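/- Let $n\ge 0$, and use coordinates $(x_1,\dots,x_n,\psi_0,\dots,\psi_n)$ on $\mathbb R^{2n+1}$. Let $\sigma^{(k)}$ and $\sigma_\mu^{(k)}$ be the $k$-th elementary symmetric polynomials in all the $x_\nu$, respectively in the $x_\nu$ with $\nu\ne\mu$. Given functions $X_\mu,N_\mu$ of one real variable ($\mu=1,\dots,n$), put $$U_\mu=\prod_{\nu\ne\mu}(x_\mu-x_\nu),\quad Q_\mu=\frac{X_\mu(x_\mu)}{U_\mu},\quad H=\sum_{\mu=1}^n\frac{N_\mu(x_\mu)}{U_\mu},\quad A=\sum_{\mu=1}^n\frac{N_\mu(x_\mu)}{U_\mu}\sum_{k=1}^n\sigma_\mu^{(k-1)}d\psi_k,$$ $$g=\sum_{\mu=1}^n\frac{dx_\mu^2}{Q_\mu}+\sum_{\mu=1}^nQ_\mu\Big(\sum_{k=1}^n\sigma_\mu^{(k-1)}d\psi_k\Big)^2+4\Big(\sum_{k=0}^n\sigma^{(k)}d\psi_k+A\Big)^2 ,$$ $$e^\mu=\frac{dx_\mu}{\sqrt{Q_\mu}},\quad e^{\hat\mu}=\sqrt{Q_\mu}\sum_{k=1}^n\sigma_\mu^{(k-1)}d\psi_k,\quad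 e^0=2\Big(\sum_{k=0}^n\sigma^{(k)}d\psi_k+A\Big),\quad T=2\sum_{\mu=1}^n\partial_\mu H\;e^\mu\wedge e^{\hat\mu}\wedge e^0 .$$ Let $D\subset\mathbb R^{2n+1}$ be any open set at each point of which the $x_\mu$ are pairwise distinct, $Q_\mu>0$, and $X_\mu,N_\mu$ are smooth at $x_\mu$, for all $\mu$. Let $(e_\mu,e_{\hat\mu},e_0)$ be the frame dual to $(e^\mu,e^{\hat\mu},e^0)$, put $\xi=e_0$, $\eta=e^0$, $\Phi(e_\mu)=e_{\hat\mu}$, $\Phi(e_{\hat\mu})=-e_\mu$, $\Phi(e_0)=0$, and $\omega(Y,Z)=g(\Phi Y,Z)$. For a metric $g$ and a 3-form $T$, $\nabla^T$ is the connection with $g(\nabla^T_YZ,W)=g(\nabla^g_YZ,W)+\tfrac12T(Y,Z,W)$, where $\nabla^g$ is the Levi-Civita connection, and $d^T\phi=\sum_ae^a\wedge\nabla^T_{e_a}\phi$. A Kähler with torsion (KT) structure is an integrable complex structure $J$ with a Hermitian metric, together with its Bismut torsion $B(Y,Z,W)=d\Omega(JY,JZ,JW)$, $\Omega(Y,Z)=g(JY,Z)$;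 the connection $\nabla^B$ satisfies $\nabla^Bg=0$ and $\nabla^BJ=0$. $(D,g,T)$ is Sasaki with torsion (ST) if the cone $(D\times\mathbb R_+,\ dr^2+r^2g)$ has a KT structure with $B=r^2T$. Then on $D$ the following hold. 1. $g$ is a Riemannian metric with orthonormal frame $(e_\mu,e_{\hat\mu},e_0)$, and $(D,g,T)$ is ST. The field $\xi$ is a Killing field of unit length with $\nabla^T_Y\xi=\Phi(Y)$, $(\nabla^T_Y\Phi)(Z)=g(\xi,Z)Y-g(Y,Z)\xi$, $d^T\eta=2\omega$, and $T(Y,Z,W)=T(Y,\Phi Z,\Phi W)+T(\Phi Y,Z,\Phi W)+T(\Phi Y,\Phi Z,W)$. 2. The cone is KT with Bismut torsion $B=r^2T$ for the complex structure $J(Y)=\Phi(Y)-r\,\eta(Y)\partial_r$ ($Y$ tangent to $D$), $J(r\partial_r)=\xi$. 3. $(g,\xi,\eta,\Phi)$ is quasi-Sasakian: it is a normal almost contact metric structure with $d\omega=0$. Moreover $\omega=\sum_\mu e^\mu\wedge e^{\hat\mu}=d\big[\sum_{k=0}^n\sigma^{(k)}d\psi_k\big]$ and $d\eta=2\sum_\mu(1+\partial_\mu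 H)\,e^\mu\wedge e^{\hat\mu}$. 4. For $k=0,\dots,n$, the field $\partial/\partial\psi_k$ is Killing for $g$ and for the cone metric, and it preserves the KT structure of the cone: $\mathcal L_{\partial/\partial\psi_k}J=0$, $\mathcal L_{\partial/\partial\psi_k}\Omega=0$, $\mathcal L_{\partial/\partial\psi_k}B=0$. 5. For $\ell=0,\dots,n$, the $(2\ell+1)$-form $\phi=\eta\wedge(d^T\eta)^\ell$ is a special Killing form with torsion: for every vector field $Y$, $$\nabla^T_Y\phi=\frac1{2\ell+2}\,Y\lrcorner\,d^T\phi,\qquad \nabla^T_Y(d^T\phi)=-2(\ell+1)\,Y^\flat\wedge\phi .$$ -/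

import Mathlib

open scoped ContDiff

set_option maxSynthPendingDepth 3

noncomputable section

namespace SasakiTorsion

/-! ### Differential forms and tensor calculus on open subsets of a real normed space

A point-dependent object on an open set `D` of `E` is a function on `E`, of which only the
values on `D` matter. -/

section Calculus

variable {E : Type*} [NormedAddCommGroup E] [NormedSpace ℝ E]

/-- Alternating `k`-forms on `E`. -/
abbrev Form (E : Type*) [NormedAddCommGroup E] [NormedSpace ℝ E] (k : ℕ) : Type _ :=
  E [⋀^Fin k]→L[ℝ] ℝ

/-- Bilinear forms on `E`. -/
abbrev Bilin (E : Type*) [NormedAddCommGroup E] [NormedSpace ℝ E] : Type _ :=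
  E →L[ℝ] E →L[ℝ] ℝ

/-- A linear functional as a `1`-form. -/
def oneForm (α : E →L[ℝ] ℝ) : Form E 1 :=
  ContinuousAlternatingMap.ofSubsingleton ℝ E ℝ (0 : Fin 1) α

/-- The multilinear map `(v₁, …, v_{p+q}) ↦ φ(v₁, …, v_p) ψ(v_{p+1}, …, v_{p+q})`. -/
def formTensor {p q : ℕ} (φ : Form E p) (ψ : Form E q) :
    ContinuousMultilinearMap ℝ (fun _ : Fin (p + q) => E) ℝ :=
  ((φ.toContinuousMultilinearMap.smulRight ψ.toContinuousMultilinearMap).uncurrySum).domDomCongr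
    finSumFinEquiv

/-- The wedge product
`(φ ∧ ψ)(v) = 1/(p! q!) ∑_σ sign σ φ(v_{σ 1}, …, v_{σ p}) ψ(v_{σ (p+1)}, …, v_{σ (p+q)})`. -/
def wedge {p q : ℕ} (φ : Form E p) (ψ : Form E q) : Form E (p + q) :=
  ((p.factorial : ℝ) * (q.factorial : ℝ))⁻¹ •
    ContinuousMultilinearMap.alternatization (formTensor φ ψ)

theorem wedge_apply {p q : ℕ} (φ : Form E p) (ψ : Form E q) (v : Fin (p + q) → E) :
    wedge φ ψ v = ((p.factorial : ℝ) * (q.factorial : ℝ))⁻¹ *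
      ∑ σ : Equiv.Perm (Fin (p + q)), Equiv.Perm.sign σ •
        (φ (fun i => v (σ (Fin.castAdd q i))) * ψ (fun j => v (σ (Fin.natAdd p j)))) := by
  simp [wedge, formTensor, ContinuousMultilinearMap.alternatization_apply_apply,
    Function.comp_def]

/-- `α ∧ φ` for a `1`-form `α` and a `p`-form `φ`, as a form of degree `p + 1`. -/
def oneWedge {p : ℕ} (α : E →L[ℝ] ℝ) (φ : Form E p) : Form E (p + 1) :=
  ContinuousAlternatingMap.alternatizeUncurryFin (α.smulRight φ)

theorem oneWedge_apply {p : ℕ} (α : E →L[ℝ] ℝ) (φ : Form E p) (v : Fin (p + 1) → E) :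
    oneWedge α φ v = ∑ i : Fin (p + 1), (-1) ^ (i : ℕ) * (α (v i) * φ (i.removeNth v)) := by
  simp [oneWedge, ContinuousAlternatingMap.alternatizeUncurryFin_apply, zsmul_eq_mul]

theorem sum_perm_succ {p : ℕ} (α : E →L[ℝ] ℝ) (φ : Form E p) (v : Fin (p + 1) → E) :
    ((p.factorial : ℝ))⁻¹ * ∑ σ : Equiv.Perm (Fin (p + 1)), Equiv.Perm.sign σ •
        (α (v (σ 0)) * φ (fun j => v (σ j.succ))) = 
      ∑ i : Fin (p + 1), (-1) ^ (i : ℕ) * (α (v i) * φ (i.removeNth v)) := by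
  have key : ∑ σ : Equiv.Perm (Fin (p + 1)), Equiv.Perm.sign σ •
        (α (v (σ 0)) * φ (fun j => v (σ j.succ))) =
      ∑ x : Fin (p + 1) × Equiv.Perm (Fin p),
        ((-1) ^ (x.1 : ℕ) * (α (v x.1) * φ (x.1.removeNth v))) := by
    symm
    refine Fintype.sum_bijective
      (fun x => x.1.cycleRange.symm * Equiv.Perm.decomposeFin.symm (0, x.2))
      ((Fintype.bijective_iff_injective_and_card _).2 ⟨?_, ?_⟩) _ _ ?_
    · rintro ⟨i, τ⟩ ⟨j, τ'⟩ h
      have h0 := congrArg (fun σ : Equiv.Perm (Fin (p + 1)) => σ 0) h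
      simp at h0
      subst h0
      simpa using h
    · simp [Fintype.card_perm, Nat.factorial_succ]
    · rintro ⟨i, τ⟩
      have h1 : (φ fun j => v (i.succAbove (τ j)))
          = Equiv.Perm.sign τ • φ (i.removeNth v) := by
        have := φ.toAlternatingMap.map_perm (i.removeNth v) τ
        exact this
      rcases Int.units_eq_one_or (Equiv.Perm.sign τ) with hs | hs <;>
        simp [h1, hs, Units.smul_def, Equiv.Perm.sign_mul]
  rw [key, Fintype.sum_prod_type]
  simp only [Finset.sum_const, Finset.card_univ, Fintype.card_perm, Fintype.card_fin, nsmul_eq_mul]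
  rw [← Finset.mul_sum, inv_mul_cancel_left₀ (by positivity)]
/-- `oneWedge` is the wedge product with a `1`-form. -/
theorem oneWedge_eq_wedge {p : ℕ} (α : E →L[ℝ] ℝ) (φ : Form E p) (v : Fin (p + 1) → E) :
    oneWedge α φ v = wedge (oneForm α) φ (fun i => v (Fin.cast (Nat.add_comm 1 p) i)) := by
  rw [oneWedge_apply, ← sum_perm_succ, wedge_apply]
  congr 1
  · simp
  · refine Fintype.sum_equiv (finCongr (Nat.add_comm p 1)).permCongr _ _ fun σ => ?_
    rw [Equiv.Perm.sign_permCongr]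
    congr 2
    refine congrArg φ (funext fun j => congrArg v ?_)
    simp only [Equiv.permCongr_apply, finCongr_apply, finCongr_symm, Fin.cast_cast, Fin.cast_eq_self]
    congr 1
    ext
    simp

/-- The power `φ ∧ ⋯ ∧ φ` (`ℓ` factors) of a `2`-form `φ`. -/
def wedgePow (φ : Form E 2) : (ℓ : ℕ) → Form E (2 * ℓ)
  | 0 => ContinuousAlternatingMap.constOfIsEmpty ℝ E (Fin 0) 1
  | ℓ + 1 => wedge (wedgePow φ ℓ) φ

/-- The derivation action of an endomorphism `A` on a `k`-form,
`(A · ψ)(v₁, …, v_k) = ∑ i, ψ(v₁, …, A v_i, …, v_k)`, as a linear function of `A`. -/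
def derivAct {k : ℕ} (ψ : Form E k) : (E →L[ℝ] E) →L[ℝ] Form E k :=
  ψ.fderivCompContinuousLinearMap (ContinuousLinearMap.id ℝ E)

theorem derivAct_apply {k : ℕ} (ψ : Form E k) (A : E →L[ℝ] E) (v : Fin k → E) :
    derivAct ψ A v = ∑ i, ψ (Function.update v i (A (v i))) := by
  simp only [derivAct, ContinuousAlternatingMap.fderivCompContinuousLinearMap_apply]
  refine Finset.sum_congr rfl fun i _ => congrArg ψ (funext fun j => ?_)
  by_cases h : j = i
  · subst h; simp
  · simp [Function.update_of_ne h]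

/-- A smooth Riemannian metric on `D`. -/
structure IsRiemannianMetric (D : Set E) (g : E → Bilin E) : Prop where
  smooth : ContDiffOn ℝ ∞ g D
  symm : ∀ p ∈ D, ∀ u v, g p u v = g p v u
  pos : ∀ p ∈ D, ∀ u, u ≠ 0 → 0 < g p u u

/-- The trilinear form `(u, v, w) ↦ T(u, v, w)` underlying a `3`-form. -/
def trilin (T : Form E 3) : E →L[ℝ] Bilin E :=
  (ContinuousLinearMap.compL ℝ E (Form E 1) (E →L[ℝ] ℝ)
      (ContinuousAlternatingMap.ofSubsingletonLIE
        (𝕜 := ℝ) (E := E) (F := ℝ) (0 : Fin 1)).symm.toContinuousLinearEquiv.toContinuousLinearMap)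
    ∘L (ContinuousAlternatingMap.curryLeftLI
        (𝕜 := ℝ) (E := E) (F := ℝ) (n := 1)).toContinuousLinearMap
    ∘L T.curryLeft

theorem trilin_apply (T : Form E 3) (u v w : E) : trilin T u v w = T ![u, v, w] := by
  have h : ∀ β : Form E 1, (ContinuousAlternatingMap.ofSubsingletonLIE
      (𝕜 := ℝ) (E := E) (F := ℝ) (0 : Fin 1)).symm β w = β ![w] := fun β =>
    congrArg β (funext fun i => by fin_cases i; rfl)
  have h' : trilin T u v w = (ContinuousAlternatingMap.ofSubsingletonLIE
      (𝕜 := ℝ) (E := E) (F := ℝ) (0 : Fin 1)).symm ((T.curryLeft u).curryLeft v) w := rfl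
  rw [h', h]
  rfl

/-- `b ↦ ((u, v) ↦ b(v, u))`. -/
def metricFlip : Bilin E →L[ℝ] Bilin E :=
  (ContinuousLinearMap.flipₗᵢ ℝ E E ℝ).toContinuousLinearEquiv.toContinuousLinearMap

/-- Twice the Koszul form of the constant vector fields `u, v, w`, with torsion term:
`(∂_u g)(v, w) + (∂_v g)(u, w) - (∂_w g)(u, v) + T(u, v, w)`. -/
def koszul (g : E → Bilin E) (T : E → Form E 3) (p : E) : E →L[ℝ] Bilin E :=
  fderiv ℝ g p + (fderiv ℝ g p).flip - metricFlip ∘L (fderiv ℝ g p).flip + trilin (T p)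

theorem koszul_apply (g : E → Bilin E) (T : E → Form E 3) (p u v w : E) :
    koszul g T p u v w = fderiv ℝ g p u v w + fderiv ℝ g p v u w - fderiv ℝ g p w u v
      + T p ![u, v, w] := by
  simp [koszul, trilin_apply, metricFlip]

/-- The connection coefficients `Γ^T(u, v)` of the connection with totally skew-symmetric
torsion `T`: for constant vector fields, `g(Γ^T(u, v), w) = g(∇^g_u v, w) + T(u, v, w) / 2`
with `∇^g` the Levi-Civita connection (given by the Koszul formula).  The covariant derivative
of a vector field `Y` is `∇^T_u Y = ∂_u Y + Γ^T(u, Y)`. -/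
def conn (g : E → Bilin E) (T : E → Form E 3) (p : E) : E →L[ℝ] E →L[ℝ] E :=
  (2⁻¹ : ℝ) • ((ContinuousLinearMap.compL ℝ E (E →L[ℝ] ℝ) E (g p).inverse) ∘L koszul g T p)

/-- `∇^T_u Y` for a vector field `Y`. -/
def covVec (g : E → Bilin E) (T : E → Form E 3) (Y : E → E) (p u : E) : E :=
  fderiv ℝ Y p u + conn g T p u (Y p)

/-- `∇^T_u A` for an endomorphism field `A`. -/
def covEnd (g : E → Bilin E) (T : E → Form E 3) (A : E → E →L[ℝ] E) (p u : E) : E →L[ℝ] E :=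
  fderiv ℝ A p u + (conn g T p u) ∘L A p - A p ∘L (conn g T p u)

/-- `u ↦ ∇^T_u ψ` for a `k`-form `ψ`. -/
def covForm {k : ℕ} (g : E → Bilin E) (T : E → Form E 3) (ψ : E → Form E k) (p : E) :
    E →L[ℝ] Form E k :=
  fderiv ℝ ψ p - derivAct (ψ p) ∘L conn g T p

/-- `d^T ψ = ∑ₐ eᵃ ∧ ∇^T_{eₐ} ψ`, written without a frame:
`(d^T ψ)(v₀, …, v_k) = ∑ i, (-1)^i (∇^T_{v_i} ψ)(v₀, …, v̂_i, …, v_k)`. -/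
def dT {k : ℕ} (g : E → Bilin E) (T : E → Form E 3) (ψ : E → Form E k) (p : E) :
    Form E (k + 1) :=
  ContinuousAlternatingMap.alternatizeUncurryFin (covForm g T ψ p)

/-- `L_V g (u, w)` for a bilinear form field `g`. -/
def lieMetric (V : E → E) (g : E → Bilin E) (p u w : E) : ℝ :=
  fderiv ℝ g p (V p) u w + g p (fderiv ℝ V p u) w + g p u (fderiv ℝ V p w)

/-- `L_V A` for an endomorphism field `A`. -/
def lieEnd (V : E → E) (A : E → E →L[ℝ] E) (p : E) : E →L[ℝ] E :=
  fderiv ℝ A p (V p) - fderiv ℝ V p ∘L A p + A p ∘L fderiv ℝ V p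

/-- `L_V ψ` for a `k`-form `ψ`. -/
def lieForm {k : ℕ} (V : E → E) (ψ : E → Form E k) (p : E) : Form E k :=
  fderiv ℝ ψ p (V p) + derivAct (ψ p) (fderiv ℝ V p)

/-- A smooth Killing vector field on `D`. -/
structure IsKilling (D : Set E) (g : E → Bilin E) (V : E → E) : Prop where
  smooth : ContDiffOn ℝ ∞ V D
  lie : ∀ p ∈ D, ∀ u w, lieMetric V g p u w = 0

/-- The Nijenhuis tensor `[AX, AY] + A²[X, Y] - A[X, AY] - A[AX, Y]`, evaluated on the constant
vector fields `X = u`, `Y = v` (it is tensorial in `X` and `Y`). -/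
def nijenhuis (A : E → E →L[ℝ] E) (p u v : E) : E :=
  VectorField.lieBracket ℝ (fun q => A q u) (fun q => A q v) p
    + A p (A p (VectorField.lieBracket ℝ (fun _ => u) (fun _ => v) p))
    - A p (VectorField.lieBracket ℝ (fun _ => u) (fun q => A q v) p)
    - A p (VectorField.lieBracket ℝ (fun q => A q u) (fun _ => v) p)

/-- The `2`-form `(u, v) ↦ (g(A u, v) - g(A v, u)) / 2`; it is `(u, v) ↦ g(A u, v)` whenever the
latter is skew-symmetric (as for a Hermitian or an almost contact metric structure). -/
def fundForm (g : E → Bilin E) (A : E → E →L[ℝ] E) (p : E) : Form E 2 :=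
  (2⁻¹ : ℝ) • ContinuousAlternatingMap.alternatizeUncurryFin
    ((ContinuousAlternatingMap.ofSubsingletonLIE
        (𝕜 := ℝ) (E := E) (F := ℝ) (0 : Fin 1)).toContinuousLinearEquiv.toContinuousLinearMap
      ∘L g p ∘L A p)

theorem fundForm_apply (g : E → Bilin E) (A : E → E →L[ℝ] E) (p u v : E)
    (h : g p (A p v) u = - g p (A p u) v) :
    fundForm g A p ![u, v] = g p (A p u) v := by
  simp [fundForm, ContinuousAlternatingMap.alternatizeUncurryFin_apply, Fin.sum_univ_two,
    ContinuousAlternatingMap.ofSubsingletonLIE, Fin.removeNth, h]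
  ring

/-! ### Hermitian, Kähler with torsion, and Sasaki with torsion structures -/

/-- `J` is an integrable complex structure on `D`, and `g` is a Hermitian metric for it. -/
structure IsHermitian (D : Set E) (g : E → Bilin E) (J : E → E →L[ℝ] E) : Prop where
  metric : IsRiemannianMetric D g
  smooth : ContDiffOn ℝ ∞ J D
  sq : ∀ p ∈ D, ∀ u, J p (J p u) = -u
  integrable : ∀ p ∈ D, ∀ u v, nijenhuis J p u v = 0
  compat : ∀ p ∈ D, ∀ u v, g p (J p u) (J p v) = g p u v

/-- `(D, g, J)` is Kähler with torsion with Bismut torsion `B`: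
`(D, g, J)` is Hermitian, `B(u, v, w) = dΩ(J u, J v, J w)` for the fundamental form
`Ω(u, v) = g(J u, v)`, and the connection `∇^B` with totally skew-symmetric torsion `B` is
Hermitian (`∇^B g = 0`, `∇^B J = 0`). -/
structure IsKahlerWithTorsion (D : Set E) (g : E → Bilin E) (J : E → E →L[ℝ] E)
    (B : E → Form E 3) : Prop where
  hermitian : IsHermitian D g J
  smooth : ContDiffOn ℝ ∞ B D
  bismut : ∀ p ∈ D,
    B p = (extDeriv (fundForm g J) p).compContinuousLinearMap (J p)
  parallel_metric : ∀ p ∈ D, ∀ u v w,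
    fderiv ℝ g p u v w - g p (conn g B p u v) w - g p v (conn g B p u w) = 0
  parallel_complex : ∀ p ∈ D, ∀ u, covEnd g B J p u = 0

/-- The domain `D × (0, ∞)` of the cone over `D`. -/
def coneDomain (D : Set E) : Set (E × ℝ) := D ×ˢ Set.Ioi 0

/-- The cone metric `dr² + r² g`. -/
def coneMetric (g : E → Bilin E) (q : E × ℝ) : Bilin (E × ℝ) :=
  (ContinuousLinearMap.snd ℝ E ℝ).smulRight (ContinuousLinearMap.snd ℝ E ℝ)
    + (q.2 ^ 2) • (g q.1).bilinearComp
        (ContinuousLinearMap.fst ℝ E ℝ) (ContinuousLinearMap.fst ℝ E ℝ)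

/-- The `k`-form `r² ψ` on the cone. -/
def coneForm {k : ℕ} (ψ : E → Form E k) (q : E × ℝ) : Form (E × ℝ) k :=
  (q.2 ^ 2) • (ψ q.1).compContinuousLinearMap (ContinuousLinearMap.fst ℝ E ℝ)

/-- `(D, g, T)` is Sasaki with torsion: its metric cone is Kähler with torsion, for some complex
structure, with Bismut torsion `r² T`. -/
structure IsSasakiWithTorsion (D : Set E) (g : E → Bilin E) (T : E → Form E 3) : Prop where
  metric : IsRiemannianMetric D g
  smooth : ContDiffOn ℝ ∞ T D
  cone : ∃ J : E × ℝ → (E × ℝ) →L[ℝ] (E × ℝ),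
    IsKahlerWithTorsion (coneDomain D) (coneMetric g) J (coneForm T)

/-- The structure tensors `(ξ, Φ)` of a Sasaki with torsion structure: `ξ` is a unit Killing field,
`Φ = ∇^T ξ`, `(∇^T_u Φ)(v) = g(ξ, v) u - g(u, v) ξ`, and
`T(u, v, w) = T(u, Φ v, Φ w) + T(Φ u, v, Φ w) + T(Φ u, Φ v, w)`. -/
structure IsSTStructure (D : Set E) (g : E → Bilin E) (T : E → Form E 3)
    (ξ : E → E) (Φ : E → E →L[ℝ] E) : Prop where
  killing : IsKilling D g ξ
  unit : ∀ p ∈ D, g p (ξ p) (ξ p) = 1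
  smooth : ContDiffOn ℝ ∞ Φ D
  cov_vec : ∀ p ∈ D, ∀ u, covVec g T ξ p u = Φ p u
  cov_end : ∀ p ∈ D, ∀ u v, covEnd g T Φ p u v = g p (ξ p) v • u - g p u v • ξ p
  torsion : ∀ p ∈ D, ∀ u v w, T p ![u, v, w] =
    T p ![u, Φ p v, Φ p w] + T p ![Φ p u, v, Φ p w] + T p ![Φ p u, Φ p v, w]

/-- An almost contact metric structure on `D`. -/
structure IsAlmostContactMetric (D : Set E) (g : E → Bilin E) (ξ : E → E) (η : E → E →L[ℝ] ℝ)
    (Φ : E → E →L[ℝ] E) : Prop where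
  metric : IsRiemannianMetric D g
  smooth_vec : ContDiffOn ℝ ∞ ξ D
  smooth_form : ContDiffOn ℝ ∞ η D
  smooth_end : ContDiffOn ℝ ∞ Φ D
  form_vec : ∀ p ∈ D, η p (ξ p) = 1
  sq : ∀ p ∈ D, ∀ u, Φ p (Φ p u) = -u + η p u • ξ p
  compat : ∀ p ∈ D, ∀ u v, g p (Φ p u) (Φ p v) = g p u v - η p u * η p v

/-- A quasi-Sasakian structure: a normal almost contact metric structure
(`N_Φ + dη ⊗ ξ = 0`) whose fundamental form `ω(u, v) = g(Φ u, v)` is closed. -/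
structure IsQuasiSasakian (D : Set E) (g : E → Bilin E) (ξ : E → E) (η : E → E →L[ℝ] ℝ)
    (Φ : E → E →L[ℝ] E) : Prop where
  contact : IsAlmostContactMetric D g ξ η Φ
  normal : ∀ p ∈ D, ∀ u v,
    nijenhuis Φ p u v + extDeriv (fun q => oneForm (η q)) p ![u, v] • ξ p = 0
  closed : ∀ p ∈ D, extDeriv (fundForm g Φ) p = 0

/-- A special Killing `k`-form with torsion `T` and constant `c`:
`∇^T_u φ = u ⌟ d^T φ / (k + 1)` and `∇^T_u (d^T φ) = c u♭ ∧ φ`. -/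
structure IsSpecialKilling {k : ℕ} (D : Set E) (g : E → Bilin E) (T : E → Form E 3)
    (φ : E → Form E k) (c : ℝ) : Prop where
  smooth : ContDiffOn ℝ ∞ φ D
  killing : ∀ p ∈ D, ∀ u, covForm g T φ p u = ((k : ℝ) + 1)⁻¹ • (dT g T φ p).curryLeft u
  special : ∀ p ∈ D, ∀ u, covForm g T (dT g T φ) p u = c • oneWedge (g p u) (φ p)

end Calculus

/-! ### The explicit metric -/

section LocalMetric

/-- Local coordinates `(x_1, …, x_n, ψ_0, …, ψ_n)`. -/
abbrev Coord (n : ℕ) : Type := (Fin n → ℝ) × (Fin (n + 1) → ℝ)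

variable {n : ℕ}

/-- The coordinate differential `dx_μ`. -/
def dx (μ : Fin n) : Coord n →L[ℝ] ℝ :=
  (ContinuousLinearMap.proj μ) ∘L (ContinuousLinearMap.fst ℝ (Fin n → ℝ) (Fin (n + 1) → ℝ))

/-- The coordinate differential `dψ_k`. -/
def dpsi (k : Fin (n + 1)) : Coord n →L[ℝ] ℝ :=
  (ContinuousLinearMap.proj k) ∘L (ContinuousLinearMap.snd ℝ (Fin n → ℝ) (Fin (n + 1) → ℝ))

/-- The coordinate vector field `∂/∂ψ_k`. -/
def partialPsi (k : Fin (n + 1)) (_ : Coord n) : Coord n := (0, Pi.single k 1)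

/-- `σ^{(k)}`, the elementary symmetric polynomial of degree `k` in all the `x_ν`. -/
def sigma (k : ℕ) (x : Fin n → ℝ) : ℝ :=
  ∑ s ∈ (Finset.univ : Finset (Fin n)).powersetCard k, ∏ ν ∈ s, x ν

/-- `σ_μ^{(k)}`, the elementary symmetric polynomial of degree `k` in the `x_ν`, `ν ≠ μ`. -/
def sigmaOmit (μ : Fin n) (k : ℕ) (x : Fin n → ℝ) : ℝ :=
  ∑ s ∈ (Finset.univ.erase μ).powersetCard k, ∏ ν ∈ s, x ν

/-- `U_μ = ∏_{ν ≠ μ} (x_μ - x_ν)`. -/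
def U (μ : Fin n) (x : Fin n → ℝ) : ℝ := ∏ ν ∈ Finset.univ.erase μ, (x μ - x ν)

/-- `Q_μ = X_μ(x_μ) / U_μ`. -/
def Q (X : Fin n → ℝ → ℝ) (μ : Fin n) (x : Fin n → ℝ) : ℝ := X μ (x μ) / U μ x

/-- `H = ∑_μ N_μ(x_μ) / U_μ`. -/
def H (N : Fin n → ℝ → ℝ) (x : Fin n → ℝ) : ℝ := ∑ μ, N μ (x μ) / U μ x

/-- `∂_μ H`. -/
def dH (N : Fin n → ℝ → ℝ) (μ : Fin n) (x : Fin n → ℝ) : ℝ :=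
  fderiv ℝ (H N) x (Pi.single μ 1)

/-- `∑_{k=1}^n σ_μ^{(k-1)} dψ_k`. -/
def theta (μ : Fin n) (x : Fin n → ℝ) : Coord n →L[ℝ] ℝ :=
  ∑ k : Fin n, sigmaOmit μ k x • dpsi k.succ

/-- `∑_{k=0}^n σ^{(k)} dψ_k`. -/
def sigmaForm (x : Fin n → ℝ) : Coord n →L[ℝ] ℝ :=
  ∑ k : Fin (n + 1), sigma k x • dpsi k

/-- `A = ∑_μ (N_μ / U_μ) ∑_{k=1}^n σ_μ^{(k-1)} dψ_k`. -/
def potA (N : Fin n → ℝ → ℝ) (x : Fin n → ℝ) : Coord n →L[ℝ] ℝ :=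
  ∑ μ, (N μ (x μ) / U μ x) • theta μ x

/-- The metric
`∑_μ dx_μ² / Q_μ + ∑_μ Q_μ (∑_k σ_μ^{(k-1)} dψ_k)² + 4 (∑_k σ^{(k)} dψ_k + A)²`. -/
def metric (X N : Fin n → ℝ → ℝ) (p : Coord n) : Bilin (Coord n) :=
  ∑ μ, (Q X μ p.1)⁻¹ • (dx μ).smulRight (dx μ)
    + ∑ μ, Q X μ p.1 • (theta μ p.1).smulRight (theta μ p.1)
    + (4 : ℝ) • (sigmaForm p.1 + potA N p.1).smulRight (sigmaForm p.1 + potA N p.1)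

/-- `e^μ = dx_μ / √Q_μ`. -/
def eForm (X : Fin n → ℝ → ℝ) (μ : Fin n) (p : Coord n) : Coord n →L[ℝ] ℝ :=
  (Real.sqrt (Q X μ p.1))⁻¹ • dx μ

/-- `e^μ̂ = √Q_μ ∑_k σ_μ^{(k-1)} dψ_k`. -/
def eHatForm (X : Fin n → ℝ → ℝ) (μ : Fin n) (p : Coord n) : Coord n →L[ℝ] ℝ :=
  Real.sqrt (Q X μ p.1) • theta μ p.1

/-- `η = e^0 = 2 (∑_k σ^{(k)} dψ_k + A)`. -/
def eta (N : Fin n → ℝ → ℝ) (p : Coord n) : Coord n →L[ℝ] ℝ :=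
  (2 : ℝ) • (sigmaForm p.1 + potA N p.1)

/-- The coframe `(e^μ, e^μ̂, e^0)`. -/
def coframe (X N : Fin n → ℝ → ℝ) (p : Coord n) :
    Fin n ⊕ Fin n ⊕ Unit → Coord n →L[ℝ] ℝ
  | .inl μ => eForm X μ p
  | .inr (.inl μ) => eHatForm X μ p
  | .inr (.inr _) => eta N p

/-- The dual frame `(e_μ, e_μ̂, e_0)` of the coframe. -/
def frame (X N : Fin n → ℝ → ℝ) (p : Coord n) (a : Fin n ⊕ Fin n ⊕ Unit) : Coord n :=
  (ContinuousLinearMap.pi (coframe X N p)).inverse (Pi.single a 1)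

/-- `ξ = e_0`. -/
def xi (X N : Fin n → ℝ → ℝ) (p : Coord n) : Coord n := frame X N p (.inr (.inr ()))

/-- The endomorphism with `Φ(e_μ) = e_μ̂`, `Φ(e_μ̂) = -e_μ`, `Φ(e_0) = 0`. -/
def Phi (X N : Fin n → ℝ → ℝ) (p : Coord n) : Coord n →L[ℝ] Coord n :=
  ∑ μ, ((eForm X μ p).smulRight (frame X N p (.inr (.inl μ)))
    - (eHatForm X μ p).smulRight (frame X N p (.inl μ)))

/-- The torsion `T = 2 ∑_μ ∂_μ H e^μ ∧ e^μ̂ ∧ e^0`. -/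
def torsion (X N : Fin n → ℝ → ℝ) (p : Coord n) : Form (Coord n) 3 :=
  (2 : ℝ) • ∑ μ, dH N μ p.1 •
    oneWedge (eForm X μ p) (oneWedge (eHatForm X μ p) (oneForm (eta N p)))

/-- The complex structure of the cone: with `ē_r = ∂_r` and `ē_a = e_a / r`,
`J(ē_r) = ē_0`, `J(ē_0) = -ē_r`, `J(ē_μ) = ē_μ̂`, `J(ē_μ̂) = -ē_μ`; that is,
`J(u) = Φ(u) - r η(u) ∂_r` for `u` tangent to the base, and `J(r ∂_r) = ξ`. -/
def coneJ (X N : Fin n → ℝ → ℝ) (q : Coord n × ℝ) :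
    (Coord n × ℝ) →L[ℝ] (Coord n × ℝ) :=
  ContinuousLinearMap.prod
    (Phi X N q.1 ∘L ContinuousLinearMap.fst ℝ (Coord n) ℝ
      + (ContinuousLinearMap.snd ℝ (Coord n) ℝ).smulRight (q.2⁻¹ • xi X N q.1))
    (-(q.2 • (eta N q.1 ∘L ContinuousLinearMap.fst ℝ (Coord n) ℝ)))

/-- The form `η ∧ (d^T η)^ℓ`, of degree `2ℓ + 1`. -/
def etaPow (X N : Fin n → ℝ → ℝ) (ℓ : ℕ) (p : Coord n) : Form (Coord n) (2 * ℓ + 1) :=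
  oneWedge (eta N p)
    (wedgePow (dT (metric X N) (torsion X N) (fun q => oneForm (eta N q)) p) ℓ)

end LocalMetric

end SasakiTorsion

end

namespace SasakiTorsion

/-! ### Alternating trilinear forms and metrics -/

section Generic

variable {E : Type*} [NormedAddCommGroup E] [NormedSpace ℝ E]

/-! The proof separates the explicit geometry from a general mechanism. Write `θ_μ = ∑_k σ_μ^{(k-1)}
dψ_k`. Identities for elementary symmetric polynomials give `d(∑_k σ^{(k)} dψ_k) = ∑_μ dx_μ ∧ θ_μ =
ω` (`fderiv_sigmaForm`) and `dA = ∑_μ ∂_μH dx_μ ∧ θ_μ` (`IsRegularAt.fderiv_potA`). Hence `ω` is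
exact and `dη = 2ω + κ`, where `κ = 2 ∑_μ ∂_μH e^μ ∧ e^μ̂` is horizontal and `Φ`-invariant, and the
torsion is `T = κ ∧ η`. Moreover `ξ = ½ ∂/∂ψ_0` is Killing, because no coefficient depends on the
`ψ_k`. `IsReebTorsion` records exactly these facts, and the general theory uses nothing else about
the metric except, for integrability, a supply of closed forms.

Integrability comes from the closed forms `dψ_k`, `k ≥ 1`. Their transposes `dψ_k ∘ Φ` are sums of
`f_μ(x_μ) dx_μ`, hence closed as well, so these pairs act as differentials of transverse holomorphic
coordinates. The Nijenhuis tensor paired with such a form vanishes (`apply_nijenhuis`), and `η`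
accounts for the remaining component. On the cone the pair `(η, dr/r)` is added, which makes `J`
integrable.

The covariant derivatives come from one algebraic lemma, `eq_zero_of_skew_of_cyclic_of_nijenhuis`.
On the base it is applied to the difference of the two sides of the formula for `∇^T Φ`, where `dω =
0` supplies the cyclic identity. On the cone it is applied to `∇^B J`, where the cyclic identity
comes from `B = dΩ(J, J, J)` together with the type of `B`. The form is `Ω = r² ω + r dr ∧ η`, so
`dΩ = -r dr ∧ κ`, and composition with `J` turns this into `r² κ ∧ η = r² T`.

The special Killing equations follow from `∇^T_u η = u ⌟ ω` and `∇^T_u ω = -u♭ ∧ η` by the Leibniz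
rule, `η ∧ η = 0` and `u ⌟ ω^{ℓ+1} = (ℓ+1) (u ⌟ ω) ∧ ω^ℓ`. -/

theorem form_three_swap (T : Form E 3) (u v w : E) : T ![v, u, w] = -T ![u, v, w] := by
  have h := T.toAlternatingMap.map_swap ![u, v, w] (i := 0) (j := 1) (by decide)
  have e : (![u, v, w] ∘ Equiv.swap (0 : Fin 3) 1) = ![v, u, w] := by
    funext i; fin_cases i <;> rfl
  rw [e] at h
  exact h

theorem form_three_swap' (T : Form E 3) (u v w : E) : T ![u, w, v] = -T ![u, v, w] := by
  have h := T.toAlternatingMap.map_swap ![u, v, w] (i := 1) (j := 2) (by decide)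
  have e : (![u, v, w] ∘ Equiv.swap (1 : Fin 3) 2) = ![u, w, v] := by
    funext i; fin_cases i <;> rfl
  rw [e] at h
  exact h

theorem form_three_rotate (T : Form E 3) (u v w : E) : T ![v, w, u] = T ![u, v, w] := by
  rw [form_three_swap', form_three_swap, neg_neg]

theorem form_two_ext {φ ψ : Form E 2} (h : ∀ u v, φ ![u, v] = ψ ![u, v]) : φ = ψ := by
  ext x
  have : x = ![x 0, x 1] := by funext i; fin_cases i <;> rfl
  rw [this, h]

theorem form_three_ext {φ ψ : Form E 3} (h : ∀ u v w, φ ![u, v, w] = ψ ![u, v, w]) : φ = ψ := by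
  ext x
  have : x = ![x 0, x 1, x 2] := by funext i; fin_cases i <;> rfl
  rw [this, h]

theorem form_two_swap (φ : Form E 2) (u v : E) : φ ![v, u] = -φ ![u, v] := by
  have h := φ.toAlternatingMap.map_swap ![u, v] (i := 0) (j := 1) (by decide)
  have e : (![u, v] ∘ Equiv.swap (0 : Fin 2) 1) = ![v, u] := by
    funext i; fin_cases i <;> rfl
  rw [e] at h
  exact h

@[simp] theorem oneForm_apply (α : E →L[ℝ] ℝ) (v : Fin 1 → E) : oneForm α v = α (v 0) := rfl

theorem oneWedge_oneForm_apply (α β : E →L[ℝ] ℝ) (u v : E) :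
    oneWedge α (oneForm β) ![u, v] = α u * β v - α v * β u := by
  simp [oneWedge_apply, Fin.sum_univ_two, Fin.removeNth]
  ring

theorem extDeriv_two_apply {φ : E → Form E 1} {p : E} (u v : E) :
    extDeriv φ p ![u, v] = fderiv ℝ φ p u ![v] - fderiv ℝ φ p v ![u] := by
  refine (ContinuousAlternatingMap.alternatizeUncurryFin_apply _ _).trans
    ((Fin.sum_univ_two _).trans ?_)
  have h0 : (0 : Fin 2).removeNth ![u, v] = ![v] := by funext i; fin_cases i; rfl
  have h1 : (1 : Fin 2).removeNth ![u, v] = ![u] := by funext i; fin_cases i; rfl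
  simp [h0, h1]
  ring

theorem extDeriv_three_apply {φ : E → Form E 2} {p : E} (u v w : E) :
    extDeriv φ p ![u, v, w] = fderiv ℝ φ p u ![v, w] + fderiv ℝ φ p v ![w, u]
      + fderiv ℝ φ p w ![u, v] := by
  refine (ContinuousAlternatingMap.alternatizeUncurryFin_apply _ _).trans
    ((Fin.sum_univ_three _).trans ?_)
  have h0 : (0 : Fin 3).removeNth ![u, v, w] = ![v, w] := by funext i; fin_cases i <;> rfl
  have h1 : (1 : Fin 3).removeNth ![u, v, w] = ![u, w] := by funext i; fin_cases i <;> rfl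
  have h2 : (2 : Fin 3).removeNth ![u, v, w] = ![u, v] := by funext i; fin_cases i <;> rfl
  simp [h0, h1, h2, form_two_swap _ u w]

theorem fderiv_form_apply {k : ℕ} {φ : E → Form E k} {p : E} (h : DifferentiableAt ℝ φ p)
    (u : E) (v : Fin k → E) : fderiv ℝ (fun q => φ q v) p u = fderiv ℝ φ p u v := by
  have := (ContinuousAlternatingMap.apply ℝ E ℝ v).hasFDerivAt.comp p h.hasFDerivAt
  exact congrArg (fun L : E →L[ℝ] ℝ => L u) this.fderiv

theorem fderiv_oneForm {η : E → E →L[ℝ] ℝ} {p : E} (h : DifferentiableAt ℝ η p) (u : E) :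
    fderiv ℝ (fun q => oneForm (η q)) p u = oneForm (fderiv ℝ η p u) := by
  have := ((ContinuousAlternatingMap.ofSubsingletonLIE (𝕜 := ℝ) (E := E) (F := ℝ)
    (0 : Fin 1)).toContinuousLinearEquiv.toContinuousLinearMap.hasFDerivAt.comp p h.hasFDerivAt)
  exact congrArg (fun L : E →L[ℝ] Form E 1 => L u) this.fderiv

theorem contDiff_oneForm : ContDiff ℝ ∞ (oneForm : (E →L[ℝ] ℝ) → Form E 1) :=
  (ContinuousAlternatingMap.ofSubsingletonLIE (𝕜 := ℝ) (E := E) (F := ℝ)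
    (0 : Fin 1)).contDiff

theorem extDeriv_oneForm_apply {η : E → E →L[ℝ] ℝ} {p : E} (h : DifferentiableAt ℝ η p)
    (u v : E) : extDeriv (fun q => oneForm (η q)) p ![u, v]
      = fderiv ℝ η p u v - fderiv ℝ η p v u := by
  rw [extDeriv_two_apply, fderiv_oneForm h, fderiv_oneForm h]
  rfl

theorem contDiffOn_fundForm {D : Set E} {g : E → Bilin E} {A : E → E →L[ℝ] E}
    (hg : ContDiffOn ℝ ∞ g D) (hA : ContDiffOn ℝ ∞ A D) : ContDiffOn ℝ ∞ (fundForm g A) D := by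
  have : ContDiffOn ℝ ∞ (fun p => (ContinuousAlternatingMap.ofSubsingletonLIE
        (𝕜 := ℝ) (E := E) (F := ℝ) (0 : Fin 1)).toContinuousLinearEquiv.toContinuousLinearMap
      ∘L g p ∘L A p) D := contDiffOn_const.clm_comp (hg.clm_comp hA)
  exact ((ContinuousAlternatingMap.alternatizeUncurryFinCLM ℝ E ℝ).contDiff.comp_contDiffOn
    this).const_smul (2⁻¹ : ℝ)

variable {D : Set E} {g : E → Bilin E}

theorem IsRiemannianMetric.eq_of_forall (hg : IsRiemannianMetric D g) {p : E} (hp : p ∈ D)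
    {a b : E} (h : ∀ w, g p a w = g p b w) : a = b := by
  by_contra hne
  have := hg.pos p hp (a - b) (sub_ne_zero.2 hne)
  simp [h] at this

/-- `ContinuousLinearMap.inverse` is zero on a map that is not invertible, so `conn` has its
intended meaning only because `g p` is an isomorphism onto the dual: positivity gives injectivity,
and equality of dimensions gives the rest. -/
theorem IsRiemannianMetric.apply_inverse [FiniteDimensional ℝ E]
    (hg : IsRiemannianMetric D g) {p : E} (hp : p ∈ D)
    (α : E →L[ℝ] ℝ) : g p ((g p).inverse α) = α := by
  have hinj : Function.Injective (g p : E →ₗ[ℝ] (E →L[ℝ] ℝ)) := fun a b hab =>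
    hg.eq_of_forall hp fun w => congrArg (fun L : E →L[ℝ] ℝ => L w) hab
  have hrank : Module.finrank ℝ E = Module.finrank ℝ (E →L[ℝ] ℝ) := by
    rw [← LinearEquiv.finrank_eq (LinearMap.toContinuousLinearMap : (E →ₗ[ℝ] ℝ) ≃ₗ[ℝ] E →L[ℝ] ℝ)]
    exact (Subspace.dual_finrank_eq).symm
  have hbij : Function.Bijective (g p : E →ₗ[ℝ] (E →L[ℝ] ℝ)) :=
    ⟨hinj, (LinearMap.injective_iff_surjective_of_finrank_eq_finrank hrank).1 hinj⟩
  let e : E ≃L[ℝ] (E →L[ℝ] ℝ) := (LinearEquiv.ofBijective _ hbij).toContinuousLinearEquiv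
  have he : g p = (e : E →L[ℝ] (E →L[ℝ] ℝ)) := by ext a b; rfl
  rw [he, ContinuousLinearMap.inverse_equiv]
  simp

/-- The Koszul formula is used only to derive metric compatibility and the torsion identity below.
Afterwards `conn` is an opaque bilinear map with these two properties. -/
theorem IsRiemannianMetric.apply_conn [FiniteDimensional ℝ E] (hg : IsRiemannianMetric D g) {p : E} (hp : p ∈ D)
    (T : E → Form E 3) (u v w : E) :
    g p (conn g T p u v) w = 2⁻¹ * (fderiv ℝ g p u v w + fderiv ℝ g p v u w
      - fderiv ℝ g p w u v + T p ![u, v, w]) := by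
  have : g p (conn g T p u v) = (2⁻¹ : ℝ) • koszul g T p u v := by
    simp [conn, hg.apply_inverse hp]
  rw [this, ← koszul_apply]
  rfl

theorem IsRiemannianMetric.differentiableAt (hD : IsOpen D) (hg : IsRiemannianMetric D g) {p : E} (hp : p ∈ D) :
    DifferentiableAt ℝ g p :=
  (hg.smooth.contDiffAt (hD.mem_nhds hp)).differentiableAt (by simp)

theorem IsRiemannianMetric.fderiv_symm (hD : IsOpen D) (hg : IsRiemannianMetric D g) {p : E} (hp : p ∈ D)
    (u v w : E) : fderiv ℝ g p u v w = fderiv ℝ g p u w v := by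
  have hd := hg.differentiableAt hD hp
  have key : ∀ a b, fderiv ℝ (fun q => g q a b) p u = fderiv ℝ g p u a b := fun a b => by
    have := ((hd.hasFDerivAt.clm_apply (hasFDerivAt_const a p)).clm_apply
      (hasFDerivAt_const b p)).fderiv
    rw [this]; simp
  rw [← key, ← key]
  refine congrArg (fun L : E →L[ℝ] ℝ => L u) (Filter.EventuallyEq.fderiv_eq ?_)
  filter_upwards [hD.mem_nhds hp] with q hq using hg.symm q hq v w

/-- `∇^T g = 0`. -/
theorem IsRiemannianMetric.fderiv_eq_conn [FiniteDimensional ℝ E] (hD : IsOpen D)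
    (hg : IsRiemannianMetric D g) {p : E} (hp : p ∈ D)
    (T : E → Form E 3) (u v w : E) :
    fderiv ℝ g p u v w = g p (conn g T p u v) w + g p v (conn g T p u w) := by
  rw [hg.symm p hp v, hg.apply_conn hp, hg.apply_conn hp, hg.fderiv_symm hD hp u w v,
    hg.fderiv_symm hD hp w u v, hg.fderiv_symm hD hp v u w, form_three_swap' (T p) u v w]
  ring

/-- The torsion of `∇^T` is `T`. -/
theorem IsRiemannianMetric.conn_sub_conn [FiniteDimensional ℝ E] (hD : IsOpen D)
    (hg : IsRiemannianMetric D g) {p : E} (hp : p ∈ D)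
    (T : E → Form E 3) (u v w : E) :
    g p (conn g T p u v - conn g T p v u) w = T p ![u, v, w] := by
  rw [map_sub, sub_apply, hg.apply_conn hp, hg.apply_conn hp,
    hg.fderiv_symm hD hp w u v, form_three_swap (T p) u v w]
  ring

end Generic

end SasakiTorsion

namespace SasakiTorsion

/-! ### The Nijenhuis tensor and the covariant derivative of an endomorphism field -/

section Nijenhuis

variable {E : Type*} [NormedAddCommGroup E] [NormedSpace ℝ E]

theorem fderiv_clm_apply_const {F G : Type*} [NormedAddCommGroup F] [NormedSpace ℝ F]
    [NormedAddCommGroup G] [NormedSpace ℝ G] {A : E → F →L[ℝ] G} {p : E}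
    (hA : DifferentiableAt ℝ A p) (v : F) (u : E) :
    fderiv ℝ (fun q => A q v) p u = fderiv ℝ A p u v := by
  have := (hA.hasFDerivAt.clm_apply (hasFDerivAt_const v p)).fderiv
  rw [this]
  simp

theorem nijenhuis_eq {A : E → E →L[ℝ] E} {p : E} (hA : DifferentiableAt ℝ A p) (u v : E) :
    nijenhuis A p u v = fderiv ℝ A p (A p u) v - fderiv ℝ A p (A p v) u
      - A p (fderiv ℝ A p u v) + A p (fderiv ℝ A p v u) := by
  simp only [nijenhuis, VectorField.lieBracket, fderiv_clm_apply_const hA]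
  simp

/-- If `β = α ∘ A` and `γ = β ∘ A`, then `α ∘ N_A` only depends on `dα`, `dβ`, `dγ`. -/
theorem apply_nijenhuis {A : E → E →L[ℝ] E} {α β γ : E → E →L[ℝ] ℝ} {p : E}
    (hA : DifferentiableAt ℝ A p) (hα : DifferentiableAt ℝ α p) (hβ : DifferentiableAt ℝ β p)
    (hγ : DifferentiableAt ℝ γ p) (h1 : ∀ᶠ q in nhds p, ∀ v, α q (A q v) = β q v)
    (h2 : ∀ᶠ q in nhds p, ∀ v, β q (A q v) = γ q v) (u v : E) :
    α p (nijenhuis A p u v) =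
      -(fderiv ℝ α p (A p u) (A p v) - fderiv ℝ α p (A p v) (A p u))
      + (fderiv ℝ β p u (A p v) - fderiv ℝ β p (A p v) u)
      + (fderiv ℝ β p (A p u) v - fderiv ℝ β p v (A p u))
      - (fderiv ℝ γ p u v - fderiv ℝ γ p v u) := by
  -- Differentiating `α(A v) = β v` expresses `α ∘ ∂_w A` through the derivatives of `α` and `β`
  -- alone.
  have key : ∀ {α β : E → E →L[ℝ] ℝ}, DifferentiableAt ℝ α p → DifferentiableAt ℝ β p →
      (∀ᶠ q in nhds p, ∀ v, α q (A q v) = β q v) → ∀ w v,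
      α p (fderiv ℝ A p w v) = fderiv ℝ β p w v - fderiv ℝ α p w (A p v) := by
    intro α β hα hβ h w v
    have e : fderiv ℝ (fun q => α q (A q v)) p w = fderiv ℝ β p w v := by
      rw [← fderiv_clm_apply_const hβ]
      refine congrArg (fun L : E →L[ℝ] ℝ => L w) (Filter.EventuallyEq.fderiv_eq ?_)
      filter_upwards [h] with q hq using hq v
    have := (hα.hasFDerivAt.clm_apply
      (hA.hasFDerivAt.clm_apply (hasFDerivAt_const v p))).fderiv
    rw [this] at e
    simp at e
    linarith
  have h1p := h1.self_of_nhds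
  rw [nijenhuis_eq hA]
  simp only [map_add, map_sub, h1p]
  rw [key hα hβ h1, key hα hβ h1, key hβ hγ h2, key hβ hγ h2]
  ring

variable {D : Set E} {g : E → Bilin E}

/-- The Nijenhuis tensor in terms of `∇^T A` and the torsion. -/
theorem nijenhuis_eq_covEnd {A : E → E →L[ℝ] E} {p : E} (hA : DifferentiableAt ℝ A p)
    (T : E → Form E 3) (u v : E) :
    nijenhuis A p u v = covEnd g T A p (A p u) v - covEnd g T A p (A p v) u
      - A p (covEnd g T A p u v) + A p (covEnd g T A p v u)
      - (conn g T p (A p u) (A p v) - conn g T p (A p v) (A p u))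
      + A p (conn g T p u (A p v) - conn g T p (A p v) u)
      + A p (conn g T p (A p u) v - conn g T p v (A p u))
      - A p (A p (conn g T p u v - conn g T p v u)) := by
  rw [nijenhuis_eq hA]
  simp only [covEnd, add_apply, sub_apply, ContinuousLinearMap.comp_apply,
    map_add, map_sub]
  abel

variable [FiniteDimensional ℝ E]

/-- Skewness moves every outer `A` onto the test vector `w`; each remaining difference `Γ(a, b) -
Γ(b, a)` then pairs with the metric to a value of `T`. -/
theorem skew_nijenhuis_apply (hD : IsOpen D) (hg : IsRiemannianMetric D g) {A : E → E →L[ℝ] E}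
    {p : E} (hp : p ∈ D) (hA : DifferentiableAt ℝ A p)
    (hskew : ∀ u v, g p (A p u) v = -g p u (A p v)) (T : E → Form E 3) (u v w : E) :
    g p (nijenhuis A p u v) w = g p (covEnd g T A p (A p u) v) w
      - g p (covEnd g T A p (A p v) u) w
      + g p (covEnd g T A p u v) (A p w) - g p (covEnd g T A p v u) (A p w)
      - T p ![A p u, A p v, w] - T p ![u, A p v, A p w] - T p ![A p u, v, A p w]
      - T p ![u, v, A p (A p w)] := by
  rw [nijenhuis_eq_covEnd (g := g) hA T]
  simp only [map_add, map_sub (g p), add_apply, sub_apply, hskew]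
  simp only [← hg.conn_sub_conn hD hp, map_sub (g p), sub_apply]
  ring

/-- The covariant derivative of a skew-adjoint endomorphism field is skew-adjoint. -/
theorem covEnd_skew (hD : IsOpen D) (hg : IsRiemannianMetric D g) {A : E → E →L[ℝ] E}
    {p : E} (hp : p ∈ D) (hA : DifferentiableAt ℝ A p)
    (hskew : ∀ q ∈ D, ∀ u v, g q (A q u) v = -g q u (A q v)) (T : E → Form E 3) (u v w : E) :
    g p (covEnd g T A p u v) w = -g p (covEnd g T A p u w) v := by
  have hd := hg.differentiableAt hD hp
  have key : fderiv ℝ (fun q => g q (A q v) w + g q v (A q w)) p u = 0 := by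
    have : (fun q => g q (A q v) w + g q v (A q w)) =ᶠ[nhds p] fun _ => 0 := by
      filter_upwards [hD.mem_nhds hp] with q hq
      rw [hskew q hq]; ring
    rw [this.fderiv_eq]; simp
  have e := ((((hd.hasFDerivAt.clm_apply (hA.hasFDerivAt.clm_apply
    (hasFDerivAt_const v p))).clm_apply (hasFDerivAt_const w p)).fun_add
    ((hd.hasFDerivAt.clm_apply (hasFDerivAt_const v p)).clm_apply
      (hA.hasFDerivAt.clm_apply (hasFDerivAt_const w p))))).fderiv
  rw [e] at key
  simp at key
  rw [hg.fderiv_eq_conn hD hp T, hg.fderiv_eq_conn hD hp T] at key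
  simp only [covEnd, add_apply, sub_apply, ContinuousLinearMap.comp_apply,
    map_add, map_sub, hskew p hp]
  rw [hg.symm p hp _ v, hg.symm p hp _ v, hg.symm p hp _ (A p v)]
  simp only [hskew p hp v] at key ⊢
  linarith

/-- Since `∇^T g = 0`, the derivative of `g(A v, w)` splits into the tensorial part `g((∇^T A) v,
w)` and the action of the connection coefficients on the two arguments. -/
theorem fderiv_fundForm_apply (hD : IsOpen D) (hg : IsRiemannianMetric D g)
    {A : E → E →L[ℝ] E} {p : E} (hp : p ∈ D) (hA : ContDiffOn ℝ ∞ A D)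
    (hskew : ∀ q ∈ D, ∀ u v, g q (A q u) v = -g q u (A q v)) (T : E → Form E 3) (u v w : E) :
    fderiv ℝ (fundForm g A) p u ![v, w] = g p (covEnd g T A p u v) w
      + g p (A p v) (conn g T p u w) - g p (conn g T p u v) (A p w) := by
  have hd := hg.differentiableAt hD hp
  have hA' : DifferentiableAt ℝ A p :=
    (hA.contDiffAt (hD.mem_nhds hp)).differentiableAt (by simp)
  have hω : DifferentiableAt ℝ (fundForm g A) p :=
    ((contDiffOn_fundForm hg.smooth hA).contDiffAt (hD.mem_nhds hp)).differentiableAt (by simp)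
  rw [← fderiv_form_apply hω]
  have : (fun q => fundForm g A q ![v, w]) =ᶠ[nhds p] fun q => g q (A q v) w := by
    filter_upwards [hD.mem_nhds hp] with q hq
    refine fundForm_apply _ _ _ _ _ ?_
    rw [hskew q hq, hg.symm q hq]
  rw [this.fderiv_eq]
  have e := ((hd.hasFDerivAt.clm_apply (hA'.hasFDerivAt.clm_apply
    (hasFDerivAt_const v p))).clm_apply (hasFDerivAt_const w p)).fderiv
  rw [e]
  simp
  rw [hg.fderiv_eq_conn hD hp T]
  simp only [covEnd, add_apply, sub_apply, ContinuousLinearMap.comp_apply, map_add, map_sub,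
    hskew p hp (conn g T p u v)]
  ring

/-- In the cyclic sum the connection coefficients occur only in antisymmetrised pairs, so they
contribute nothing but torsion. -/
theorem extDeriv_fundForm_apply (hD : IsOpen D) (hg : IsRiemannianMetric D g)
    {A : E → E →L[ℝ] E} {p : E} (hp : p ∈ D) (hA : ContDiffOn ℝ ∞ A D)
    (hskew : ∀ q ∈ D, ∀ u v, g q (A q u) v = -g q u (A q v)) (T : E → Form E 3) (u v w : E) :
    extDeriv (fundForm g A) p ![u, v, w] = g p (covEnd g T A p u v) w
      + g p (covEnd g T A p v w) u + g p (covEnd g T A p w u) v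
      - T p ![u, v, A p w] - T p ![v, w, A p u] - T p ![w, u, A p v] := by
  rw [extDeriv_three_apply, fderiv_fundForm_apply hD hg hp hA hskew T,
    fderiv_fundForm_apply hD hg hp hA hskew T, fderiv_fundForm_apply hD hg hp hA hskew T]
  simp only [← hg.conn_sub_conn hD hp T, map_sub, sub_apply, hg.symm p hp (A p _)]
  ring

/-- A tensor `S(u; v, w)`, skew in `v, w`, with vanishing cyclic sum and of Nijenhuis type zero,
vanishes for `u` in the image of the endomorphism. -/
theorem eq_zero_of_skew_of_cyclic_of_nijenhuis {V : Type*} {S : V → V → V → ℝ} {a : V → V}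
    (hskew : ∀ u v w, S u v w = -S u w v) (hcyc : ∀ u v w, S u v w + S v w u + S w u v = 0)
    (hnij : ∀ u v w, S (a u) v w - S (a v) u w + S u v (a w) - S v u (a w) = 0) (u v w : V) :
    S (a u) v w = 0 := by
  -- The cyclic identity at `(u, v, a w)` trades the two terms with `a` in the last slot for `S (a
  -- w) u v`.
  have key : ∀ u v w, S (a u) v w + S (a v) w u - S (a w) u v = 0 := fun u v w => by
    have h1 := hnij u v w
    have h2 := hcyc u v (a w)
    rw [hskew v (a w) u] at h2
    rw [hskew (a v) w u]
    linarith
  -- For the three cyclic values `x, y, z` of `S (a ·) · ·` this gives `x + y = z` and `z + x = y`,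
  -- hence `2x = 0`.
  linarith [key u v w, key v w u, key w u v]

/-- A Hermitian structure whose Bismut torsion `B` is of type `(2,1) + (1,2)` satisfies
`∇^B J = 0`. -/
theorem IsHermitian.covEnd_eq_zero (hD : IsOpen D) {J : E → E →L[ℝ] E} (hJ : IsHermitian D g J)
    {B : E → Form E 3} {p : E} (hp : p ∈ D)
    (hB : B p = (extDeriv (fundForm g J) p).compContinuousLinearMap (J p))
    (htype : ∀ u v w, B p ![u, v, w] = B p ![u, J p v, J p w] + B p ![J p u, v, J p w]
      + B p ![J p u, J p v, w]) (u : E) : covEnd g B J p u = 0 := by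
  have hg := hJ.metric
  have hskew : ∀ q ∈ D, ∀ u v, g q (J q u) v = -g q u (J q v) := fun q hq u v => by
    rw [← hJ.compat q hq u (J q v), hJ.sq q hq]; simp
  have hJd : DifferentiableAt ℝ J p :=
    (hJ.smooth.contDiffAt (hD.mem_nhds hp)).differentiableAt (by simp)
  have hneg : ∀ a b c, B p ![a, b, -c] = -B p ![a, b, c] := fun a b c => by
    simp [← trilin_apply]
  have hS := eq_zero_of_skew_of_cyclic_of_nijenhuis
    (S := fun u v w => g p (covEnd g B J p u v) w) (a := J p)
    (covEnd_skew hD hg hp hJd hskew B)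
    -- As `J² = -1`, the Bismut condition at `(J u, J v, J w)` reads `B(J u, J v, J w) = -dΩ(u, v,
    -- w)`. The type condition turns the left side into `B(J u, v, w) + B(u, J v, w) + B(u, v, J
    -- w)`, which are the torsion terms of the formula for `dΩ`. They cancel and leave the cyclic
    -- sum of `∇^B J`.
    (fun u v w => by
      have h1 := extDeriv_fundForm_apply hD hg hp hJ.smooth hskew B u v w
      have h2 := htype (J p u) (J p v) (J p w)
      have h3 : B p ![J p u, J p v, J p w] = -extDeriv (fundForm g J) p ![u, v, w] := by
        rw [hB]
        simp only [ContinuousAlternatingMap.compContinuousLinearMap_apply]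
        have : (J p ∘ ![J p u, J p v, J p w]) = ![-u, -v, -w] := by
          funext i; fin_cases i <;> simp [hJ.sq p hp]
        rw [this]
        simp [← trilin_apply]
      simp only [hJ.sq p hp, hneg] at h2
      have h4 : ∀ a b c, B p ![-a, b, c] = -B p ![a, b, c] := fun a b c => by
        simp [← trilin_apply]
      have h5 : ∀ a b c, B p ![a, -b, c] = -B p ![a, b, c] := fun a b c => by
        simp [← trilin_apply]
      simp only [h4, h5, neg_neg] at h2
      have r1 := form_three_rotate (B p) (J p u) v w
      have r2 := form_three_rotate (B p) w u (J p v)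
      have r3 := form_three_rotate (B p) u (J p v) w
      have r4 := form_three_rotate (B p) (J p v) w u
      linarith)
    -- Here the torsion terms of the vanishing Nijenhuis tensor cancel by the type condition itself.
    (fun u v w => by
      have h1 := skew_nijenhuis_apply hD hg hp hJd (hskew p hp) B u v w
      rw [hJ.integrable p hp, hJ.sq p hp, hneg] at h1
      simp only [map_zero, zero_apply] at h1
      have h2 := htype u v w
      linarith)
  ext v
  refine hg.eq_of_forall hp fun w => ?_
  -- Every `u` equals `J(-J u)`, so the restriction to the image of `J` is no loss.
  have := hS (-(J p u)) v w
  simp only [map_neg, hJ.sq p hp, neg_neg] at this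
  simp [this]

end Nijenhuis

end SasakiTorsion

namespace SasakiTorsion

/-! ### Quasi-Sasakian structures and their torsion -/

section QuasiSasakian

variable {E : Type*} [NormedAddCommGroup E] [NormedSpace ℝ E]

/-- An almost contact metric structure with a Killing Reeb field `ξ` dual to `η`, with closed
fundamental form `ω`, such that `dη = 2 ω + κ` for a basic `Φ`-invariant `2`-form `κ`, and
`T = κ ∧ η`. -/
structure IsReebTorsion (D : Set E) (g : E → Bilin E) (ξ : E → E) (η : E → E →L[ℝ] ℝ)
    (Φ : E → E →L[ℝ] E) (κ : E → Form E 2) (T : E → Form E 3) : Prop where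
  contact : IsAlmostContactMetric D g ξ η Φ
  closed : ∀ p ∈ D, extDeriv (fundForm g Φ) p = 0
  killing : IsKilling D g ξ
  dual : ∀ p ∈ D, ∀ v, g p (ξ p) v = η p v
  end_vec : ∀ p ∈ D, Φ p (ξ p) = 0
  smooth_torsion : ContDiffOn ℝ ∞ T D
  basic : ∀ p ∈ D, ∀ v, κ p ![ξ p, v] = 0
  invariant : ∀ p ∈ D, ∀ u v, κ p ![Φ p u, v] = -κ p ![u, Φ p v]
  extDeriv_form : ∀ p ∈ D, ∀ u v,
    extDeriv (fun q => oneForm (η q)) p ![u, v] = 2 * g p (Φ p u) v + κ p ![u, v]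
  torsion_eq : ∀ p ∈ D, ∀ u v w,
    T p ![u, v, w] = κ p ![u, v] * η p w + κ p ![v, w] * η p u + κ p ![w, u] * η p v

/-- A family of closed `1`-forms `α i`, `β i = α i ∘ Φ`, with `β i ∘ Φ = -α i`, which together
with `η` separate vectors. -/
structure IsHolomorphicFamily {ι : Type*} (D : Set E) (η : E → E →L[ℝ] ℝ)
    (Φ : E → E →L[ℝ] E) (α β : ι → E → E →L[ℝ] ℝ) : Prop where
  smooth_left : ∀ i, ContDiffOn ℝ ∞ (α i) D
  smooth_right : ∀ i, ContDiffOn ℝ ∞ (β i) D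
  closed_left : ∀ i, ∀ p ∈ D, ∀ u v, fderiv ℝ (α i) p u v = fderiv ℝ (α i) p v u
  closed_right : ∀ i, ∀ p ∈ D, ∀ u v, fderiv ℝ (β i) p u v = fderiv ℝ (β i) p v u
  left_comp : ∀ i, ∀ p ∈ D, ∀ v, α i p (Φ p v) = β i p v
  right_comp : ∀ i, ∀ p ∈ D, ∀ v, β i p (Φ p v) = -α i p v
  separating : ∀ p ∈ D, ∀ v, η p v = 0 → (∀ i, α i p v = 0) → (∀ i, β i p v = 0) → v = 0

variable {D : Set E} {g : E → Bilin E} {ξ : E → E} {η : E → E →L[ℝ] ℝ} {Φ : E → E →L[ℝ] E}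
  {κ : E → Form E 2} {T : E → Form E 3}

theorem ContDiffOn.differentiableAt_of_isOpen {F : Type*} [NormedAddCommGroup F]
    [NormedSpace ℝ F] {f : E → F} (hf : ContDiffOn ℝ ∞ f D) (hD : IsOpen D) {p : E}
    (hp : p ∈ D) : DifferentiableAt ℝ f p :=
  (hf.contDiffAt (hD.mem_nhds hp)).differentiableAt (by simp)

theorem form_two_add_left (φ : Form E 2) (u u' v : E) :
    φ ![u + u', v] = φ ![u, v] + φ ![u', v] :=
  congrArg (fun L : Form E 1 => L ![v]) (map_add φ.curryLeft u u')

theorem form_two_smul_left (φ : Form E 2) (c : ℝ) (u v : E) :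
    φ ![c • u, v] = c * φ ![u, v] :=
  congrArg (fun L : Form E 1 => L ![v]) (map_smul φ.curryLeft c u)

theorem form_two_neg_left (φ : Form E 2) (u v : E) : φ ![-u, v] = -φ ![u, v] := by
  have := form_two_smul_left φ (-1) u v
  simpa using this

theorem form_two_add_right (φ : Form E 2) (u v v' : E) :
    φ ![u, v + v'] = φ ![u, v] + φ ![u, v'] := by
  rw [form_two_swap, form_two_add_left, form_two_swap φ u v, form_two_swap φ u v']; ring

theorem form_two_smul_right (φ : Form E 2) (c : ℝ) (u v : E) :
    φ ![u, c • v] = c * φ ![u, v] := by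
  rw [form_two_swap, form_two_smul_left, form_two_swap φ u v]; ring

theorem covEnd_neg_add_smul (A : E → E →L[ℝ] E) (p u z : E) (c : ℝ) :
    covEnd g T A p (-u + c • z) = -covEnd g T A p u + c • covEnd g T A p z := by
  ext v
  simp [covEnd]
  module

namespace IsReebTorsion

/-- Computing `Φ³ u` as `Φ²(Φ u)` and as `Φ(Φ² u)`, with `Φ ξ = 0`, gives `η(Φ u) ξ = 0`. -/
theorem form_end (h : IsReebTorsion D g ξ η Φ κ T) {p : E} (hp : p ∈ D) (u : E) :
    η p (Φ p u) = 0 := by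
  have h1 := h.contact.sq p hp (Φ p u)
  rw [h.contact.sq p hp u] at h1
  simp only [map_add, map_neg, map_smul, h.end_vec p hp, smul_zero, add_zero] at h1
  have h2 := congrArg (η p) h1
  simp only [map_add, map_neg, map_smul, h.contact.form_vec p hp, smul_eq_mul] at h2
  linarith

theorem skew (h : IsReebTorsion D g ξ η Φ κ T) {p : E} (hp : p ∈ D) (u v : E) :
    g p (Φ p u) v = -g p u (Φ p v) := by
  have h1 := h.contact.compat p hp u (Φ p v)
  rw [h.contact.sq p hp v, h.form_end hp] at h1
  simp only [map_add, map_neg, map_smul, smul_eq_mul] at h1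
  rw [h.contact.metric.symm p hp (Φ p u) (ξ p), h.dual p hp, h.form_end hp] at h1
  linarith

theorem invariant_end (h : IsReebTorsion D g ξ η Φ κ T) {p : E} (hp : p ∈ D) (u v : E) :
    κ p ![Φ p u, Φ p v] = κ p ![u, v] := by
  rw [h.invariant p hp, h.contact.sq p hp, form_two_add_right, form_two_smul_right,
    form_two_swap _ (ξ p) u, h.basic p hp, form_two_swap, form_two_neg_left, form_two_swap]
  ring

/-- Because `η ∘ Φ = 0` and `κ(Φ·, Φ·) = κ`, each summand on the right keeps exactly one of the
three terms of `κ ∧ η`. -/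
theorem torsion_type (h : IsReebTorsion D g ξ η Φ κ T) {p : E} (hp : p ∈ D) (u v w : E) :
    T p ![u, v, w] = T p ![u, Φ p v, Φ p w] + T p ![Φ p u, v, Φ p w]
      + T p ![Φ p u, Φ p v, w] := by
  simp only [h.torsion_eq p hp, h.form_end hp, h.invariant_end hp]
  ring

theorem metric_vec (h : IsReebTorsion D g ξ η Φ κ T) {p : E} (hp : p ∈ D) (v : E) :
    g p v (ξ p) = η p v := by
  rw [h.contact.metric.symm p hp, h.dual p hp]

theorem torsion_vec (h : IsReebTorsion D g ξ η Φ κ T) {p : E} (hp : p ∈ D) (u v : E) :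
    T p ![u, v, ξ p] = κ p ![u, v] := by
  rw [h.torsion_eq p hp, h.contact.form_vec p hp, h.basic p hp,
    form_two_swap (κ p) (ξ p) v, h.basic p hp]
  ring

/-- This is `∇^T η = g(∇^T ξ, ·)`: the form is metrically dual to `ξ`, and the metric is parallel.
-/
theorem fderiv_form_apply [FiniteDimensional ℝ E] (hD : IsOpen D)
    (h : IsReebTorsion D g ξ η Φ κ T) {p : E} (hp : p ∈ D) (u w : E) :
    fderiv ℝ η p u w = g p (covVec g T ξ p u) w + η p (conn g T p u w) := by
  have hg := h.contact.metric
  have hξ := ContDiffOn.differentiableAt_of_isOpen h.contact.smooth_vec hD hp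
  have hη := ContDiffOn.differentiableAt_of_isOpen h.contact.smooth_form hD hp
  rw [← fderiv_clm_apply_const hη]
  have : (fun q => η q w) =ᶠ[nhds p] fun q => g q (ξ q) w := by
    filter_upwards [hD.mem_nhds hp] with q hq
    rw [h.dual q hq]
  rw [this.fderiv_eq]
  have e := (((hg.differentiableAt hD hp).hasFDerivAt.clm_apply hξ.hasFDerivAt).clm_apply
    (hasFDerivAt_const w p)).fderiv
  rw [e]
  simp
  rw [hg.fderiv_eq_conn hD hp T, h.dual p hp]
  simp only [covVec, map_add, add_apply]
  ring

/-- `∇^T ξ = Φ`. -/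
theorem covVec_eq [FiniteDimensional ℝ E] (hD : IsOpen D)
    (h : IsReebTorsion D g ξ η Φ κ T) {p : E} (hp : p ∈ D) (u : E) :
    covVec g T ξ p u = Φ p u := by
  have hg := h.contact.metric
  refine hg.eq_of_forall hp fun w => ?_
  have hη := ContDiffOn.differentiableAt_of_isOpen h.contact.smooth_form hD hp
  -- `dη` gives the skew part of `g(∇^T ξ, ·)` up to the torsion term `T(u, w, ξ) = κ(u, w)`, which
  -- absorbs `κ` and leaves `2 g(Φ u, w)`. The Killing equation makes the symmetric part vanish,
  -- since its torsion terms cancel.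
  have h1 := h.extDeriv_form p hp u w
  rw [extDeriv_oneForm_apply hη, h.fderiv_form_apply hD hp, h.fderiv_form_apply hD hp] at h1
  have h2 := h.killing.lie p hp u w
  rw [lieMetric, hg.fderiv_eq_conn hD hp T] at h2
  have t1 := hg.conn_sub_conn hD hp T (ξ p) u w
  have t2 := hg.conn_sub_conn hD hp T (ξ p) w u
  have t3 := hg.conn_sub_conn hD hp T u w (ξ p)
  rw [h.torsion_vec hp, h.metric_vec hp, map_sub] at t3
  rw [map_sub (g p), sub_apply] at t1 t2
  rw [form_three_swap' (T p) (ξ p) u w] at t2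
  rw [hg.symm p hp u, hg.symm p hp u] at h2
  simp only [covVec, map_add, add_apply] at *
  linarith

/-- Differentiating `η ∘ Φ = 0` and using `∇^T ξ = Φ` gives `η((∇^T_u Φ) v) = -g(Φ u, Φ v)`. -/
theorem apply_covEnd [FiniteDimensional ℝ E] (hD : IsOpen D)
    (h : IsReebTorsion D g ξ η Φ κ T) {p : E} (hp : p ∈ D) (u v : E) :
    η p (covEnd g T Φ p u v) = η p u * η p v - g p u v := by
  have hη := ContDiffOn.differentiableAt_of_isOpen h.contact.smooth_form hD hp
  have hΦ := ContDiffOn.differentiableAt_of_isOpen h.contact.smooth_end hD hp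
  have key : fderiv ℝ (fun q => η q (Φ q v)) p u = 0 := by
    have : (fun q => η q (Φ q v)) =ᶠ[nhds p] fun _ => 0 := by
      filter_upwards [hD.mem_nhds hp] with q hq using h.form_end hq v
    rw [this.fderiv_eq]; simp
  rw [(hη.hasFDerivAt.clm_apply (hΦ.hasFDerivAt.clm_apply (hasFDerivAt_const v p))).fderiv]
    at key
  simp at key
  rw [h.fderiv_form_apply hD hp, h.covVec_eq hD hp, h.contact.compat p hp] at key
  simp only [covEnd, map_add, map_sub, add_apply, sub_apply,
    ContinuousLinearMap.comp_apply, h.form_end hp]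
  linarith

/-- `(∇^T_u Φ)(v) = η(v) u - g(u, v) ξ`. -/
theorem covEnd_eq [FiniteDimensional ℝ E] (hD : IsOpen D)
    (h : IsReebTorsion D g ξ η Φ κ T)
    (hN : ∀ p ∈ D, ∀ u v,
      nijenhuis Φ p u v + extDeriv (fun q => oneForm (η q)) p ![u, v] • ξ p = 0)
    {p : E} (hp : p ∈ D) (u v : E) :
    covEnd g T Φ p u v = η p v • u - g p u v • ξ p := by
  have hg := h.contact.metric
  have hΦ := ContDiffOn.differentiableAt_of_isOpen h.contact.smooth_end hD hp
  have hskew : ∀ q ∈ D, ∀ u v, g q (Φ q u) v = -g q u (Φ q v) := fun q hq => h.skew hq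
  have hS0 : ∀ u v w, g p (covEnd g T Φ p u v - (η p v • u - g p u v • ξ p)) w
      = g p (covEnd g T Φ p u v) w - η p v * g p u w + g p u v * η p w := fun u v w => by
    simp only [map_sub, map_smul, sub_apply, smul_apply, smul_eq_mul,
      h.dual p hp]
    ring
  have hsk : ∀ u v w, g p (covEnd g T Φ p u v - (η p v • u - g p u v • ξ p)) w
      = -g p (covEnd g T Φ p u w - (η p w • u - g p u w • ξ p)) v := fun u v w => by
    rw [hS0, hS0, covEnd_skew hD hg hp hΦ hskew T u v w]; ring
  have hcyc : ∀ u v w, g p (covEnd g T Φ p u v - (η p v • u - g p u v • ξ p)) w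
      + g p (covEnd g T Φ p v w - (η p w • v - g p v w • ξ p)) u
      + g p (covEnd g T Φ p w u - (η p u • w - g p w u • ξ p)) v = 0 := fun u v w => by
    have h1 := extDeriv_fundForm_apply hD hg hp h.contact.smooth_end hskew T u v w
    rw [h.closed p hp, show (0 : Form E 3) ![u, v, w] = 0 from rfl] at h1
    simp only [h.torsion_eq p hp, h.form_end hp, h.invariant p hp] at h1
    rw [hS0, hS0, hS0, hg.symm p hp w u, hg.symm p hp v u, hg.symm p hp w v]
    linarith
  -- `S` measures the failure of the claimed formula. It is skew, its cyclic sum vanishes by `dω =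
  -- 0`, and normality is its Nijenhuis condition.
  have hS := eq_zero_of_skew_of_cyclic_of_nijenhuis
    (S := fun u v w => g p (covEnd g T Φ p u v - (η p v • u - g p u v • ξ p)) w) (a := Φ p)
    hsk hcyc
    (fun u v w => by
      have h1 := skew_nijenhuis_apply hD hg hp hΦ (hskew p hp) T u v w
      rw [eq_neg_of_add_eq_zero_left (hN p hp u v), h.extDeriv_form p hp] at h1
      have h2 := h.torsion_type hp u v w
      have h3 : T p ![u, v, Φ p (Φ p w)] = -T p ![u, v, w] + η p w * κ p ![u, v] := by
        rw [h.contact.sq p hp, ← h.torsion_vec hp]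
        simp [← trilin_apply]
      rw [h3] at h1
      simp only [map_neg, map_smul, neg_apply, smul_apply, smul_eq_mul,
        h.dual p hp] at h1
      simp only [hS0, h.form_end hp]
      rw [h.skew hp v w, h.skew hp v u, h.skew hp u w, hg.symm p hp v (Φ p u)]
      linarith)
  refine sub_eq_zero.1 (hg.eq_of_forall hp fun w => ?_)
  have hvec : ∀ u v, g p (covEnd g T Φ p u v - (η p v • u - g p u v • ξ p)) (ξ p) = 0 := by
    intro u v
    rw [hS0, h.metric_vec hp, h.apply_covEnd hD hp, h.metric_vec hp, h.contact.form_vec p hp]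
    ring
  -- Now `S` vanishes in the direction `Φ² u = -u + η(u) ξ`, so only the direction `ξ` is left.
  -- There the cyclic identity reduces `S(ξ; v, w)` to values of `S` with `ξ` in a skew slot, which
  -- `hvec` kills.
  have h1 := hS (Φ p u) v w
  have h2 := hcyc (ξ p) v w
  rw [hsk w, hvec, hvec] at h2
  simp only [hS0, h.contact.sq p hp, covEnd_neg_add_smul] at h1 h2 ⊢
  simp only [map_neg, map_add, map_smul, map_sub, neg_apply, add_apply, sub_apply, smul_apply,
    smul_eq_mul, map_zero, zero_apply, h.dual p hp] at h1 h2 ⊢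
  linear_combination -h1 + η p u * h2

theorem isSTStructure [FiniteDimensional ℝ E] (hD : IsOpen D)
    (h : IsReebTorsion D g ξ η Φ κ T)
    (hN : ∀ p ∈ D, ∀ u v,
      nijenhuis Φ p u v + extDeriv (fun q => oneForm (η q)) p ![u, v] • ξ p = 0) :
    IsSTStructure D g T ξ Φ where
  killing := h.killing
  unit p hp := by rw [h.dual p hp, h.contact.form_vec p hp]
  smooth := h.contact.smooth_end
  cov_vec p hp u := h.covVec_eq hD hp u
  cov_end p hp u v := by rw [h.covEnd_eq hD hN hp, h.dual p hp]
  torsion p hp u v w := h.torsion_type hp u v w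

theorem extDeriv_form_vec (h : IsReebTorsion D g ξ η Φ κ T) {p : E} (hp : p ∈ D) (v : E) :
    extDeriv (fun q => oneForm (η q)) p ![ξ p, v] = 0 := by
  rw [h.extDeriv_form p hp, h.end_vec p hp, h.basic p hp]
  simp

theorem extDeriv_form_end (h : IsReebTorsion D g ξ η Φ κ T) {p : E} (hp : p ∈ D) (u v : E) :
    extDeriv (fun q => oneForm (η q)) p ![Φ p u, v]
      = -extDeriv (fun q => oneForm (η q)) p ![u, Φ p v] := by
  rw [h.extDeriv_form p hp, h.extDeriv_form p hp, h.invariant p hp, h.skew hp (Φ p u)]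
  ring

theorem extDeriv_form_end_end (h : IsReebTorsion D g ξ η Φ κ T) {p : E} (hp : p ∈ D)
    (u v : E) : extDeriv (fun q => oneForm (η q)) p ![Φ p u, Φ p v]
      = extDeriv (fun q => oneForm (η q)) p ![u, v] := by
  rw [h.extDeriv_form p hp, h.extDeriv_form p hp, h.invariant_end hp, h.contact.compat p hp,
    h.form_end hp]
  ring

/-- It suffices to test against the separating forms. On `α i` and `β i` every term of
`apply_nijenhuis` is the exterior derivative of a closed form. On `η` what remains is `-dη(Φ u, Φ v)
+ dη(u, v)`, zero by invariance of `dη`. -/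
theorem normal (hD : IsOpen D) (h : IsReebTorsion D g ξ η Φ κ T) {ι : Type*}
    {α β : ι → E → E →L[ℝ] ℝ} (hα : IsHolomorphicFamily D η Φ α β) {p : E} (hp : p ∈ D)
    (u v : E) : nijenhuis Φ p u v + extDeriv (fun q => oneForm (η q)) p ![u, v] • ξ p = 0 := by
  have hη := ContDiffOn.differentiableAt_of_isOpen h.contact.smooth_form hD hp
  have hΦ := ContDiffOn.differentiableAt_of_isOpen h.contact.smooth_end hD hp
  have hdα := fun i => ContDiffOn.differentiableAt_of_isOpen (hα.smooth_left i) hD hp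
  have hdβ := fun i => ContDiffOn.differentiableAt_of_isOpen (hα.smooth_right i) hD hp
  have hDp := hD.mem_nhds hp
  have hβξ : ∀ i, β i p (ξ p) = 0 := fun i => by
    rw [← hα.left_comp i p hp, h.end_vec p hp, map_zero]
  have hαξ : ∀ i, α i p (ξ p) = 0 := fun i => by
    rw [← neg_eq_zero, ← hα.right_comp i p hp, h.end_vec p hp, map_zero]
  refine hα.separating p hp _ ?_ (fun i => ?_) (fun i => ?_)
  · rw [map_add, map_smul, h.contact.form_vec p hp,
      apply_nijenhuis (α := η) (β := fun _ => 0) (γ := fun _ => 0) hΦ hη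
        (differentiableAt_const _) (differentiableAt_const _)
        (by filter_upwards [hDp] with q hq using fun w => h.form_end hq w) (by simp),
      ← extDeriv_oneForm_apply hη, h.extDeriv_form_end_end hp]
    simp
  · rw [map_add, map_smul, hαξ, apply_nijenhuis (α := α i) (β := β i) (γ := fun q => -α i q)
      hΦ (hdα i) (hdβ i) (hdα i).neg
      (by filter_upwards [hDp] with q hq using hα.left_comp i q hq)
      (by filter_upwards [hDp] with q hq using hα.right_comp i q hq)]
    rw [fderiv_fun_neg, hα.closed_left i p hp (Φ p u), hα.closed_right i p hp (Φ p u),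
      hα.closed_right i p hp u]
    simp [hα.closed_left i p hp u v]
  · rw [map_add, map_smul, hβξ, apply_nijenhuis (α := β i) (β := fun q => -α i q)
      (γ := fun q => -β i q) hΦ (hdβ i) (hdα i).neg (hdβ i).neg
      (by filter_upwards [hDp] with q hq using hα.right_comp i q hq)
      (by filter_upwards [hDp] with q hq using fun w => by
            rw [neg_apply, hα.left_comp i q hq, neg_apply])]
    rw [fderiv_fun_neg, fderiv_fun_neg, hα.closed_right i p hp (Φ p u)]
    simp [hα.closed_right i p hp u v, hα.closed_left i p hp u, hα.closed_left i p hp v]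

theorem isQuasiSasakian (hD : IsOpen D) (h : IsReebTorsion D g ξ η Φ κ T) {ι : Type*}
    {α β : ι → E → E →L[ℝ] ℝ} (hα : IsHolomorphicFamily D η Φ α β) :
    IsQuasiSasakian D g ξ η Φ where
  contact := h.contact
  normal _ hp u v := h.normal hD hα hp u v
  closed := h.closed

end IsReebTorsion

end QuasiSasakian

end SasakiTorsion

namespace SasakiTorsion

/-! ### The cone over a quasi-Sasakian structure -/

section Cone

variable {E : Type*} [NormedAddCommGroup E] [NormedSpace ℝ E]

/-- The almost complex structure `J(u) = Φ(u) - r η(u) ∂_r`, `J(r ∂_r) = ξ` of the cone. -/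
noncomputable def coneEnd (ξ : E → E) (η : E → E →L[ℝ] ℝ) (Φ : E → E →L[ℝ] E) (q : E × ℝ) :
    (E × ℝ) →L[ℝ] (E × ℝ) :=
  ContinuousLinearMap.prod
    (Φ q.1 ∘L ContinuousLinearMap.fst ℝ E ℝ
      + (ContinuousLinearMap.snd ℝ E ℝ).smulRight (q.2⁻¹ • ξ q.1))
    (-(q.2 • (η q.1 ∘L ContinuousLinearMap.fst ℝ E ℝ)))

variable {D : Set E} {g : E → Bilin E} {ξ : E → E} {η : E → E →L[ℝ] ℝ} {Φ : E → E →L[ℝ] E}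
  {κ : E → Form E 2} {T : E → Form E 3}

theorem coneEnd_apply (q U : E × ℝ) :
    coneEnd ξ η Φ q U = (Φ q.1 U.1 + (U.2 * q.2⁻¹) • ξ q.1, -(q.2 * η q.1 U.1)) := by
  simp [coneEnd, smul_smul]

theorem coneMetric_apply (q U V : E × ℝ) :
    coneMetric g q U V = U.2 * V.2 + q.2 ^ 2 * g q.1 U.1 V.1 := by
  simp [coneMetric]

theorem coneForm_three_apply (q U V W : E × ℝ) :
    coneForm T q ![U, V, W] = q.2 ^ 2 * T q.1 ![U.1, V.1, W.1] := by
  have : (Prod.fst ∘ ![U, V, W]) = ![U.1, V.1, W.1] := by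
    funext i; fin_cases i <;> rfl
  simp [coneForm, this]

theorem isOpen_coneDomain {E : Type*} [NormedAddCommGroup E] {D : Set E} (hD : IsOpen D) :
    IsOpen (coneDomain D) := hD.prod isOpen_Ioi

theorem mem_coneDomain {E : Type*} {D : Set E} {q : E × ℝ} : q ∈ coneDomain D ↔ q.1 ∈ D ∧ 0 < q.2 := by
  simp [coneDomain, Set.mem_prod]

theorem contDiffOn_comp_fst {F : Type*} [NormedAddCommGroup F] [NormedSpace ℝ F] {f : E → F}
    (hf : ContDiffOn ℝ ∞ f D) : ContDiffOn ℝ ∞ (fun q : E × ℝ => f q.1) (coneDomain D) :=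
  hf.comp contDiff_fst.contDiffOn fun _ hq => (mem_coneDomain.1 hq).1

theorem hasFDerivAt_comp_fst {F : Type*} [NormedAddCommGroup F] [NormedSpace ℝ F] {f : E → F}
    {q : E × ℝ} (hf : DifferentiableAt ℝ f q.1) :
    HasFDerivAt (fun q : E × ℝ => f q.1) (fderiv ℝ f q.1 ∘L ContinuousLinearMap.fst ℝ E ℝ) q :=
  hf.hasFDerivAt.comp q hasFDerivAt_fst

theorem IsRiemannianMetric.cone (hg : IsRiemannianMetric D g) :
    IsRiemannianMetric (coneDomain D) (coneMetric g) where
  smooth := by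
    -- The pullback is rewritten as pre- and postcomposition with fixed linear maps, so that
    -- smoothness in `q` is visible.
    have e : coneMetric g = fun q : E × ℝ =>
        (ContinuousLinearMap.snd ℝ E ℝ).smulRight (ContinuousLinearMap.snd ℝ E ℝ) +
        (q.2 ^ 2) • (((ContinuousLinearMap.compL ℝ (E × ℝ) E ℝ).flip
          (ContinuousLinearMap.fst ℝ E ℝ)) ∘L (g q.1) ∘L ContinuousLinearMap.fst ℝ E ℝ) := by
      funext q
      refine ContinuousLinearMap.ext fun U => ContinuousLinearMap.ext fun V => ?_
      rw [coneMetric_apply]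
      simp
    rw [e]
    exact contDiffOn_const.add ((contDiff_snd.pow 2).contDiffOn.smul (contDiffOn_const.clm_comp
      ((contDiffOn_comp_fst hg.smooth).clm_comp contDiffOn_const)))
  symm q hq U V := by
    rw [coneMetric_apply, coneMetric_apply, hg.symm q.1 (mem_coneDomain.1 hq).1]; ring
  pos q hq U hU := by
    obtain ⟨h1, h2⟩ := mem_coneDomain.1 hq
    rw [coneMetric_apply]
    by_cases hu : U.1 = 0
    · have : U.2 ≠ 0 := fun h => hU (Prod.ext hu h)
      rw [hu]
      simp
      positivity
    · have := hg.pos q.1 h1 U.1 hu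
      nlinarith [mul_pos (pow_pos h2 2) this, mul_self_nonneg U.2]

theorem contDiffOn_coneForm {k : ℕ} {ψ : E → Form E k} (hψ : ContDiffOn ℝ ∞ ψ D) :
    ContDiffOn ℝ ∞ (coneForm ψ) (coneDomain D) := by
  have : ContDiffOn ℝ ∞ (fun q : E × ℝ => ContinuousAlternatingMap.compContinuousLinearMapCLM
      (ContinuousLinearMap.fst ℝ E ℝ) (ψ q.1)) (coneDomain D) :=
    contDiffOn_const.clm_apply (contDiffOn_comp_fst hψ)
  exact (contDiff_snd.pow 2).contDiffOn.smul this

theorem contDiffOn_coneEnd (hξ : ContDiffOn ℝ ∞ ξ D) (hη : ContDiffOn ℝ ∞ η D)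
    (hΦ : ContDiffOn ℝ ∞ Φ D) : ContDiffOn ℝ ∞ (coneEnd ξ η Φ) (coneDomain D) := by
  have e : coneEnd ξ η Φ = fun q : E × ℝ =>
      ContinuousLinearMap.inl ℝ E ℝ ∘L (Φ q.1 ∘L ContinuousLinearMap.fst ℝ E ℝ)
      + (ContinuousLinearMap.inl ℝ E ℝ ∘L
        (ContinuousLinearMap.smulRightL ℝ (E × ℝ) E (ContinuousLinearMap.snd ℝ E ℝ)
          (q.2⁻¹ • ξ q.1)))
      - q.2 • (ContinuousLinearMap.inr ℝ E ℝ ∘L (η q.1 ∘L ContinuousLinearMap.fst ℝ E ℝ)) := by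
    funext q
    refine ContinuousLinearMap.ext fun U => ?_
    rw [coneEnd_apply]
    ext <;> simp [smul_smul, mul_comm]
  rw [e]
  have hr : ContDiffOn ℝ ∞ (fun q : E × ℝ => q.2⁻¹) (coneDomain D) :=
    contDiff_snd.contDiffOn.inv fun q hq => (mem_coneDomain.1 hq).2.ne'
  exact ((contDiffOn_const.clm_comp ((contDiffOn_comp_fst hΦ).clm_comp contDiffOn_const)).add
    (contDiffOn_const.clm_comp (contDiffOn_const.clm_apply
      (hr.smul (contDiffOn_comp_fst hξ))))).sub
    (contDiff_snd.contDiffOn.smul (contDiffOn_const.clm_comp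
      ((contDiffOn_comp_fst hη).clm_comp contDiffOn_const)))

namespace IsReebTorsion

theorem coneEnd_sq (h : IsReebTorsion D g ξ η Φ κ T) {q : E × ℝ} (hq : q ∈ coneDomain D)
    (U : E × ℝ) : coneEnd ξ η Φ q (coneEnd ξ η Φ q U) = -U := by
  obtain ⟨hp, hr⟩ := mem_coneDomain.1 hq
  simp only [coneEnd_apply, map_add, map_smul, h.contact.sq _ hp, h.end_vec _ hp, h.form_end hp,
    h.contact.form_vec _ hp]
  ext
  · have : -(q.2 * η q.1 U.1) * q.2⁻¹ = -η q.1 U.1 := by field_simp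
    simp [this]
  · simp
    field_simp

theorem coneEnd_compat (h : IsReebTorsion D g ξ η Φ κ T) {q : E × ℝ} (hq : q ∈ coneDomain D)
    (U V : E × ℝ) : coneMetric g q (coneEnd ξ η Φ q U) (coneEnd ξ η Φ q V)
      = coneMetric g q U V := by
  obtain ⟨hp, hr⟩ := mem_coneDomain.1 hq
  simp only [coneEnd_apply, coneMetric_apply, map_add, map_smul, add_apply, smul_apply,
    h.contact.compat _ hp, h.metric_vec hp, h.dual _ hp, h.form_end hp,
    h.contact.form_vec _ hp, smul_eq_mul]
  field_simp
  ring

theorem fundForm_apply (h : IsReebTorsion D g ξ η Φ κ T) {p : E} (hp : p ∈ D) (u v : E) :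
    fundForm g Φ p ![u, v] = g p (Φ p u) v :=
  SasakiTorsion.fundForm_apply _ _ _ _ _ (by rw [h.skew hp, h.contact.metric.symm p hp])

/-- In terms of forms, `Ω = r² ω + r dr ∧ η`. -/
theorem fundForm_cone_apply (h : IsReebTorsion D g ξ η Φ κ T) {q : E × ℝ}
    (hq : q ∈ coneDomain D) (U V : E × ℝ) :
    fundForm (coneMetric g) (coneEnd ξ η Φ) q ![U, V] =
      q.2 ^ 2 * fundForm g Φ q.1 ![U.1, V.1]
        + q.2 * (U.2 * η q.1 V.1 - V.2 * η q.1 U.1) := by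
  obtain ⟨hp, hr⟩ := mem_coneDomain.1 hq
  have key : ∀ U V : E × ℝ, coneMetric g q (coneEnd ξ η Φ q U) V
      = q.2 ^ 2 * g q.1 (Φ q.1 U.1) V.1 + q.2 * (U.2 * η q.1 V.1 - V.2 * η q.1 U.1) := by
    intro U V
    simp only [coneEnd_apply, coneMetric_apply, map_add, map_smul, add_apply, smul_apply,
      h.dual _ hp, smul_eq_mul]
    field_simp
    ring
  rw [SasakiTorsion.fundForm_apply, key, h.fundForm_apply hp]
  rw [key, key, h.skew hp, h.contact.metric.symm _ hp V.1]
  ring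

/-- With `dω = 0` and `dη = 2ω + κ`, `dΩ = 2r dr ∧ ω - r dr ∧ dη = -r dr ∧ κ`. -/
theorem extDeriv_fundForm_cone (hD : IsOpen D) (h : IsReebTorsion D g ξ η Φ κ T) {q : E × ℝ}
    (hq : q ∈ coneDomain D) (U V W : E × ℝ) :
    extDeriv (fundForm (coneMetric g) (coneEnd ξ η Φ)) q ![U, V, W] =
      -(q.2 * (U.2 * κ q.1 ![V.1, W.1] + V.2 * κ q.1 ![W.1, U.1] + W.2 * κ q.1 ![U.1, V.1])) := by
  obtain ⟨hp, hr⟩ := mem_coneDomain.1 hq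
  have hη := ContDiffOn.differentiableAt_of_isOpen h.contact.smooth_form hD hp
  have hω := ContDiffOn.differentiableAt_of_isOpen
    (contDiffOn_fundForm h.contact.metric.smooth h.contact.smooth_end) hD hp
  have hΩ := ContDiffOn.differentiableAt_of_isOpen
    (contDiffOn_fundForm h.contact.metric.cone.smooth (contDiffOn_coneEnd h.contact.smooth_vec
      h.contact.smooth_form h.contact.smooth_end)) (isOpen_coneDomain hD) hq
  have key : ∀ U V W : E × ℝ,
      fderiv ℝ (fundForm (coneMetric g) (coneEnd ξ η Φ)) q U ![V, W] =
      2 * q.2 * U.2 * fundForm g Φ q.1 ![V.1, W.1]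
      + q.2 ^ 2 * fderiv ℝ (fundForm g Φ) q.1 U.1 ![V.1, W.1]
      + U.2 * (V.2 * η q.1 W.1 - W.2 * η q.1 V.1)
      + q.2 * (V.2 * fderiv ℝ η q.1 U.1 W.1 - W.2 * fderiv ℝ η q.1 U.1 V.1) := by
    intro U V W
    rw [← SasakiTorsion.fderiv_form_apply hΩ]
    have e : (fun q => fundForm (coneMetric g) (coneEnd ξ η Φ) q ![V, W]) =ᶠ[nhds q]
        fun q => q.2 ^ 2 * fundForm g Φ q.1 ![V.1, W.1]
          + q.2 * (V.2 * η q.1 W.1 - W.2 * η q.1 V.1) := by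
      filter_upwards [(isOpen_coneDomain hD).mem_nhds hq] with q' hq'
        using h.fundForm_cone_apply hq' V W
    rw [e.fderiv_eq]
    have d1 : HasFDerivAt (fun q : E × ℝ => fundForm g Φ q.1 ![V.1, W.1])
        (ContinuousAlternatingMap.apply ℝ E ℝ ![V.1, W.1] ∘L
          (fderiv ℝ (fundForm g Φ) q.1 ∘L ContinuousLinearMap.fst ℝ E ℝ)) q :=
      (ContinuousAlternatingMap.apply ℝ E ℝ ![V.1, W.1]).hasFDerivAt.comp q (hasFDerivAt_comp_fst hω)
    have d2 : ∀ w, HasFDerivAt (fun q : E × ℝ => η q.1 w) _ q := fun w =>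
      (hasFDerivAt_comp_fst hη).clm_apply (hasFDerivAt_const w q)
    have d3 : HasFDerivAt (fun q : E × ℝ => q.2) (ContinuousLinearMap.snd ℝ E ℝ) q :=
      hasFDerivAt_snd
    refine (DFunLike.congr_fun (((d3.pow 2).mul d1).add (d3.mul (((d2 W.1).const_mul V.2).sub
      ((d2 V.1).const_mul W.2)))).fderiv U).trans ?_
    simp
    ring
  rw [extDeriv_three_apply, key, key, key]
  have hc := extDeriv_three_apply (φ := fundForm g Φ) (p := q.1) U.1 V.1 W.1
  rw [h.closed _ hp, show (0 : Form E 3) ![U.1, V.1, W.1] = 0 from rfl] at hc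
  have hη2 := fun u v => h.extDeriv_form q.1 hp u v
  simp only [extDeriv_oneForm_apply hη, ← h.fundForm_apply hp] at hη2
  linear_combination (-q.2 ^ 2) * hc - q.2 * U.2 * hη2 V.1 W.1 - q.2 * V.2 * hη2 W.1 U.1
    - q.2 * W.2 * hη2 U.1 V.1

/-- `dr ∘ J = -r η` and `κ` is `J`-invariant, so `-r dr ∧ κ` evaluated on `J`-images is `r² η ∧ κ`.
-/
theorem coneForm_eq (hD : IsOpen D) (h : IsReebTorsion D g ξ η Φ κ T) {q : E × ℝ}
    (hq : q ∈ coneDomain D) :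
    coneForm T q = (extDeriv (fundForm (coneMetric g) (coneEnd ξ η Φ)) q).compContinuousLinearMap
      (coneEnd ξ η Φ q) := by
  obtain ⟨hp, hr⟩ := mem_coneDomain.1 hq
  have hinv : ∀ (u v : E) (a b : ℝ),
      κ q.1 ![Φ q.1 u + a • ξ q.1, Φ q.1 v + b • ξ q.1] = κ q.1 ![u, v] := fun u v a b => by
    rw [form_two_add_left, form_two_smul_left, h.basic _ hp, form_two_add_right,
      form_two_smul_right, form_two_swap _ (ξ q.1), h.basic _ hp, h.invariant_end hp]
    ring
  refine form_three_ext fun U V W => ?_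
  have e : (coneEnd ξ η Φ q ∘ ![U, V, W])
      = ![coneEnd ξ η Φ q U, coneEnd ξ η Φ q V, coneEnd ξ η Φ q W] := by
    funext i; fin_cases i <;> rfl
  rw [ContinuousAlternatingMap.compContinuousLinearMap_apply, e, h.extDeriv_fundForm_cone hD hq,
    coneForm_three_apply, h.torsion_eq _ hp]
  simp only [coneEnd_apply, hinv]
  ring

theorem coneForm_type (h : IsReebTorsion D g ξ η Φ κ T) {q : E × ℝ}
    (hq : q ∈ coneDomain D) (U V W : E × ℝ) :
    coneForm T q ![U, V, W] = coneForm T q ![U, coneEnd ξ η Φ q V, coneEnd ξ η Φ q W]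
      + coneForm T q ![coneEnd ξ η Φ q U, V, coneEnd ξ η Φ q W]
      + coneForm T q ![coneEnd ξ η Φ q U, coneEnd ξ η Φ q V, W] := by
  obtain ⟨hp, hr⟩ := mem_coneDomain.1 hq
  have hb : ∀ v, κ q.1 ![v, ξ q.1] = 0 := fun v => by
    rw [form_two_swap, h.basic _ hp, neg_zero]
  simp only [coneForm_three_apply, h.torsion_eq _ hp, coneEnd_apply, form_two_add_left,
    form_two_smul_left, form_two_add_right, form_two_smul_right, h.basic _ hp, hb, map_add,
    map_smul, h.form_end hp, h.contact.form_vec _ hp, h.invariant_end hp, h.invariant _ hp,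
    smul_eq_mul]
  ring

/-- The transverse pairs `(α i, β i)` are supplemented by `η ∘ J = dr/r` and `(dr/r) ∘ J = -η`. The
form `dr/r` is closed; `η` is not, but `dη` annihilates `ξ` and is `Φ`-invariant, which is enough.
-/
theorem nijenhuis_cone (hD : IsOpen D) (h : IsReebTorsion D g ξ η Φ κ T) {ι : Type*}
    {α β : ι → E → E →L[ℝ] ℝ} (hα : IsHolomorphicFamily D η Φ α β) {q : E × ℝ}
    (hq : q ∈ coneDomain D) (U V : E × ℝ) : nijenhuis (coneEnd ξ η Φ) q U V = 0 := by
  obtain ⟨hp, hr⟩ := mem_coneDomain.1 hq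
  have hDq := (isOpen_coneDomain hD).mem_nhds hq
  have hJ := ContDiffOn.differentiableAt_of_isOpen (contDiffOn_coneEnd h.contact.smooth_vec
      h.contact.smooth_form h.contact.smooth_end) (isOpen_coneDomain hD) hq
  have lift : ∀ {α : E → E →L[ℝ] ℝ}, ContDiffOn ℝ ∞ α D →
      HasFDerivAt (fun q : E × ℝ => α q.1 ∘L ContinuousLinearMap.fst ℝ E ℝ) _ q := fun hα =>
    (hasFDerivAt_comp_fst (ContDiffOn.differentiableAt_of_isOpen hα hD hp)).clm_comp
      (hasFDerivAt_const (ContinuousLinearMap.fst ℝ E ℝ) q)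
  have lift_apply : ∀ {α : E → E →L[ℝ] ℝ}, ContDiffOn ℝ ∞ α D → ∀ U V : E × ℝ,
      fderiv ℝ (fun q : E × ℝ => α q.1 ∘L ContinuousLinearMap.fst ℝ E ℝ) q U V
        = fderiv ℝ α q.1 U.1 V.1 := fun hα U V => by
    rw [(lift hα).fderiv]; simp
  have dρ : HasFDerivAt (fun q : E × ℝ => q.2⁻¹ • ContinuousLinearMap.snd ℝ E ℝ) _ q :=
    ((hasFDerivAt_inv hr.ne').comp q hasFDerivAt_snd).smul_const (ContinuousLinearMap.snd ℝ E ℝ)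
  have dρ_symm : ∀ U V : E × ℝ,
      fderiv ℝ (fun q : E × ℝ => q.2⁻¹ • ContinuousLinearMap.snd ℝ E ℝ) q U V =
      fderiv ℝ (fun q : E × ℝ => q.2⁻¹ • ContinuousLinearMap.snd ℝ E ℝ) q V U := fun U V => by
    rw [dρ.fderiv]; simp; ring
  have hη := ContDiffOn.differentiableAt_of_isOpen h.contact.smooth_form hD hp
  have hαξ : ∀ i, ∀ p ∈ D, α i p (ξ p) = 0 := fun i p hp => by
    rw [← neg_eq_zero, ← hα.right_comp i p hp, h.end_vec p hp, map_zero]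
  have hβξ : ∀ i, ∀ p ∈ D, β i p (ξ p) = 0 := fun i p hp => by
    rw [← hα.left_comp i p hp, h.end_vec p hp, map_zero]
  have cα : ∀ i, ∀ q ∈ coneDomain D, ∀ W : E × ℝ,
      (α i q.1 ∘L ContinuousLinearMap.fst ℝ E ℝ) (coneEnd ξ η Φ q W)
        = (β i q.1 ∘L ContinuousLinearMap.fst ℝ E ℝ) W := fun i q hq W => by
    have hp := (mem_coneDomain.1 hq).1
    simp [coneEnd_apply, hα.left_comp i _ hp, hαξ i _ hp]
  have cβ : ∀ i, ∀ q ∈ coneDomain D, ∀ W : E × ℝ,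
      (β i q.1 ∘L ContinuousLinearMap.fst ℝ E ℝ) (coneEnd ξ η Φ q W)
        = (-(α i q.1 ∘L ContinuousLinearMap.fst ℝ E ℝ)) W := fun i q hq W => by
    have hp := (mem_coneDomain.1 hq).1
    simp [coneEnd_apply, hα.right_comp i _ hp, hβξ i _ hp]
  have cη : ∀ q ∈ coneDomain D, ∀ W : E × ℝ,
      (η q.1 ∘L ContinuousLinearMap.fst ℝ E ℝ) (coneEnd ξ η Φ q W)
        = (q.2⁻¹ • ContinuousLinearMap.snd ℝ E ℝ) W := fun q hq W => by
    have hp := (mem_coneDomain.1 hq).1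
    simp [coneEnd_apply, h.form_end hp, h.contact.form_vec _ hp, mul_comm]
  have cρ : ∀ q ∈ coneDomain D, ∀ W : E × ℝ,
      (q.2⁻¹ • ContinuousLinearMap.snd ℝ E ℝ) (coneEnd ξ η Φ q W)
        = (-(η q.1 ∘L ContinuousLinearMap.fst ℝ E ℝ)) W := fun q hq W => by
    have hr := (mem_coneDomain.1 hq).2
    simp [coneEnd_apply]
    field_simp
  have hδ := fun u v => extDeriv_oneForm_apply hη u v
  have hfst : ∀ W, (coneEnd ξ η Φ q W).1 = Φ q.1 W.1 + (W.2 * q.2⁻¹) • ξ q.1 := fun W => by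
    rw [coneEnd_apply]
  have hb : ∀ v, extDeriv (fun q => oneForm (η q)) q.1 ![v, ξ q.1] = 0 := fun v => by
    rw [form_two_swap, h.extDeriv_form_vec hp, neg_zero]
  -- Along `η` only `-dη(J U, J V) + dη(U, V)` survives.
  have h1 : η q.1 (nijenhuis (coneEnd ξ η Φ) q U V).1 = 0 := by
    have := apply_nijenhuis (p := q) (α := fun q => η q.1 ∘L ContinuousLinearMap.fst ℝ E ℝ)
      (β := fun q => q.2⁻¹ • ContinuousLinearMap.snd ℝ E ℝ)
      (γ := fun q => -(η q.1 ∘L ContinuousLinearMap.fst ℝ E ℝ))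
      hJ (lift h.contact.smooth_form).differentiableAt dρ.differentiableAt
      (lift h.contact.smooth_form).differentiableAt.neg
      (by filter_upwards [hDq] with q hq using cη q hq)
      (by filter_upwards [hDq] with q hq using cρ q hq) U V
    rw [dρ_symm U, dρ_symm _ V, fderiv_fun_neg] at this
    simp only [neg_apply, lift_apply h.contact.smooth_form] at this
    refine (show _ = _ from this).trans ?_
    have e1 := hδ (coneEnd ξ η Φ q U).1 (coneEnd ξ η Φ q V).1
    have e2 := hδ U.1 V.1
    rw [hfst, hfst, form_two_add_left, form_two_smul_left, h.extDeriv_form_vec hp,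
      form_two_add_right, form_two_smul_right, hb, h.extDeriv_form_end_end hp, ← hfst,
      ← hfst] at e1
    linarith
  -- Along `dr/r` only `-dη(U, J V) - dη(J U, V)` survives.
  have h2 : (nijenhuis (coneEnd ξ η Φ) q U V).2 = 0 := by
    have := apply_nijenhuis (p := q) (β := fun q => -(η q.1 ∘L ContinuousLinearMap.fst ℝ E ℝ))
      (α := fun q => q.2⁻¹ • ContinuousLinearMap.snd ℝ E ℝ)
      (γ := fun q => -(q.2⁻¹ • ContinuousLinearMap.snd ℝ E ℝ))
      hJ dρ.differentiableAt (lift h.contact.smooth_form).differentiableAt.neg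
      dρ.differentiableAt.neg
      (by filter_upwards [hDq] with q hq using cρ q hq)
      (by filter_upwards [hDq] with q hq using fun W => by
            rw [neg_apply, cη q hq]; rfl) U V
    rw [fderiv_fun_neg, fderiv_fun_neg, dρ_symm (coneEnd ξ η Φ q U)] at this
    simp only [neg_apply, lift_apply h.contact.smooth_form, dρ_symm U V] at this
    have e1 := hδ U.1 (coneEnd ξ η Φ q V).1
    have e2 := hδ (coneEnd ξ η Φ q U).1 V.1
    rw [hfst, form_two_add_right, form_two_smul_right, hb, ← hfst] at e1
    rw [hfst, form_two_add_left, form_two_smul_left, h.extDeriv_form_vec hp,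
      h.extDeriv_form_end hp, ← hfst] at e2
    have e3 : q.2⁻¹ * (nijenhuis (coneEnd ξ η Φ) q U V).2 = 0 :=
      (show _ = _ from this).trans (by linarith)
    simpa [hr.ne'] using e3
  have h3 : (nijenhuis (coneEnd ξ η Φ) q U V).1 = 0 := by
    refine hα.separating _ hp _ h1 (fun i => ?_) (fun i => ?_)
    · have := apply_nijenhuis (p := q) (α := fun q => α i q.1 ∘L ContinuousLinearMap.fst ℝ E ℝ)
        (β := fun q => β i q.1 ∘L ContinuousLinearMap.fst ℝ E ℝ)
        (γ := fun q => -(α i q.1 ∘L ContinuousLinearMap.fst ℝ E ℝ))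
        hJ (lift (hα.smooth_left i)).differentiableAt (lift (hα.smooth_right i)).differentiableAt
        (lift (hα.smooth_left i)).differentiableAt.neg
        (by filter_upwards [hDq] with q hq using cα i q hq)
        (by filter_upwards [hDq] with q hq using cβ i q hq) U V
      rw [fderiv_fun_neg] at this
      simp only [neg_apply, lift_apply (hα.smooth_left i), lift_apply (hα.smooth_right i)] at this
      refine (show _ = _ from this).trans ?_
      rw [hα.closed_left i _ hp (coneEnd ξ η Φ q U).1, hα.closed_right i _ hp U.1,
        hα.closed_right i _ hp _ V.1, hα.closed_left i _ hp U.1]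
      ring
    · have := apply_nijenhuis (p := q) (α := fun q => β i q.1 ∘L ContinuousLinearMap.fst ℝ E ℝ)
        (β := fun q => -(α i q.1 ∘L ContinuousLinearMap.fst ℝ E ℝ))
        (γ := fun q => -(β i q.1 ∘L ContinuousLinearMap.fst ℝ E ℝ))
        hJ (lift (hα.smooth_right i)).differentiableAt
        (lift (hα.smooth_left i)).differentiableAt.neg
        (lift (hα.smooth_right i)).differentiableAt.neg
        (by filter_upwards [hDq] with q hq using cβ i q hq)
        (by filter_upwards [hDq] with q hq using fun W => by
              rw [neg_apply, cα i q hq]; rfl) U V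
      rw [fderiv_fun_neg, fderiv_fun_neg] at this
      simp only [neg_apply, lift_apply (hα.smooth_left i), lift_apply (hα.smooth_right i)] at this
      refine (show _ = _ from this).trans ?_
      rw [hα.closed_right i _ hp (coneEnd ξ η Φ q U).1, hα.closed_left i _ hp U.1,
        hα.closed_left i _ hp _ V.1, hα.closed_right i _ hp U.1]
      ring
  exact Prod.ext h3 h2

theorem isHermitian_cone (hD : IsOpen D) (h : IsReebTorsion D g ξ η Φ κ T) {ι : Type*}
    {α β : ι → E → E →L[ℝ] ℝ} (hα : IsHolomorphicFamily D η Φ α β) :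
    IsHermitian (coneDomain D) (coneMetric g) (coneEnd ξ η Φ) where
  metric := h.contact.metric.cone
  smooth := contDiffOn_coneEnd h.contact.smooth_vec h.contact.smooth_form h.contact.smooth_end
  sq _ hq := h.coneEnd_sq hq
  integrable _ hq := h.nijenhuis_cone hD hα hq
  compat _ hq := h.coneEnd_compat hq

/-- The cone over a quasi-Sasakian structure with torsion `κ ∧ η` is Kähler with torsion. -/
theorem isKahlerWithTorsion_cone [FiniteDimensional ℝ E] (hD : IsOpen D)
    (h : IsReebTorsion D g ξ η Φ κ T) {ι : Type*} {α β : ι → E → E →L[ℝ] ℝ}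
    (hα : IsHolomorphicFamily D η Φ α β) :
    IsKahlerWithTorsion (coneDomain D) (coneMetric g) (coneEnd ξ η Φ) (coneForm T) where
  hermitian := h.isHermitian_cone hD hα
  smooth := contDiffOn_coneForm h.smooth_torsion
  bismut _ hq := h.coneForm_eq hD hq
  parallel_metric q hq U V W := by
    rw [h.contact.metric.cone.fderiv_eq_conn (isOpen_coneDomain hD) hq (coneForm T)]
    ring
  parallel_complex _ hq := (h.isHermitian_cone hD hα).covEnd_eq_zero (isOpen_coneDomain hD) hq
    (h.coneForm_eq hD hq) (h.coneForm_type hq)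

end IsReebTorsion

end Cone

end SasakiTorsion

namespace SasakiTorsion

/-! ### Exterior algebra of `1`-forms and `2`-forms -/

section Exterior

variable {E : Type*} [NormedAddCommGroup E] [NormedSpace ℝ E]

/-- `oneWedge` as a continuous bilinear map. -/
noncomputable def oneWedgeL (E : Type*) [NormedAddCommGroup E] [NormedSpace ℝ E] (p : ℕ) :
    (E →L[ℝ] ℝ) →L[ℝ] Form E p →L[ℝ] Form E (p + 1) :=
  (ContinuousLinearMap.compL ℝ (Form E p) (E →L[ℝ] Form E p) (Form E (p + 1))
      (ContinuousAlternatingMap.alternatizeUncurryFinCLM ℝ E ℝ)) ∘L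
    ContinuousLinearMap.smulRightL ℝ E (Form E p)

theorem oneWedgeL_apply {p : ℕ} (α : E →L[ℝ] ℝ) (φ : Form E p) :
    oneWedgeL E p α φ = oneWedge α φ := rfl

/-- A crude count of permutations suffices: the bound only serves to make `wedge` a continuous
bilinear map, so that the product rule for derivatives applies. -/
theorem norm_wedge_le {p q : ℕ} (φ : Form E p) (ψ : Form E q) :
    ‖wedge φ ψ‖ ≤ ((p.factorial : ℝ) * (q.factorial : ℝ))⁻¹ * ((p + q).factorial : ℝ)
      * ‖φ‖ * ‖ψ‖ := by
  refine ContinuousAlternatingMap.opNorm_le_bound _ (by positivity) fun v => ?_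
  rw [wedge_apply, norm_mul, Real.norm_of_nonneg (by positivity)]
  simp only [mul_assoc]
  refine mul_le_mul_of_nonneg_left ?_ (by positivity)
  refine (norm_sum_le _ _).trans ?_
  have : ∀ σ ∈ (Finset.univ : Finset (Equiv.Perm (Fin (p + q)))), ‖Equiv.Perm.sign σ •
        (φ (fun i => v (σ (Fin.castAdd q i))) * ψ (fun j => v (σ (Fin.natAdd p j))))‖
        ≤ ‖φ‖ * (‖ψ‖ * ∏ i, ‖v i‖) := fun σ _ => by
    have h1 : ‖Equiv.Perm.sign σ •
        (φ (fun i => v (σ (Fin.castAdd q i))) * ψ (fun j => v (σ (Fin.natAdd p j))))‖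
        = ‖φ (fun i => v (σ (Fin.castAdd q i)))‖ * ‖ψ (fun j => v (σ (Fin.natAdd p j)))‖ := by
      rcases Int.units_eq_one_or (Equiv.Perm.sign σ) with hs | hs <;> simp [hs]
    rw [h1, ← Equiv.prod_comp σ (fun i => ‖v i‖), Fin.prod_univ_add]
    calc _ ≤ (‖φ‖ * ∏ i, ‖v (σ (Fin.castAdd q i))‖) * (‖ψ‖ * ∏ j, ‖v (σ (Fin.natAdd p j))‖) :=
          mul_le_mul (φ.le_opNorm _) (ψ.le_opNorm _) (norm_nonneg _) (by positivity)
      _ = _ := by ring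
  refine (Finset.sum_le_card_nsmul _ _ _ this).trans_eq ?_
  simp [Fintype.card_perm]

/-- `wedge` as a continuous bilinear map. -/
noncomputable def wedgeL (E : Type*) [NormedAddCommGroup E] [NormedSpace ℝ E] (p q : ℕ) :
    Form E p →L[ℝ] Form E q →L[ℝ] Form E (p + q) :=
  LinearMap.mkContinuous₂
    (LinearMap.mk₂ ℝ wedge
      (fun φ φ' ψ => by
        ext v; simp [wedge_apply, add_mul, smul_add, Finset.sum_add_distrib, mul_add])
      (fun c φ ψ => by
        ext v
        simp only [wedge_apply, ContinuousAlternatingMap.smul_apply, smul_eq_mul,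
          Units.smul_def, zsmul_eq_mul, Finset.mul_sum]
        exact Finset.sum_congr rfl fun σ _ => by ring)
      (fun φ ψ ψ' => by
        ext v; simp [wedge_apply, mul_add, smul_add, Finset.sum_add_distrib])
      (fun c φ ψ => by
        ext v
        simp only [wedge_apply, ContinuousAlternatingMap.smul_apply, smul_eq_mul,
          Units.smul_def, zsmul_eq_mul, Finset.mul_sum]
        exact Finset.sum_congr rfl fun σ _ => by ring))
    _ norm_wedge_le

theorem wedgeL_apply {p q : ℕ} (φ : Form E p) (ψ : Form E q) :
    wedgeL E p q φ ψ = wedge φ ψ := rfl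

theorem wedge_compContinuousLinearMap {p q : ℕ} (φ : Form E p) (ψ : Form E q) (A : E →L[ℝ] E) :
    (wedge φ ψ).compContinuousLinearMap A
      = wedge (φ.compContinuousLinearMap A) (ψ.compContinuousLinearMap A) := by
  ext v
  simp [wedge_apply, Function.comp_def]

theorem oneWedge_compContinuousLinearMap {p : ℕ} (α : E →L[ℝ] ℝ) (φ : Form E p)
    (A : E →L[ℝ] E) : (oneWedge α φ).compContinuousLinearMap A
      = oneWedge (α ∘L A) (φ.compContinuousLinearMap A) := by
  ext v
  simp only [oneWedge_apply, ContinuousAlternatingMap.compContinuousLinearMap_apply]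
  rfl

/-- Seeing `derivAct` as the derivative of pullback at the identity makes its Leibniz rules
consequences of the multiplicativity of pullback. -/
theorem hasFDerivAt_compContinuousLinearMap {k : ℕ} (ψ : Form E k) :
    HasFDerivAt (fun A : E →L[ℝ] E => ψ.compContinuousLinearMap A) (derivAct ψ)
      (ContinuousLinearMap.id ℝ E) := by
  have := (hasFDerivAt_const ψ (ContinuousLinearMap.id ℝ E)
    ).continuousAlternatingMapCompContinuousLinearMap
    (hasFDerivAt_id (𝕜 := ℝ) (ContinuousLinearMap.id ℝ E))
  refine this.congr_fderiv ?_
  ext A v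
  simp [derivAct]

theorem compContinuousLinearMap_id {k : ℕ} (ψ : Form E k) :
    ψ.compContinuousLinearMap (ContinuousLinearMap.id ℝ E) = ψ := by
  ext v; rfl

theorem derivAct_wedge {p q : ℕ} (φ : Form E p) (ψ : Form E q) (A : E →L[ℝ] E) :
    derivAct (wedge φ ψ) A = wedge (derivAct φ A) ψ + wedge φ (derivAct ψ A) := by
  have h1 := hasFDerivAt_compContinuousLinearMap (wedge φ ψ)
  simp only [wedge_compContinuousLinearMap] at h1
  have h2 := (wedgeL E p q).hasFDerivAt_of_bilinear (hasFDerivAt_compContinuousLinearMap φ)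
    (hasFDerivAt_compContinuousLinearMap ψ)
  rw [h1.unique h2]
  simp [compContinuousLinearMap_id, wedgeL_apply, add_comm]

theorem derivAct_oneWedge {p : ℕ} (α : E →L[ℝ] ℝ) (φ : Form E p) (A : E →L[ℝ] E) :
    derivAct (oneWedge α φ) A = oneWedge (α ∘L A) φ + oneWedge α (derivAct φ A) := by
  have h1 := hasFDerivAt_compContinuousLinearMap (oneWedge α φ)
  simp only [oneWedge_compContinuousLinearMap] at h1
  have h2 := (oneWedgeL E p).hasFDerivAt_of_bilinear
    (ContinuousLinearMap.compL ℝ E E ℝ α).hasFDerivAt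
    (hasFDerivAt_compContinuousLinearMap φ)
  rw [h1.unique h2]
  simp [compContinuousLinearMap_id, oneWedgeL_apply, add_comm]

theorem sum_perm_two {p : ℕ} (α β : E →L[ℝ] ℝ) (φ : Form E p) (v : Fin (p + 2) → E) :
    oneWedge α (oneWedge β φ) v = ((p.factorial : ℝ))⁻¹ *
      ∑ σ : Equiv.Perm (Fin (p + 2)), Equiv.Perm.sign σ •
        (α (v (σ 0)) * β (v (σ 1)) * φ (fun j => v (σ j.succ.succ))) := by
  rw [oneWedge_apply, ← sum_perm_succ]
  have h1 : ∀ σ : Equiv.Perm (Fin (p + 2)), Equiv.Perm.sign σ •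
      (α (v (σ 0)) * oneWedge β φ (fun j => v (σ j.succ))) =
      ((p.factorial : ℝ))⁻¹ * ∑ τ : Equiv.Perm (Fin (p + 1)),
        Equiv.Perm.sign (σ * Equiv.Perm.decomposeFin.symm (0, τ)) •
        (α (v ((σ * Equiv.Perm.decomposeFin.symm (0, τ)) 0))
          * β (v ((σ * Equiv.Perm.decomposeFin.symm (0, τ)) 1))
          * φ (fun j => v ((σ * Equiv.Perm.decomposeFin.symm (0, τ)) j.succ.succ))) := by
    intro σ
    rw [oneWedge_apply, ← sum_perm_succ, Finset.mul_sum, Finset.mul_sum, Finset.smul_sum,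
      Finset.mul_sum]
    refine Finset.sum_congr rfl fun τ _ => ?_
    have e1 : (Equiv.Perm.decomposeFin.symm (0, τ)) (1 : Fin (p + 2)) = (τ 0).succ := by
      rw [← Fin.succ_zero_eq_one, Equiv.Perm.decomposeFin_symm_apply_succ]; simp
    rcases Int.units_eq_one_or (Equiv.Perm.sign σ) with hs | hs <;>
    rcases Int.units_eq_one_or (Equiv.Perm.sign τ) with ht | ht <;>
      simp [hs, ht, Equiv.Perm.sign_mul, e1] <;> ring
  -- For each fixed inner permutation `τ`, right translation by `τ` reindexes the sum over `σ` to
  -- the same value. The `(p+1)!` choices of `τ` cancel the outer normalisation.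
  rw [Finset.sum_congr rfl fun σ _ => h1 σ, ← Finset.mul_sum, Finset.sum_comm]
  have h2 : ∀ τ : Equiv.Perm (Fin (p + 1)),
      ∑ σ : Equiv.Perm (Fin (p + 2)),
        Equiv.Perm.sign (σ * Equiv.Perm.decomposeFin.symm (0, τ)) •
        (α (v ((σ * Equiv.Perm.decomposeFin.symm (0, τ)) 0))
          * β (v ((σ * Equiv.Perm.decomposeFin.symm (0, τ)) 1))
          * φ (fun j => v ((σ * Equiv.Perm.decomposeFin.symm (0, τ)) j.succ.succ))) =
      ∑ σ : Equiv.Perm (Fin (p + 2)), Equiv.Perm.sign σ •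
        (α (v (σ 0)) * β (v (σ 1)) * φ (fun j => v (σ j.succ.succ))) := fun τ =>
    Equiv.sum_comp (Equiv.mulRight (Equiv.Perm.decomposeFin.symm (0, τ)))
      (fun σ : Equiv.Perm (Fin (p + 2)) => Equiv.Perm.sign σ •
        (α (v (σ 0)) * β (v (σ 1)) * φ (fun j => v (σ j.succ.succ))))
  rw [Finset.sum_congr rfl fun τ _ => h2 τ]
  simp only [Finset.sum_const, Finset.card_univ, Fintype.card_perm, Fintype.card_fin,
    nsmul_eq_mul]
  have : ((p + 1).factorial : ℝ) ≠ 0 := by positivity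
  field_simp

/-- `φ ∧ (α ∧ β) = α ∧ (β ∧ φ)`. -/
theorem wedge_oneWedge_oneForm {p : ℕ} (φ : Form E p) (α β : E →L[ℝ] ℝ) :
    wedge φ (oneWedge α (oneForm β)) = oneWedge α (oneWedge β φ) := by
  ext v
  let S := ∑ σ : Equiv.Perm (Fin (p + 2)), Equiv.Perm.sign σ •
    (α (v (σ (Fin.natAdd p 0))) * β (v (σ (Fin.natAdd p 1)))
      * φ (fun j => v (σ (Fin.castAdd 2 j))))
  have hS : wedge φ (oneWedge α (oneForm β)) v = ((p.factorial : ℝ))⁻¹ * S := by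
    -- Exchanging the last two slots flips the sign, so both terms of `α ∧ β` contribute equally and
    -- cancel the factor `2!` of `wedge`.
    have hswap : ∑ σ : Equiv.Perm (Fin (p + 2)), Equiv.Perm.sign σ •
        (α (v (σ (Fin.natAdd p 1))) * β (v (σ (Fin.natAdd p 0)))
          * φ (fun j => v (σ (Fin.castAdd 2 j)))) = -S := by
      have hne : (Fin.natAdd p 0 : Fin (p + 2)) ≠ Fin.natAdd p 1 := by
        simp [Fin.ext_iff]
      rw [← Equiv.sum_comp (Equiv.mulRight (Equiv.swap (Fin.natAdd p 0 : Fin (p + 2))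
        (Fin.natAdd p 1))), ← Finset.sum_neg_distrib]
      refine Finset.sum_congr rfl fun σ _ => ?_
      have hc : ∀ j : Fin p, Equiv.swap (Fin.natAdd p 0 : Fin (p + 2)) (Fin.natAdd p 1)
          (Fin.castAdd 2 j) = Fin.castAdd 2 j := fun j =>
        Equiv.swap_apply_of_ne_of_ne (by simp [Fin.ext_iff]; omega)
          (by simp [Fin.ext_iff]; omega)
      simp [hc, Equiv.Perm.sign_mul, Equiv.Perm.sign_swap hne]
    have h0 : ∀ σ : Equiv.Perm (Fin (p + 2)), Equiv.Perm.sign σ •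
        (φ (fun i => v (σ (Fin.castAdd 2 i))) *
          oneWedge α (oneForm β) (fun j => v (σ (Fin.natAdd p j)))) =
        Equiv.Perm.sign σ • (α (v (σ (Fin.natAdd p 0))) * β (v (σ (Fin.natAdd p 1)))
          * φ (fun j => v (σ (Fin.castAdd 2 j)))) -
        Equiv.Perm.sign σ • (α (v (σ (Fin.natAdd p 1))) * β (v (σ (Fin.natAdd p 0)))
          * φ (fun j => v (σ (Fin.castAdd 2 j)))) := fun σ => by
      have : (fun j : Fin 2 => v (σ (Fin.natAdd p j)))
          = ![v (σ (Fin.natAdd p 0)), v (σ (Fin.natAdd p 1))] := by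
        funext j; fin_cases j <;> rfl
      rw [this, oneWedge_oneForm_apply, ← smul_sub]
      congr 1
      ring
    rw [wedge_apply, Finset.sum_congr rfl fun σ _ => h0 σ, Finset.sum_sub_distrib, hswap]
    simp only [mul_inv]
    change (_ : ℝ) * (S - -S) = _
    ring
  rw [hS, sum_perm_two]
  congr 1
  -- The square of the cyclic rotation carries the last two slots to the front, and a square is an
  -- even permutation.
  have hlt : ∀ k (h : k < p + 1), finRotate (p + 2) ⟨k, by omega⟩ = ⟨k + 1, by omega⟩ :=
    fun k h => finRotate_of_lt h
  have hlast : finRotate (p + 2) ⟨p + 1, by omega⟩ = 0 := finRotate_last'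
  have e0 : (finRotate (p + 2) * finRotate (p + 2)) (Fin.natAdd p 0) = 0 := by
    rw [Equiv.Perm.mul_apply, show (Fin.natAdd p 0 : Fin (p + 2)) = ⟨p, by omega⟩ from rfl,
      hlt p (by omega), hlast]
  have e1 : (finRotate (p + 2) * finRotate (p + 2)) (Fin.natAdd p 1) = 1 := by
    rw [Equiv.Perm.mul_apply, show (Fin.natAdd p 1 : Fin (p + 2)) = ⟨p + 1, by omega⟩ from rfl,
      hlast]
    exact hlt 0 (by omega)
  have e2 : ∀ j : Fin p, (finRotate (p + 2) * finRotate (p + 2)) (Fin.castAdd 2 j)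
      = j.succ.succ := fun j => by
    rw [Equiv.Perm.mul_apply, show (Fin.castAdd 2 j : Fin (p + 2)) = ⟨j, by omega⟩ from rfl,
      hlt j (by omega), hlt (j + 1) (by omega)]
    rfl
  have es : Equiv.Perm.sign (finRotate (p + 2) * finRotate (p + 2)) = 1 := by
    rw [Equiv.Perm.sign_mul, Int.units_mul_self]
  refine (Equiv.sum_comp (Equiv.mulRight (finRotate (p + 2) * finRotate (p + 2))) _).symm.trans
    (Finset.sum_congr rfl fun σ _ => ?_)
  rw [Equiv.coe_mulRight, Equiv.Perm.sign_mul, es, mul_one]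
  simp only [Equiv.Perm.mul_apply σ, e0, e1, e2]

theorem oneWedge_anticomm {p : ℕ} (α β : E →L[ℝ] ℝ) (φ : Form E p) :
    oneWedge α (oneWedge β φ) = -oneWedge β (oneWedge α φ) := by
  have h : oneWedge α (oneForm β) = -oneWedge β (oneForm α) := form_two_ext fun u v => by
    simp only [ContinuousAlternatingMap.neg_apply, oneWedge_oneForm_apply]; ring
  rw [← wedge_oneWedge_oneForm, ← wedge_oneWedge_oneForm, h, ← wedgeL_apply, map_neg,
    wedgeL_apply]

theorem oneWedge_self {p : ℕ} (α : E →L[ℝ] ℝ) (φ : Form E p) :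
    oneWedge α (oneWedge α φ) = 0 := by
  have h := oneWedge_anticomm α α φ
  ext v
  have hv := congrArg (fun ψ : Form E (p + 2) => ψ v) h
  simp only [ContinuousAlternatingMap.neg_apply] at hv
  exact self_eq_neg.1 hv

theorem curryLeft_oneWedge {p : ℕ} (α : E →L[ℝ] ℝ) (φ : Form E (p + 1)) (u : E) :
    (oneWedge α φ).curryLeft u = α u • φ - oneWedge α (φ.curryLeft u) := by
  ext v
  rw [ContinuousAlternatingMap.curryLeft_apply_apply, oneWedge_apply, Fin.sum_univ_succ]
  refine Eq.trans ?_ (show α u * φ v - oneWedge α (φ.curryLeft u) v = _ from rfl)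
  rw [oneWedge_apply, sub_eq_add_neg, ← Finset.sum_neg_distrib]
  congr 1
  · simp
  · refine Finset.sum_congr rfl fun i _ => ?_
    have : (i.succ).removeNth (Matrix.vecCons u v) = Matrix.vecCons u (i.removeNth v) := by
      funext j
      cases j using Fin.cases <;> simp [Fin.removeNth]
    simp [this, pow_succ]

theorem curryLeft_oneWedge_zero (α : E →L[ℝ] ℝ) (φ : Form E 0) (u : E) :
    (oneWedge α φ).curryLeft u = α u • φ := by
  ext v
  rw [ContinuousAlternatingMap.curryLeft_apply_apply, oneWedge_apply]
  simp

/-- The `1`-form `v ↦ ω(u, v)`. -/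
noncomputable def contract (φ : Form E 2) (u : E) : E →L[ℝ] ℝ :=
  (ContinuousAlternatingMap.ofSubsingletonLIE
    (𝕜 := ℝ) (E := E) (F := ℝ) (0 : Fin 1)).symm (φ.curryLeft u)

theorem contract_apply (φ : Form E 2) (u v : E) : contract φ u v = φ ![u, v] :=
  congrArg φ (funext fun i => by fin_cases i <;> rfl)

theorem oneForm_contract (φ : Form E 2) (u : E) : oneForm (contract φ u) = φ.curryLeft u :=
  (ContinuousAlternatingMap.ofSubsingletonLIE
    (𝕜 := ℝ) (E := E) (F := ℝ) (0 : Fin 1)).apply_symm_apply _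

theorem sum_apply_form {ι : Type*} (s : Finset ι) {k : ℕ} (f : ι → Form E k) (v : Fin k → E) :
    (∑ i ∈ s, f i) v = ∑ i ∈ s, f i v :=
  map_sum (ContinuousAlternatingMap.apply ℝ E ℝ v) f s

/-- A `2`-form is a sum of products of `1`-forms. -/
theorem exists_eq_sum_oneWedge [FiniteDimensional ℝ E] (φ : Form E 2) :
    ∃ (m : ℕ) (α β : Fin m → E →L[ℝ] ℝ), φ = ∑ i, oneWedge (α i) (oneForm (β i)) := by
  let b := Module.finBasis ℝ E
  refine ⟨_, fun i => LinearMap.toContinuousLinearMap (b.coord i),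
    -- `φ = ½ ∑_i bⁱ ∧ (b_i ⌟ φ)`; the half compensates for counting each ordered pair twice.
    fun i => (2⁻¹ : ℝ) • contract φ (b i), form_two_ext fun u v => ?_⟩
  have h : ∀ u v : E, ∑ i, b.coord i u * contract φ (b i) v = φ ![u, v] := fun u v => by
    have h1 : φ.curryLeft u = ∑ i, b.repr u i • φ.curryLeft (b i) := by
      conv_lhs => rw [← b.sum_repr u]
      simp only [map_sum, map_smul]
    have h2 := congrArg (fun L : Form E 1 => L ![v]) h1
    simp only [sum_apply_form] at h2
    refine Eq.trans (Finset.sum_congr rfl fun i _ => ?_) h2.symm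
    rw [contract_apply]
    rfl
  simp only [sum_apply_form, oneWedge_oneForm_apply, Finset.sum_sub_distrib, smul_apply,
    smul_eq_mul, mul_left_comm _ (2⁻¹ : ℝ), ← Finset.mul_sum]
  have h1 := h u v
  have h2 := h v u
  rw [form_two_swap] at h2
  simp only [LinearMap.coe_toContinuousLinearMap']
  linarith

theorem contract_sum {ι : Type*} (s : Finset ι) (f : ι → Form E 2) (u : E) :
    contract (∑ i ∈ s, f i) u = ∑ i ∈ s, contract (f i) u := by
  ext v
  simp [contract_apply]

theorem contract_oneWedge (α β : E →L[ℝ] ℝ) (u : E) :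
    contract (oneWedge α (oneForm β)) u = α u • β - β u • α := by
  ext v
  simp [contract_apply, oneWedge_oneForm_apply, mul_comm]

theorem contract_sum_oneWedge {ι : Type*} [Fintype ι] (α β : ι → E →L[ℝ] ℝ) (u : E) :
    contract (∑ i, oneWedge (α i) (oneForm (β i))) u
      = ∑ i, (α i u • β i - β i u • α i) :=
  (contract_sum _ _ u).trans (Finset.sum_congr rfl fun _ _ => contract_oneWedge _ _ u)

theorem curryLeft_sum {ι : Type*} (s : Finset ι) {k : ℕ} (f : ι → Form E (k + 1)) (u : E) :
    (∑ i ∈ s, f i).curryLeft u = ∑ i ∈ s, (f i).curryLeft u := by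
  have := map_sum (ContinuousAlternatingMap.curryLeftLI (𝕜 := ℝ) (E := E) (F := ℝ) (n := k)) f s
  have h := congrArg (fun L : E →L[ℝ] Form E k => L u) this
  rw [sum_apply] at h
  exact h

theorem oneWedge_sum {ι : Type*} (s : Finset ι) {k : ℕ} (α : E →L[ℝ] ℝ) (f : ι → Form E k) :
    oneWedge α (∑ i ∈ s, f i) = ∑ i ∈ s, oneWedge α (f i) :=
  map_sum (oneWedgeL E _ α) f s

theorem sum_oneWedge {ι : Type*} (s : Finset ι) {k : ℕ} (α : ι → E →L[ℝ] ℝ) (φ : Form E k) :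
    oneWedge (∑ i ∈ s, α i) φ = ∑ i ∈ s, oneWedge (α i) φ := by
  simp only [← oneWedgeL_apply, map_sum, sum_apply]

theorem smul_oneWedge {k : ℕ} (c : ℝ) (α : E →L[ℝ] ℝ) (φ : Form E k) :
    oneWedge (c • α) φ = c • oneWedge α φ := by
  simp only [← oneWedgeL_apply, map_smul, smul_apply]

theorem sub_oneWedge {k : ℕ} (α β : E →L[ℝ] ℝ) (φ : Form E k) :
    oneWedge (α - β) φ = oneWedge α φ - oneWedge β φ := by
  simp only [← oneWedgeL_apply, map_sub, sub_apply]

theorem oneWedge_smul {k : ℕ} (c : ℝ) (α : E →L[ℝ] ℝ) (φ : Form E k) :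
    oneWedge α (c • φ) = c • oneWedge α φ := map_smul (oneWedgeL E _ α) c φ

theorem oneWedge_sub {k : ℕ} (α : E →L[ℝ] ℝ) (φ ψ : Form E k) :
    oneWedge α (φ - ψ) = oneWedge α φ - oneWedge α ψ := map_sub (oneWedgeL E _ α) φ ψ

theorem oneWedge_neg {k : ℕ} (α : E →L[ℝ] ℝ) (φ : Form E k) :
    oneWedge α (-φ) = -oneWedge α φ := map_neg (oneWedgeL E _ α) φ

theorem smul_wedge {p q : ℕ} (c : ℝ) (φ : Form E p) (ψ : Form E q) :
    wedge (c • φ) ψ = c • wedge φ ψ := by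
  simp only [← wedgeL_apply, map_smul, smul_apply]

theorem wedge_smul {p q : ℕ} (c : ℝ) (φ : Form E p) (ψ : Form E q) :
    wedge φ (c • ψ) = c • wedge φ ψ := map_smul (wedgeL E p q φ) c ψ

theorem wedge_sum {ι : Type*} (s : Finset ι) {p q : ℕ} (φ : Form E p) (f : ι → Form E q) :
    wedge φ (∑ i ∈ s, f i) = ∑ i ∈ s, wedge φ (f i) := map_sum (wedgeL E p q φ) f s

variable [FiniteDimensional ℝ E]

/-- `(α ∧ φ) ∧ ω = α ∧ (φ ∧ ω)` for a `2`-form `ω`. -/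
theorem wedge_oneWedge {p : ℕ} (α : E →L[ℝ] ℝ) (φ : Form E p) (ψ : Form E 2) :
    wedge (oneWedge α φ) ψ = oneWedge α (wedge φ ψ) := by
  obtain ⟨m, β, γ, rfl⟩ := exists_eq_sum_oneWedge ψ
  simp only [wedge_sum, wedge_oneWedge_oneForm, oneWedge_sum]
  refine Finset.sum_congr rfl fun i _ => ?_
  rw [oneWedge_anticomm (γ i) α, oneWedge_neg, oneWedge_anticomm (β i) α, neg_neg]

/-- Contraction is an antiderivation. The sign from passing `u` over `φ` is absorbed by writing the
`1`-form `u ⌟ ψ` on the left. -/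
theorem curryLeft_wedge {p : ℕ} (φ : Form E (p + 1)) (ψ : Form E 2) (u : E) :
    (wedge φ ψ).curryLeft u = wedge (φ.curryLeft u) ψ + oneWedge (contract ψ u) φ := by
  obtain ⟨m, β, γ, rfl⟩ := exists_eq_sum_oneWedge ψ
  rw [contract_sum_oneWedge]
  simp only [wedge_sum, wedge_oneWedge_oneForm, sum_oneWedge, sub_oneWedge, smul_oneWedge]
  refine (curryLeft_sum Finset.univ (fun i => oneWedge (β i) (oneWedge (γ i) φ)) u).trans ?_
  rw [← Finset.sum_add_distrib]
  refine Finset.sum_congr rfl fun i _ => ?_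
  rw [curryLeft_oneWedge, curryLeft_oneWedge, oneWedge_sub, oneWedge_smul]
  abel

theorem curryLeft_wedge_zero (φ : Form E 0) (ψ : Form E 2) (u : E) :
    (wedge φ ψ).curryLeft u = oneWedge (contract ψ u) φ := by
  obtain ⟨m, β, γ, rfl⟩ := exists_eq_sum_oneWedge ψ
  rw [contract_sum_oneWedge]
  simp only [wedge_sum, wedge_oneWedge_oneForm, sum_oneWedge, sub_oneWedge, smul_oneWedge]
  refine (curryLeft_sum Finset.univ (fun i => oneWedge (β i) (oneWedge (γ i) φ)) u).trans ?_
  refine Finset.sum_congr rfl fun i _ => ?_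
  rw [curryLeft_oneWedge, curryLeft_oneWedge_zero, oneWedge_smul]

/-- `u ⌟ ω^{l+1} = (l + 1) (u ⌟ ω) ∧ ω^l`. -/
theorem curryLeft_wedgePow (ψ : Form E 2) (u : E) (l : ℕ) :
    (show Form E (2 * l + 1 + 1) from wedgePow ψ (l + 1)).curryLeft u
      = ((l : ℝ) + 1) • oneWedge (contract ψ u) (wedgePow ψ l) := by
  induction l with
  | zero =>
    refine (curryLeft_wedge_zero (wedgePow ψ 0) ψ u).trans ?_
    simp
  | succ l ih =>
    refine (curryLeft_wedge (p := 2 * l + 1) (wedgePow ψ (l + 1)) ψ u).trans ?_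
    have h2 : wedge ((show Form E (2 * l + 1 + 1) from wedgePow ψ (l + 1)).curryLeft u) ψ
        = ((l : ℝ) + 1) • oneWedge (contract ψ u) (wedgePow ψ (l + 1)) := by
      rw [ih, smul_wedge, wedge_oneWedge]
      rfl
    refine (congrArg (· + _) h2).trans ?_
    push_cast
    rw [add_smul ((l : ℝ) + 1) 1, one_smul]

end Exterior

end SasakiTorsion

namespace SasakiTorsion

/-! ### Special Killing forms with torsion -/

section SpecialKilling

variable {E : Type*} [NormedAddCommGroup E] [NormedSpace ℝ E]
  {D : Set E} {g : E → Bilin E} {T : E → Form E 3}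

theorem covForm_congr {k : ℕ} {φ ψ : E → Form E k} {p : E} (h : φ =ᶠ[nhds p] ψ) :
    covForm g T φ p = covForm g T ψ p := by
  rw [covForm, covForm, h.fderiv_eq, h.self_of_nhds]

theorem covForm_wedge {a b : ℕ} {φ : E → Form E a} {ψ : E → Form E b} {p : E}
    (hφ : DifferentiableAt ℝ φ p) (hψ : DifferentiableAt ℝ ψ p) (u : E) :
    covForm g T (fun q => wedge (φ q) (ψ q)) p u
      = wedge (covForm g T φ p u) (ψ p) + wedge (φ p) (covForm g T ψ p u) := by
  have h : fderiv ℝ (fun q => wedge (φ q) (ψ q)) p u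
      = wedgeL E a b (φ p) (fderiv ℝ ψ p u) + wedgeL E a b (fderiv ℝ φ p u) (ψ p) :=
    DFunLike.congr_fun
      ((wedgeL E a b).hasFDerivAt_of_bilinear hφ.hasFDerivAt hψ.hasFDerivAt).fderiv u
  simp only [covForm, sub_apply, h, ContinuousLinearMap.comp_apply, derivAct_wedge]
  simp only [← wedgeL_apply, map_sub, sub_apply]
  abel

theorem covForm_oneForm {η : E → E →L[ℝ] ℝ} {p : E} (hη : DifferentiableAt ℝ η p) (u : E) :
    covForm g T (fun q => oneForm (η q)) p u
      = oneForm (fderiv ℝ η p u - η p ∘L conn g T p u) := by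
  rw [covForm, sub_apply, fderiv_oneForm hη]
  ext v
  simp [derivAct_apply]

theorem covForm_oneWedge {a : ℕ} {η : E → E →L[ℝ] ℝ} {φ : E → Form E a} {p : E}
    (hη : DifferentiableAt ℝ η p) (hφ : DifferentiableAt ℝ φ p) (u : E) :
    covForm g T (fun q => oneWedge (η q) (φ q)) p u
      = oneWedge (fderiv ℝ η p u - η p ∘L conn g T p u) (φ p)
        + oneWedge (η p) (covForm g T φ p u) := by
  have h : fderiv ℝ (fun q => oneWedge (η q) (φ q)) p u
      = oneWedgeL E a (η p) (fderiv ℝ φ p u) + oneWedgeL E a (fderiv ℝ η p u) (φ p) :=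
    DFunLike.congr_fun
      ((oneWedgeL E a).hasFDerivAt_of_bilinear hη.hasFDerivAt hφ.hasFDerivAt).fderiv u
  simp only [covForm, sub_apply, h, ContinuousLinearMap.comp_apply, derivAct_oneWedge]
  simp only [← oneWedgeL_apply, map_sub, sub_apply]
  abel

theorem contDiffOn_wedgePow {F : E → Form E 2} (hF : ContDiffOn ℝ ∞ F D) (l : ℕ) :
    ContDiffOn ℝ ∞ (fun q => wedgePow (F q) l) D := by
  induction l with
  | zero => exact contDiffOn_const
  | succ l ih => exact (contDiffOn_const (c := wedgeL E (2 * l) 2)).clm_apply ih |>.clm_apply hF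

theorem contDiffOn_oneWedge {a : ℕ} {η : E → E →L[ℝ] ℝ} {φ : E → Form E a}
    (hη : ContDiffOn ℝ ∞ η D) (hφ : ContDiffOn ℝ ∞ φ D) :
    ContDiffOn ℝ ∞ (fun q => oneWedge (η q) (φ q)) D :=
  (contDiffOn_const (c := oneWedgeL E a)).clm_apply hη |>.clm_apply hφ

variable [FiniteDimensional ℝ E]

/-- The Leibniz rule for a power: `F` has even degree, so the `l + 1` terms `F^l ∧ ∇F` agree without
signs. -/
theorem covForm_wedgePow_succ {F : E → Form E 2} {η : E → E →L[ℝ] ℝ} {p : E}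
    (hD : IsOpen D) (hp : p ∈ D) (hF : ContDiffOn ℝ ∞ F D) {u : E} {c : ℝ}
    (hcov : covForm g T F p u = c • oneWedge (g p u) (oneForm (η p))) (l : ℕ) :
    covForm g T (fun q => wedgePow (F q) (l + 1)) p u
      = (c * ((l : ℝ) + 1)) • oneWedge (g p u) (oneWedge (η p) (wedgePow (F p) l)) := by
  have hF' := ContDiffOn.differentiableAt_of_isOpen hF hD hp
  have hpow := fun l => ContDiffOn.differentiableAt_of_isOpen (contDiffOn_wedgePow hF l) hD hp
  have hstep : ∀ l, covForm g T (fun q => wedgePow (F q) (l + 1)) p u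
      = wedge (covForm g T (fun q => wedgePow (F q) l) p u) (F p)
        + c • oneWedge (g p u) (oneWedge (η p) (wedgePow (F p) l)) := fun l => by
    have h2 : wedge (wedgePow (F p) l) (covForm g T F p u)
        = c • oneWedge (g p u) (oneWedge (η p) (wedgePow (F p) l)) :=
      (congrArg (wedge _) hcov).trans ((wedge_smul _ _ _).trans
        (congrArg (c • ·) (wedge_oneWedge_oneForm _ _ _)))
    refine (covForm_wedge (hpow l) hF' u).trans ?_
    rw [h2]
  induction l with
  | zero =>
    rw [hstep]
    have h0 : covForm g T (fun q => wedgePow (F q) 0) p u = 0 := by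
      ext v
      simp [covForm, wedgePow, derivAct]
    rw [h0, ← wedgeL_apply, map_zero, zero_apply]
    refine (zero_add _).trans ?_
    simp
  | succ l ih =>
    rw [hstep, ih, smul_wedge]
    have h1 : wedge (oneWedge (g p u) (oneWedge (η p) (wedgePow (F p) l))) (F p)
        = oneWedge (g p u) (oneWedge (η p) (wedgePow (F p) (l + 1))) := by
      rw [wedge_oneWedge, wedge_oneWedge]
      rfl
    refine (congrArg (fun ψ : Form E (2 * (l + 1) + 1 + 1) => _ • ψ + _) h1).trans ?_
    rw [← add_smul]
    congr 1
    push_cast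
    ring

/-- If `∇^T_u η = u ⌟ F / 2` and `∇^T_u F = -2 u♭ ∧ η`, then the forms `η ∧ F^l` are special
Killing forms with torsion. -/
theorem isSpecialKilling_oneWedge_wedgePow (hD : IsOpen D) {η : E → E →L[ℝ] ℝ}
    {F : E → Form E 2} (hη : ContDiffOn ℝ ∞ η D) (hF : ContDiffOn ℝ ∞ F D)
    (h1 : ∀ p ∈ D, ∀ u, fderiv ℝ η p u - η p ∘L conn g T p u = (2⁻¹ : ℝ) • contract (F p) u)
    (h2 : ∀ p ∈ D, ∀ u, covForm g T F p u = (-2 : ℝ) • oneWedge (g p u) (oneForm (η p)))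
    (l : ℕ) :
    IsSpecialKilling D g T (fun q => oneWedge (η q) (wedgePow (F q) l))
      (-2 * ((l : ℝ) + 1)) := by
  have hpow := fun l => contDiffOn_wedgePow hF l
  have hl : ((l : ℝ) + 1) ≠ 0 := by positivity
  have hcov : ∀ p ∈ D, ∀ u, covForm g T (fun q => oneWedge (η q) (wedgePow (F q) l)) p u
      = (2 * ((l : ℝ) + 1))⁻¹ •
        (show Form E (2 * l + 1 + 1) from wedgePow (F p) (l + 1)).curryLeft u := by
    intro p hp u
    rw [covForm_oneWedge (ContDiffOn.differentiableAt_of_isOpen hη hD hp)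
      (ContDiffOn.differentiableAt_of_isOpen (hpow l) hD hp), h1 p hp, curryLeft_wedgePow,
      smul_oneWedge, smul_smul, mul_inv, mul_assoc, inv_mul_cancel₀ hl, mul_one]
    -- The term `η ∧ ∇(F^l)` vanishes, since `∇(F^l)` is zero for `l = 0` and otherwise contains a
    -- factor `η`.
    refine add_eq_left.2 ?_
    cases l with
    | zero =>
      have h0 : covForm g T (fun q => wedgePow (F q) 0) p u = 0 := by
        ext v
        simp [covForm, wedgePow, derivAct]
      rw [h0]
      exact map_zero (oneWedgeL E _ (η p))
    | succ l =>
      rw [covForm_wedgePow_succ hD hp hF (h2 p hp u)]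
      refine (oneWedge_smul _ _ _).trans ?_
      rw [oneWedge_anticomm]
      refine (congrArg (fun ψ => _ • -oneWedge _ ψ) (oneWedge_self _ _)).trans ?_
      have : oneWedge (g p u) (0 : Form E (2 * l + 1 + 1)) = 0 := map_zero (oneWedgeL E _ _)
      refine (congrArg (fun ψ => _ • -ψ) this).trans ?_
      simp
  -- Alternating the curried form of a `(2l+2)`-form multiplies it by `2l+2`, which cancels the
  -- constant in `hcov`. Thus `d^T(η ∧ F^l) = F^{l+1}`.
  have hdT : ∀ p ∈ D, dT g T (fun q => oneWedge (η q) (wedgePow (F q) l)) p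
      = wedgePow (F p) (l + 1) := by
    intro p hp
    have : covForm g T (fun q => oneWedge (η q) (wedgePow (F q) l)) p
        = (2 * ((l : ℝ) + 1))⁻¹ •
        (show Form E (2 * l + 1 + 1) from wedgePow (F p) (l + 1)).curryLeft := by
      ext1 u
      exact hcov p hp u
    rw [dT, this, ContinuousAlternatingMap.alternatizeUncurryFin_smul,
      ContinuousAlternatingMap.alternatizeUncurryFin_curryLeft, ← Nat.cast_smul_eq_nsmul ℝ,
      smul_smul]
    have : (2 * ((l : ℝ) + 1))⁻¹ * ((2 * l + 1 + 1 : ℕ) : ℝ) = 1 := by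
      push_cast
      rw [inv_mul_eq_one₀ (by positivity)]
      ring
    rw [this, one_smul]
  refine ⟨contDiffOn_oneWedge hη (hpow l), fun p hp u => ?_, fun p hp u => ?_⟩
  · rw [hcov p hp, hdT p hp]
    congr 2
    push_cast
    ring
  · have : dT g T (fun q => oneWedge (η q) (wedgePow (F q) l))
        =ᶠ[nhds p] fun q => wedgePow (F q) (l + 1) := by
      filter_upwards [hD.mem_nhds hp] with q hq using hdT q hq
    rw [covForm_congr this]
    exact covForm_wedgePow_succ hD hp hF (h2 p hp u) l

variable {ξ : E → E} {η : E → E →L[ℝ] ℝ} {Φ : E → E →L[ℝ] E} {κ : E → Form E 2}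

namespace IsReebTorsion

theorem fderiv_form_sub (hD : IsOpen D) (h : IsReebTorsion D g ξ η Φ κ T) {p : E} (hp : p ∈ D)
    (u : E) : fderiv ℝ η p u - η p ∘L conn g T p u = contract (fundForm g Φ p) u := by
  ext w
  rw [contract_apply, h.fundForm_apply hp, sub_apply, h.fderiv_form_apply hD hp,
    h.covVec_eq hD hp, ContinuousLinearMap.comp_apply]
  ring

/-- `d^T η = 2 ω`. -/
theorem dT_form (hD : IsOpen D) (h : IsReebTorsion D g ξ η Φ κ T) {p : E} (hp : p ∈ D) :
    dT g T (fun q => oneForm (η q)) p = (2 : ℝ) • fundForm g Φ p := by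
  have : covForm g T (fun q => oneForm (η q)) p
      = (show Form E (1 + 1) from fundForm g Φ p).curryLeft := by
    ext1 u
    rw [covForm_oneForm (ContDiffOn.differentiableAt_of_isOpen h.contact.smooth_form hD hp),
      h.fderiv_form_sub hD hp, oneForm_contract]
  rw [dT, this, ContinuousAlternatingMap.alternatizeUncurryFin_curryLeft,
    ← Nat.cast_smul_eq_nsmul ℝ]
  norm_num

/-- The general criterion applies to `F = d^T η = 2ω`: `∇^T_u η = u ⌟ ω`, and `∇^T_u ω = g((∇^T_u
Φ)·, ·) = -u♭ ∧ η` by the formula for `∇^T Φ`. -/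
theorem isSpecialKilling (hD : IsOpen D) (h : IsReebTorsion D g ξ η Φ κ T)
    (hN : ∀ p ∈ D, ∀ u v,
      nijenhuis Φ p u v + extDeriv (fun q => oneForm (η q)) p ![u, v] • ξ p = 0) (l : ℕ) :
    IsSpecialKilling D g T
      (fun q => oneWedge (η q) (wedgePow (dT g T (fun q => oneForm (η q)) q) l))
      (-2 * ((l : ℝ) + 1)) := by
  have hω := contDiffOn_fundForm h.contact.metric.smooth h.contact.smooth_end
  have hF : ContDiffOn ℝ ∞ (dT g T (fun q => oneForm (η q))) D :=
    (hω.const_smul (2 : ℝ)).congr fun p hp => h.dT_form hD hp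
  refine isSpecialKilling_oneWedge_wedgePow hD h.contact.smooth_form hF
    (fun p hp u => ?_) (fun p hp u => ?_) l
  · rw [h.fderiv_form_sub hD hp, h.dT_form hD hp]
    ext w
    simp [contract_apply]
  · have e : dT g T (fun q => oneForm (η q)) =ᶠ[nhds p] fun q => (2 : ℝ) • fundForm g Φ q := by
      filter_upwards [hD.mem_nhds hp] with q hq using h.dT_form hD hq
    rw [covForm_congr e]
    have hd := ContDiffOn.differentiableAt_of_isOpen hω hD hp
    have hs : ∀ q ∈ D, ∀ u v, g q (Φ q u) v = -g q u (Φ q v) := fun q hq => h.skew hq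
    refine form_two_ext fun v w => ?_
    have h1 := fderiv_fundForm_apply hD h.contact.metric hp h.contact.smooth_end hs T u v w
    rw [h.covEnd_eq hD hN hp] at h1
    have h2 : derivAct (fundForm g Φ p) (conn g T p u) ![v, w]
        = fundForm g Φ p ![conn g T p u v, w] + fundForm g Φ p ![v, conn g T p u w] := by
      rw [derivAct_apply, Fin.sum_univ_two]
      congr 2 <;> funext i <;> fin_cases i <;> rfl
    rw [h.fundForm_apply hp, h.fundForm_apply hp, h.skew hp (conn g T p u v)] at h2
    have h3 : covForm g T (fun q => (2 : ℝ) • fundForm g Φ q) p u ![v, w]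
        = 2 * (fderiv ℝ (fundForm g Φ) p u ![v, w]
          - derivAct (fundForm g Φ p) (conn g T p u) ![v, w]) := by
      have hf : fderiv ℝ (fun q => (2 : ℝ) • fundForm g Φ q) p
          = (2 : ℝ) • fderiv ℝ (fundForm g Φ) p := fderiv_fun_const_smul hd 2
      rw [covForm, sub_apply, hf]
      refine (show _ = 2 * fderiv ℝ (fundForm g Φ) p u ![v, w]
        - derivAct ((2 : ℝ) • fundForm g Φ p) (conn g T p u) ![v, w] from rfl).trans ?_
      rw [derivAct_apply, derivAct_apply, mul_sub, Finset.mul_sum]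
      rfl
    rw [h3, h1, h2]
    refine Eq.trans ?_ (show (-2 : ℝ) * oneWedge (g p u) (oneForm (η p)) ![v, w] = _ from rfl)
    rw [oneWedge_oneForm_apply]
    simp only [map_sub, map_smul, sub_apply, smul_apply, smul_eq_mul, h.dual p hp]
    ring

end IsReebTorsion

end SpecialKilling

end SasakiTorsion

namespace SasakiTorsion

/-! ### Elementary symmetric polynomials and the functions `U_μ`, `N_μ / U_μ` -/

section Symmetric

/-- A function that is invariant under translations by `v` has zero derivative along `v`. -/
theorem fderiv_apply_eq_zero_of_invariant {E F : Type*} [NormedAddCommGroup E] [NormedSpace ℝ E]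
    [NormedAddCommGroup F] [NormedSpace ℝ F] {f : E → F} {p v : E}
    (h : ∀ t : ℝ, f (p + t • v) = f p) : fderiv ℝ f p v = 0 := by
  by_cases hf : DifferentiableAt ℝ f p
  · rw [← hf.lineDeriv_eq_fderiv, lineDeriv]
    simp [h]
  · rw [fderiv_zero_of_not_differentiableAt hf]
    simp

variable {ι : Type*}

/-- The elementary symmetric polynomial of degree `k` in the `x_ν`, `ν ∈ s`. -/
noncomputable def esymm (s : Finset ι) (k : ℕ) (x : ι → ℝ) : ℝ :=
  ∑ t ∈ s.powersetCard k, ∏ ν ∈ t, x ν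

theorem esymm_zero (s : Finset ι) (x : ι → ℝ) : esymm s 0 x = 1 := by
  simp [esymm]

/-- The `(k+1)`-subsets are sorted by whether they contain `a`. -/
theorem esymm_insert [DecidableEq ι] {s : Finset ι} {a : ι} (ha : a ∉ s) (k : ℕ) (x : ι → ℝ) :
    esymm (insert a s) (k + 1) x = esymm s (k + 1) x + x a * esymm s k x := by
  have hnot : ∀ t ∈ s.powersetCard k, a ∉ t := fun t ht hat =>
    ha ((Finset.mem_powersetCard.1 ht).1 hat)
  rw [esymm, Finset.powersetCard_succ_insert ha, Finset.sum_union, Finset.sum_image]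
  · rw [esymm, esymm, Finset.mul_sum]
    congr 1
    exact Finset.sum_congr rfl fun t ht => Finset.prod_insert (hnot t ht)
  · intro t ht t' ht' h
    rw [← Finset.erase_insert (hnot t ht), ← Finset.erase_insert (hnot t' ht')]
    exact congrArg (fun s => Finset.erase s a) h
  · rw [Finset.disjoint_left]
    intro t ht ht'
    obtain ⟨t', -, rfl⟩ := Finset.mem_image.1 ht'
    exact ha ((Finset.mem_powersetCard.1 ht).1 (Finset.mem_insert_self a t'))

theorem esymm_erase [DecidableEq ι] {s : Finset ι} {a : ι} (ha : a ∈ s) (k : ℕ) (x : ι → ℝ) :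
    esymm s (k + 1) x = esymm (s.erase a) (k + 1) x + x a * esymm (s.erase a) k x := by
  rw [← esymm_insert (Finset.notMem_erase a s), Finset.insert_erase ha]

theorem contDiff_esymm [Fintype ι] (s : Finset ι) (k : ℕ) : ContDiff ℝ ∞ (esymm s k) :=
  ContDiff.sum fun _ _ => contDiff_prod fun ν _ => contDiff_apply ℝ ℝ ν

theorem prod_sub_eq_sum_esymm [DecidableEq ι] (s : Finset ι) (x : ι → ℝ) (y : ℝ) :
    ∏ ν ∈ s, (y - x ν)
      = ∑ k ∈ Finset.range (s.card + 1), esymm s k x * ((-1) ^ k * y ^ (s.card - k)) := by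
  rw [Finset.prod_sub, Finset.sum_powerset]
  refine Finset.sum_congr rfl fun k _ => ?_
  rw [esymm, Finset.sum_mul]
  refine Finset.sum_congr rfl fun t ht => ?_
  obtain ⟨h1, h2⟩ := Finset.mem_powersetCard.1 ht
  rw [Finset.prod_const, Finset.card_sdiff_of_subset h1, h2]
  ring

theorem add_smul_single_apply_of_ne [DecidableEq ι] (x : ι → ℝ) {a b : ι} (hab : b ≠ a) (t : ℝ) :
    (x + t • (Pi.single a 1 : ι → ℝ)) b = x b := by
  simp [hab]

theorem fderiv_esymm_of_notMem [DecidableEq ι] [Fintype ι] {s : Finset ι} {a : ι} (ha : a ∉ s) (k : ℕ)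
    (x : ι → ℝ) : fderiv ℝ (esymm s k) x (Pi.single a 1) = 0 := by
  refine fderiv_apply_eq_zero_of_invariant fun t => Finset.sum_congr rfl fun u hu =>
    Finset.prod_congr rfl fun b hb => add_smul_single_apply_of_ne x ?_ t
  rintro rfl
  exact ha ((Finset.mem_powersetCard.1 hu).1 hb)

theorem fderiv_esymm_of_mem [DecidableEq ι] [Fintype ι] {s : Finset ι} {a : ι} (ha : a ∈ s) (k : ℕ)
    (x : ι → ℝ) :
    fderiv ℝ (esymm s (k + 1)) x (Pi.single a 1) = esymm (s.erase a) k x := by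
  have e : esymm s (k + 1)
      = fun x => esymm (s.erase a) (k + 1) x + x a * esymm (s.erase a) k x := by
    funext x; exact esymm_erase ha k x
  have hd := fun k => ((contDiff_esymm (s.erase a) k).differentiable (by simp) x).hasFDerivAt
  have h := (hd (k + 1)).add ((hasFDerivAt_apply (𝕜 := ℝ) a x).mul (hd k))
  rw [e]
  refine (DFunLike.congr_fun h.fderiv _).trans ?_
  simp [fderiv_esymm_of_notMem (Finset.notMem_erase a s)]

theorem fderiv_esymm_zero [Fintype ι] (s : Finset ι) (x : ι → ℝ) :
    fderiv ℝ (esymm s 0) x = 0 := by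
  have : esymm s 0 = fun _ => 1 := funext (esymm_zero s)
  rw [this]; simp

/-! ### Derivatives of the coefficient functions and inversion of the matrix `(σ_μ^{(k)})` -/

variable {n : ℕ}

theorem sigma_eq_esymm (k : ℕ) : sigma (n := n) k = esymm Finset.univ k := rfl

theorem sigmaOmit_eq_esymm (μ : Fin n) (k : ℕ) :
    sigmaOmit μ k = esymm (Finset.univ.erase μ) k := rfl

/-- With `μ` and `ν` both omitted, `∂_μ σ_ν^{(k+1)} = σ_{μν}^{(k)}`, while `σ_ν^{(k+1)} -
σ_μ^{(k+1)} = (x_μ - x_ν) σ_{μν}^{(k)}`. -/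
theorem fderiv_sigmaOmit (k : ℕ) (x : Fin n → ℝ) (μ ν : Fin n) :
    (x μ - x ν) * fderiv ℝ (sigmaOmit ν k) x (Pi.single μ 1)
      = sigmaOmit ν k x - sigmaOmit μ k x := by
  by_cases h : ν = μ
  · subst h; simp
  simp only [sigmaOmit_eq_esymm]
  have h1 : μ ∈ Finset.univ.erase ν := by simp [Ne.symm h]
  have h2 : ν ∈ Finset.univ.erase μ := by simp [h]
  cases k with
  | zero => rw [fderiv_esymm_zero]; simp [esymm_zero]
  | succ k =>
    rw [fderiv_esymm_of_mem h1, esymm_erase h1, esymm_erase h2, Finset.erase_right_comm]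
    ring

theorem fderiv_sigmaOmit_self (k : ℕ) (x : Fin n → ℝ) (μ : Fin n) :
    fderiv ℝ (sigmaOmit μ k) x (Pi.single μ 1) = 0 :=
  fderiv_esymm_of_notMem (Finset.notMem_erase μ _) k x

/-- At the point `x` the coordinates are pairwise distinct, the functions `X_μ`, `N_μ` are smooth
and `Q_μ > 0`. -/
structure IsRegularAt (X N : Fin n → ℝ → ℝ) (x : Fin n → ℝ) : Prop where
  smooth_left : ∀ μ, ContDiffAt ℝ ∞ (X μ) (x μ)
  smooth_right : ∀ μ, ContDiffAt ℝ ∞ (N μ) (x μ)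
  injective : ∀ μ ν, μ ≠ ν → x μ ≠ x ν
  pos : ∀ μ, 0 < Q X μ x

variable {X N : Fin n → ℝ → ℝ} {x : Fin n → ℝ}

theorem contDiff_U (μ : Fin n) : ContDiff ℝ ∞ (U μ) :=
  contDiff_prod fun ν _ => (contDiff_apply ℝ ℝ μ).sub (contDiff_apply ℝ ℝ ν)

namespace IsRegularAt

theorem U_ne_zero (h : IsRegularAt X N x) (μ : Fin n) : U μ x ≠ 0 :=
  Finset.prod_ne_zero_iff.2 fun ν hν =>
    sub_ne_zero.2 (h.injective μ ν (Finset.ne_of_mem_erase hν).symm)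

theorem contDiffAt_div_U {f : ℝ → ℝ} {μ : Fin n} (h : IsRegularAt X N x)
    (hf : ContDiffAt ℝ ∞ f (x μ)) : ContDiffAt ℝ ∞ (fun x => f (x μ) / U μ x) x :=
  (hf.comp x (contDiff_apply ℝ ℝ μ).contDiffAt).div (contDiff_U μ).contDiffAt (h.U_ne_zero μ)

theorem contDiffAt_Q (h : IsRegularAt X N x) (μ : Fin n) : ContDiffAt ℝ ∞ (Q X μ) x :=
  h.contDiffAt_div_U (h.smooth_left μ)

theorem contDiffAt_H (h : IsRegularAt X N x) : ContDiffAt ℝ ∞ (H N) x :=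
  ContDiffAt.sum fun μ _ => h.contDiffAt_div_U (h.smooth_right μ)

theorem contDiffAt_dH (h : IsRegularAt X N x) (μ : Fin n) : ContDiffAt ℝ ∞ (dH N μ) x :=
  (h.contDiffAt_H.fderiv_right (m := ∞) (by simp)).clm_apply contDiffAt_const

/-- For `ν ≠ μ` the variable `x_μ` enters `N_ν/U_ν` only through the single factor `x_ν - x_μ` of
`U_ν`. -/
theorem fderiv_div_U (h : IsRegularAt X N x) {μ ν : Fin n} (hne : ν ≠ μ) :
    (x ν - x μ) * fderiv ℝ (fun x => N ν (x ν) / U ν x) x (Pi.single μ 1)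
      = N ν (x ν) / U ν x := by
  let R : (Fin n → ℝ) → ℝ := fun x => ∏ l ∈ (Finset.univ.erase ν).erase μ, (x ν - x l)
  have hU : U ν = fun x => (x ν - x μ) * R x := by
    funext y
    exact (Finset.mul_prod_erase _ (fun l => y ν - y l) (by simp [hne.symm])).symm
  have hR : ContDiff ℝ ∞ R :=
    contDiff_prod fun l _ => (contDiff_apply ℝ ℝ ν).sub (contDiff_apply ℝ ℝ l)
  have hdR : fderiv ℝ R x (Pi.single μ 1) = 0 :=
    fderiv_apply_eq_zero_of_invariant fun t => Finset.prod_congr rfl fun l hl => by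
      rw [add_smul_single_apply_of_ne x hne, add_smul_single_apply_of_ne x
        (Finset.ne_of_mem_erase hl)]
  have hU0 := h.U_ne_zero ν
  have hsub := sub_ne_zero.2 (h.injective ν μ hne)
  have hR0 : R x ≠ 0 := fun h0 => hU0 (by rw [hU]; simp [h0])
  have hdU : fderiv ℝ (U ν) x (Pi.single μ 1) = -R x := by
    rw [hU]
    refine (DFunLike.congr_fun (((hasFDerivAt_apply (𝕜 := ℝ) ν x).sub
      (hasFDerivAt_apply (𝕜 := ℝ) μ x)).mul
        (hR.differentiable (by simp) x).hasFDerivAt).fderiv _).trans ?_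
    simp [hdR, hne]
  have hNd : DifferentiableAt ℝ (fun x : Fin n → ℝ => N ν (x ν)) x :=
    (((h.smooth_right ν).comp x (contDiff_apply ℝ ℝ ν).contDiffAt).differentiableAt (by simp))
  have hdN : fderiv ℝ (fun x : Fin n → ℝ => N ν (x ν)) x (Pi.single μ 1) = 0 :=
    fderiv_apply_eq_zero_of_invariant fun t => by rw [add_smul_single_apply_of_ne x hne]
  have hUd : DifferentiableAt ℝ (U ν) x := (contDiff_U ν).differentiable (by simp) x
  -- The product rule is applied to `(N_ν/U_ν) U_ν = N_ν`, whose right side has zero `μ`-derivative.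
  have key : (fun x : Fin n → ℝ => N ν (x ν) / U ν x * U ν x) =ᶠ[nhds x] fun x => N ν (x ν) := by
    filter_upwards [hUd.continuousAt.eventually_ne hU0] with y hy
    rw [div_mul_cancel₀ _ hy]
  have hfd : DifferentiableAt ℝ (fun x : Fin n → ℝ => N ν (x ν) / U ν x) x :=
    (h.contDiffAt_div_U (h.smooth_right ν)).differentiableAt (by simp)
  have e := DFunLike.congr_fun (key.fderiv_eq (𝕜 := ℝ)) (Pi.single μ 1 : Fin n → ℝ)
  rw [hdN] at e
  have e2 := (DFunLike.congr_fun (hfd.hasFDerivAt.mul hUd.hasFDerivAt).fderiv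
    (Pi.single μ 1)).symm.trans e
  simp only [add_apply, smul_apply, smul_eq_mul, hdU] at e2
  have hUx : U ν x = (x ν - x μ) * R x := by rw [hU]
  rw [hUx] at e2 ⊢
  have : R x * ((x ν - x μ) * fderiv ℝ (fun x => N ν (x ν) / U ν x) x (Pi.single μ 1)
      - N ν (x ν) / ((x ν - x μ) * R x)) = 0 := by linarith
  rcases mul_eq_zero.1 this with h0 | h0
  · exact absurd h0 hR0
  · linarith

end IsRegularAt

theorem fderiv_apply_eq_sum {F : Type*} [NormedAddCommGroup F] [NormedSpace ℝ F]
    (L : (Fin n → ℝ) →L[ℝ] F) (u : Fin n → ℝ) : L u = ∑ μ, u μ • L (Pi.single μ 1) := by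
  conv_lhs => rw [← Finset.univ_sum_single u, map_sum]
  refine Finset.sum_congr rfl fun μ _ => ?_
  have : (Pi.single μ (u μ) : Fin n → ℝ) = u μ • Pi.single μ (1 : ℝ) := by
    rw [← Pi.single_smul, smul_eq_mul, mul_one]
  rw [this, map_smul]

theorem theta_apply (μ : Fin n) (x : Fin n → ℝ) (v : Coord n) :
    theta μ x v = ∑ k : Fin n, sigmaOmit μ k x * v.2 k.succ := by
  simp [theta, dpsi, sum_apply]

theorem sigmaForm_apply (x : Fin n → ℝ) (v : Coord n) :
    sigmaForm x v = ∑ k : Fin (n + 1), sigma k x * v.2 k := by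
  simp [sigmaForm, dpsi, sum_apply]

theorem potA_apply (N : Fin n → ℝ → ℝ) (x : Fin n → ℝ) (v : Coord n) :
    potA N x v = ∑ μ, N μ (x μ) / U μ x * theta μ x v := by
  simp [potA, sum_apply]

theorem contDiff_theta (μ : Fin n) : ContDiff ℝ ∞ (theta μ) :=
  ContDiff.sum fun _ _ => (contDiff_esymm _ _).smul contDiff_const

theorem contDiff_sigmaForm : ContDiff ℝ ∞ (sigmaForm (n := n)) :=
  ContDiff.sum fun _ _ => (contDiff_esymm _ _).smul contDiff_const

theorem IsRegularAt.contDiffAt_potA (h : IsRegularAt X N x) : ContDiffAt ℝ ∞ (potA N) x :=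
  ContDiffAt.sum fun μ _ => (h.contDiffAt_div_U (h.smooth_right μ)).smul
    (contDiff_theta μ).contDiffAt

theorem fderiv_theta_apply (μ : Fin n) (x : Fin n → ℝ) (v : Coord n) (u : Fin n → ℝ) :
    fderiv ℝ (fun x => theta μ x v) x u
      = ∑ k : Fin n, fderiv ℝ (sigmaOmit μ k) x u * v.2 k.succ := by
  simp only [theta_apply]
  have h := HasFDerivAt.fun_sum (u := Finset.univ) fun (k : Fin n) _ =>
    (((contDiff_esymm (Finset.univ.erase μ) k).differentiable (by simp) x).hasFDerivAt).mul_const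
      (v.2 k.succ)
  refine (DFunLike.congr_fun h.fderiv u).trans ?_
  simp [sum_apply, mul_comm]
  rfl

/-- `d(∑_k σ^{(k)} dψ_k) = ∑_μ dx_μ ∧ θ_μ`. -/
theorem fderiv_sigmaForm (x u : Fin n → ℝ) (v : Coord n) :
    fderiv ℝ sigmaForm x u v = ∑ μ, u μ * theta μ x v := by
  rw [← fderiv_clm_apply_const (contDiff_sigmaForm.differentiable (by simp) x),
    fderiv_apply_eq_sum]
  refine Finset.sum_congr rfl fun μ _ => ?_
  rw [smul_eq_mul]
  congr 1
  simp only [sigmaForm_apply]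
  have h := HasFDerivAt.fun_sum (u := Finset.univ) fun (k : Fin (n + 1)) _ =>
    (((contDiff_esymm (Finset.univ : Finset (Fin n)) k).differentiable (by simp) x).hasFDerivAt
      ).mul_const (v.2 k)
  refine (DFunLike.congr_fun h.fderiv _).trans ?_
  rw [sum_apply, Fin.sum_univ_succ, theta_apply]
  simp only [smul_apply, Fin.val_zero, fderiv_esymm_zero, Fin.val_succ,
    fderiv_esymm_of_mem (Finset.mem_univ μ), smul_eq_mul]
  simp [mul_comm]
  rfl

/-- `dA = ∑_μ ∂_μ H dx_μ ∧ θ_μ`. -/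
theorem IsRegularAt.fderiv_potA (h : IsRegularAt X N x) (u : Fin n → ℝ) (v : Coord n) :
    fderiv ℝ (potA N) x u v = ∑ μ, u μ * (dH N μ x * theta μ x v) := by
  rw [← fderiv_clm_apply_const (h.contDiffAt_potA.differentiableAt (by simp)),
    fderiv_apply_eq_sum]
  refine Finset.sum_congr rfl fun μ _ => ?_
  rw [smul_eq_mul]
  congr 1
  simp only [potA_apply]
  have hf := fun ν => ((h.contDiffAt_div_U (h.smooth_right ν)).differentiableAt
    (by simp)).hasFDerivAt
  have hθ : ∀ ν, DifferentiableAt ℝ (fun x => theta ν x v) x := fun ν =>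
    ((contDiff_theta ν).clm_apply contDiff_const).differentiable (by simp) x
  have h1 := HasFDerivAt.fun_sum (u := Finset.univ) fun ν _ => (hf ν).mul (hθ ν).hasFDerivAt
  have h2 := HasFDerivAt.fun_sum (u := Finset.univ) fun ν _ => hf ν
  have hH : dH N μ x = ∑ ν, fderiv ℝ (fun x => N ν (x ν) / U ν x) x (Pi.single μ 1) := by
    refine (DFunLike.congr_fun h2.fderiv _).trans ?_
    rw [sum_apply]
  refine (DFunLike.congr_fun h1.fderiv _).trans ?_
  rw [sum_apply, hH, Finset.sum_mul]
  refine Finset.sum_congr rfl fun ν _ => ?_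
  simp only [add_apply, smul_apply, smul_eq_mul]
  by_cases hne : ν = μ
  · subst hne
    rw [fderiv_theta_apply]
    simp [fderiv_sigmaOmit_self, mul_comm]
  -- With `f_ν = N_ν/U_ν`, `e1` and `e2` combine so that the denominators cancel: `f_ν ∂_μθ_ν =
  -- ∂_μf_ν (θ_μ - θ_ν)`. Hence `∂_μ(f_ν θ_ν) = ∂_μf_ν θ_μ`, and summing over `ν` produces `∂_μH
  -- θ_μ`.
  · have e1 : (x μ - x ν) * fderiv ℝ (fun x => theta ν x v) x (Pi.single μ 1)
        = theta ν x v - theta μ x v := by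
      rw [fderiv_theta_apply, theta_apply, theta_apply, ← Finset.sum_sub_distrib, Finset.mul_sum]
      refine Finset.sum_congr rfl fun k _ => ?_
      rw [← mul_assoc, fderiv_sigmaOmit]
      ring
    have e2 := h.fderiv_div_U hne
    linear_combination (-fderiv ℝ (fun x => theta ν x v) x (Pi.single μ 1)) * e2
      - fderiv ℝ (fun x => N ν (x ν) / U ν x) x (Pi.single μ 1) * e1

/-- The inverse of the matrix `(σ_μ^{(k)})`. -/
noncomputable def invCoeff (x : Fin n → ℝ) (k μ : Fin n) : ℝ :=
  (-1) ^ (k : ℕ) * x μ ^ (n - 1 - k) / U μ x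

/-- This is Lagrange interpolation: by Vieta the sum is `∏_{l ≠ μ} (x_ν - x_l) / U_ν`, which has a
zero factor unless `ν = μ`. -/
theorem IsRegularAt.sum_sigmaOmit_mul (h : IsRegularAt X N x) (μ ν : Fin n) :
    ∑ k : Fin n, sigmaOmit μ k x * invCoeff x k ν = if μ = ν then 1 else 0 := by
  have hcard : (Finset.univ.erase μ).card = n - 1 := by simp
  have hn : n - 1 + 1 = n := Nat.sub_add_cancel (Nat.one_le_of_lt μ.isLt)
  have h1 := prod_sub_eq_sum_esymm (Finset.univ.erase μ) x (x ν)
  rw [hcard, hn, ← Fin.sum_univ_eq_sum_range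
    (fun k => esymm (Finset.univ.erase μ) k x * ((-1) ^ k * x ν ^ (n - 1 - k)))] at h1
  have h2 : ∑ k : Fin n, sigmaOmit μ k x * invCoeff x k ν
      = (∏ l ∈ Finset.univ.erase μ, (x ν - x l)) / U ν x := by
    rw [h1, Finset.sum_div]
    refine Finset.sum_congr rfl fun k _ => ?_
    rw [invCoeff, sigmaOmit_eq_esymm]
    ring
  rw [h2]
  split_ifs with hμν
  · subst hμν
    exact div_self (h.U_ne_zero μ)
  · rw [Finset.prod_eq_zero (i := ν) (by simp [Ne.symm hμν]) (sub_self _), zero_div]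

/-- A one-sided inverse of a square matrix is two-sided. -/
theorem IsRegularAt.sum_mul_sigmaOmit (h : IsRegularAt X N x) (j k : Fin n) :
    ∑ μ : Fin n, invCoeff x j μ * sigmaOmit μ k x = if j = k then 1 else 0 := by
  let M : Matrix (Fin n) (Fin n) ℝ := Matrix.of fun μ k => sigmaOmit μ k x
  let C : Matrix (Fin n) (Fin n) ℝ := Matrix.of fun k μ => invCoeff x k μ
  have hMC : M * C = 1 := by
    ext μ ν
    rw [Matrix.mul_apply, Matrix.one_apply]
    exact h.sum_sigmaOmit_mul μ ν
  have hCM : C * M = 1 := mul_eq_one_comm.1 hMC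
  have := congrFun (congrFun hCM j) k
  rwa [Matrix.mul_apply, Matrix.one_apply] at this

end Symmetric

end SasakiTorsion

namespace SasakiTorsion

/-! ### The coframe, the dual frame and the quasi-Sasakian structure of the explicit metric -/

section Frame

variable {n : ℕ} {X N : Fin n → ℝ → ℝ} {p : Coord n}

theorem dx_apply (μ : Fin n) (v : Coord n) : dx μ v = v.1 μ := rfl

theorem eForm_apply (μ : Fin n) (v : Coord n) :
    eForm X μ p v = (Real.sqrt (Q X μ p.1))⁻¹ * dx μ v := rfl

theorem eHatForm_apply (μ : Fin n) (v : Coord n) :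
    eHatForm X μ p v = Real.sqrt (Q X μ p.1) * theta μ p.1 v := rfl

theorem eta_apply (v : Coord n) : eta N p v = 2 * (sigmaForm p.1 v + potA N p.1 v) := rfl

/-- The `2`-form `κ = 2 ∑_μ ∂_μ H e^μ ∧ e^μ̂`, for which `T = κ ∧ η`. -/
noncomputable def horizontalForm (X N : Fin n → ℝ → ℝ) (p : Coord n) : Form (Coord n) 2 :=
  (2 : ℝ) • ∑ μ, dH N μ p.1 • oneWedge (eForm X μ p) (oneForm (eHatForm X μ p))

theorem horizontalForm_apply (u v : Coord n) :
    horizontalForm X N p ![u, v]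
      = ∑ μ, 2 * (dH N μ p.1 * (eForm X μ p u * eHatForm X μ p v
          - eForm X μ p v * eHatForm X μ p u)) := by
  rw [horizontalForm, ContinuousAlternatingMap.smul_apply, ContinuousAlternatingMap.sum_apply,
    Finset.smul_sum]
  refine Finset.sum_congr rfl fun μ _ => ?_
  rw [ContinuousAlternatingMap.smul_apply, oneWedge_oneForm_apply]
  rfl

theorem torsion_apply (u v w : Coord n) :
    torsion X N p ![u, v, w] = horizontalForm X N p ![u, v] * eta N p w
      + horizontalForm X N p ![v, w] * eta N p u + horizontalForm X N p ![w, u] * eta N p v := by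
  simp only [horizontalForm_apply]
  rw [torsion, ContinuousAlternatingMap.smul_apply, ContinuousAlternatingMap.sum_apply,
    Finset.smul_sum, Finset.sum_mul, Finset.sum_mul, Finset.sum_mul, ← Finset.sum_add_distrib,
    ← Finset.sum_add_distrib]
  refine Finset.sum_congr rfl fun μ _ => ?_
  have h0 : (0 : Fin 3).removeNth ![u, v, w] = ![v, w] := by funext i; fin_cases i <;> rfl
  have h1 : (1 : Fin 3).removeNth ![u, v, w] = ![u, w] := by funext i; fin_cases i <;> rfl
  have h2 : (2 : Fin 3).removeNth ![u, v, w] = ![u, v] := by funext i; fin_cases i <;> rfl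
  rw [ContinuousAlternatingMap.smul_apply, oneWedge_apply, Fin.sum_univ_three, h0, h1, h2]
  simp only [oneWedge_oneForm_apply, smul_eq_mul]
  simp
  ring

theorem pi_eq_sum_smulRight {ι E : Type*} [Fintype ι] [DecidableEq ι] [NormedAddCommGroup E]
    [NormedSpace ℝ E] (f : ι → E →L[ℝ] ℝ) :
    ContinuousLinearMap.pi f = ∑ a, (f a).smulRight (Pi.single a 1 : ι → ℝ) := by
  ext v b
  simp [sum_apply, Pi.single_apply]

namespace IsRegularAt

theorem sqrt_pos (h : IsRegularAt X N p.1) (μ : Fin n) : 0 < Real.sqrt (Q X μ p.1) :=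
  Real.sqrt_pos.2 (h.pos μ)

theorem dx_eq (h : IsRegularAt X N p.1) (μ : Fin n) (v : Coord n) :
    dx μ v = Real.sqrt (Q X μ p.1) * eForm X μ p v := by
  rw [eForm_apply, mul_inv_cancel_left₀ (h.sqrt_pos μ).ne']

theorem theta_eq (h : IsRegularAt X N p.1) (μ : Fin n) (v : Coord n) :
    theta μ p.1 v = (Real.sqrt (Q X μ p.1))⁻¹ * eHatForm X μ p v := by
  rw [eHatForm_apply, inv_mul_cancel_left₀ (h.sqrt_pos μ).ne']

/-- The square roots cancel in `e^μ ∧ e^μ̂ = dx_μ ∧ θ_μ`, so exterior derivatives never involve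
`X_μ`. -/
theorem eForm_mul_eHatForm (h : IsRegularAt X N p.1) (μ : Fin n) (u v : Coord n) :
    eForm X μ p u * eHatForm X μ p v = dx μ u * theta μ p.1 v := by
  rw [h.dx_eq, h.theta_eq]
  field_simp [(h.sqrt_pos μ).ne']

theorem metric_apply (h : IsRegularAt X N p.1) (u v : Coord n) :
    metric X N p u v = ∑ μ, eForm X μ p u * eForm X μ p v
      + ∑ μ, eHatForm X μ p u * eHatForm X μ p v + eta N p u * eta N p v := by
  have hs : ∀ μ, Real.sqrt (Q X μ p.1) * Real.sqrt (Q X μ p.1) = Q X μ p.1 := fun μ =>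
    Real.mul_self_sqrt (h.pos μ).le
  have h1 : metric X N p u v = ∑ μ, (Q X μ p.1)⁻¹ * (dx μ u * dx μ v)
      + ∑ μ, Q X μ p.1 * (theta μ p.1 u * theta μ p.1 v)
      + 4 * ((sigmaForm p.1 u + potA N p.1 u) * (sigmaForm p.1 v + potA N p.1 v)) := by
    simp [metric, sum_apply]
    ring
  rw [h1, eta_apply, eta_apply]
  congr 1
  · congr 1
    · refine Finset.sum_congr rfl fun μ _ => ?_
      rw [eForm_apply, eForm_apply]
      conv_lhs => rw [← hs μ, mul_inv]
      ring
    · refine Finset.sum_congr rfl fun μ _ => ?_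
      rw [eHatForm_apply, eHatForm_apply]
      conv_lhs => rw [← hs μ]
      ring
  · ring

theorem metric_eq_sum_coframe (h : IsRegularAt X N p.1) (u v : Coord n) :
    metric X N p u v = ∑ a, coframe X N p a u * coframe X N p a v := by
  rw [h.metric_apply, Fintype.sum_sum_type, Fintype.sum_sum_type]
  simp [coframe, add_assoc]

theorem snd_succ {x : Fin n → ℝ} (h : IsRegularAt X N x) (k : Fin n) (v : Coord n) :
    v.2 k.succ = ∑ μ, invCoeff x k μ * theta μ x v := by
  simp only [theta_apply, Finset.mul_sum]
  rw [Finset.sum_comm]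
  simp only [← mul_assoc, ← Finset.sum_mul, h.sum_mul_sigmaOmit]
  simp

/-- The inverse matrix recovers `dψ_k`, `k ≥ 1`, from the `θ_μ`; what is then left of `η` is `2
dψ_0`, as `σ^{(0)} = 1`. -/
theorem eq_zero (h : IsRegularAt X N p.1) {v : Coord n} (hx : ∀ μ, dx μ v = 0)
    (hθ : ∀ μ, theta μ p.1 v = 0) (hη : eta N p v = 0) : v = 0 := by
  have hs : ∀ k : Fin n, v.2 k.succ = 0 := fun k => by simp [h.snd_succ k, hθ]
  have h0 : v.2 0 = 0 := by
    rw [eta_apply, sigmaForm_apply, potA_apply, Fin.sum_univ_succ] at hη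
    simpa [hs, hθ, sigma_eq_esymm, esymm_zero] using hη
  refine Prod.ext (funext hx) (funext fun k => ?_)
  cases k using Fin.cases with
  | zero => exact h0
  | succ k => exact hs k

theorem eq_zero_of_coframe (h : IsRegularAt X N p.1) {v : Coord n}
    (hv : ∀ a, coframe X N p a v = 0) : v = 0 :=
  h.eq_zero (fun μ => by rw [h.dx_eq, show eForm X μ p v = 0 from hv (.inl μ), mul_zero])
    (fun μ => by rw [h.theta_eq, show eHatForm X μ p v = 0 from hv (.inr (.inl μ)), mul_zero])
    (hv (.inr (.inr ())))

/-- The definition of `frame` uses `ContinuousLinearMap.inverse`, so duality and smoothness of the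
frame rest on this invertibility. -/
theorem exists_equiv_coframe (h : IsRegularAt X N p.1) :
    ∃ e : Coord n ≃L[ℝ] (Fin n ⊕ Fin n ⊕ Unit → ℝ),
      (e : Coord n →L[ℝ] _) = ContinuousLinearMap.pi (coframe X N p) := by
  have hinj : Function.Injective 
      (ContinuousLinearMap.pi (coframe X N p) : Coord n →ₗ[ℝ] (Fin n ⊕ Fin n ⊕ Unit → ℝ)) :=
    (injective_iff_map_eq_zero _).2 fun v hv => h.eq_zero_of_coframe (congrFun hv)
  have hrank : Module.finrank ℝ (Coord n)
      = Module.finrank ℝ (Fin n ⊕ Fin n ⊕ Unit → ℝ) := by simp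
  exact ⟨(LinearEquiv.ofBijective _ ⟨hinj,
    (LinearMap.injective_iff_surjective_of_finrank_eq_finrank hrank).1 hinj⟩
      ).toContinuousLinearEquiv, by ext; rfl; rfl⟩

theorem coframe_frame (h : IsRegularAt X N p.1) (a b : Fin n ⊕ Fin n ⊕ Unit) :
    coframe X N p a (frame X N p b) = if a = b then 1 else 0 := by
  obtain ⟨e, he⟩ := h.exists_equiv_coframe
  have h1 : ContinuousLinearMap.pi (coframe X N p) (frame X N p b) = Pi.single b 1 := by
    rw [frame, ← he, ContinuousLinearMap.inverse_equiv]
    simp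
  exact (congrFun h1 a).trans (Pi.single_apply b (1 : ℝ) a)

theorem metric_frame (h : IsRegularAt X N p.1) (a b : Fin n ⊕ Fin n ⊕ Unit) :
    metric X N p (frame X N p a) (frame X N p b) = if a = b then 1 else 0 := by
  simp [h.metric_eq_sum_coframe, h.coframe_frame, eq_comm]

theorem eForm_Phi (h : IsRegularAt X N p.1) (μ : Fin n) (v : Coord n) :
    eForm X μ p (Phi X N p v) = -eHatForm X μ p v := by
  have h1 : ∀ b, eForm X μ p (frame X N p b) = if Sum.inl μ = b then 1 else 0 :=
    h.coframe_frame (.inl μ)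
  simp [Phi, sum_apply, h1]

theorem eHatForm_Phi (h : IsRegularAt X N p.1) (μ : Fin n) (v : Coord n) :
    eHatForm X μ p (Phi X N p v) = eForm X μ p v := by
  have h1 : ∀ b, eHatForm X μ p (frame X N p b) = if Sum.inr (Sum.inl μ) = b then 1 else 0 :=
    h.coframe_frame (.inr (.inl μ))
  simp [Phi, sum_apply, h1]

theorem eta_Phi (h : IsRegularAt X N p.1) (v : Coord n) : eta N p (Phi X N p v) = 0 := by
  have h1 : ∀ b, eta N p (frame X N p b) = if Sum.inr (Sum.inr ()) = b then 1 else 0 :=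
    h.coframe_frame (.inr (.inr ()))
  simp [Phi, sum_apply, h1]

theorem eForm_xi (h : IsRegularAt X N p.1) (μ : Fin n) : eForm X μ p (xi X N p) = 0 :=
  h.coframe_frame (.inl μ) _

theorem eHatForm_xi (h : IsRegularAt X N p.1) (μ : Fin n) : eHatForm X μ p (xi X N p) = 0 :=
  h.coframe_frame (.inr (.inl μ)) _

theorem eta_xi (h : IsRegularAt X N p.1) : eta N p (xi X N p) = 1 :=
  h.coframe_frame (.inr (.inr ())) _

theorem eq_of_coframe (h : IsRegularAt X N p.1) {u v : Coord n}
    (h1 : ∀ μ, eForm X μ p u = eForm X μ p v) (h2 : ∀ μ, eHatForm X μ p u = eHatForm X μ p v)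
    (h3 : eta N p u = eta N p v) : u = v := by
  refine sub_eq_zero.1 (h.eq_zero_of_coframe fun a => ?_)
  rw [map_sub, sub_eq_zero]
  rcases a with μ | μ | _
  exacts [h1 μ, h2 μ, h3]

/-- The forms `dx_μ` and `θ_μ` do not see `ψ_0`, and `η(∂/∂ψ_0) = 2σ^{(0)} = 2`. That `ξ` has
constant coefficients is what makes it Killing. -/
theorem xi_eq (h : IsRegularAt X N p.1) : xi X N p = (0, Pi.single 0 (1 / 2)) := by
  have hθ : ∀ μ, theta μ p.1 ((0, Pi.single 0 (1 / 2)) : Coord n) = 0 := fun μ => by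
    simp [theta_apply]
  refine h.eq_of_coframe (fun μ => ?_) (fun μ => ?_) ?_
  · rw [h.eForm_xi, eForm_apply]; simp [dx_apply]
  · rw [h.eHatForm_xi, eHatForm_apply, hθ, mul_zero]
  · rw [h.eta_xi, eta_apply, sigmaForm_apply, potA_apply, Fin.sum_univ_succ]
    simp only [hθ]
    simp [sigma_eq_esymm, esymm_zero]

theorem contDiffAt_sqrt_Q (h : IsRegularAt X N p.1) (μ : Fin n) :
    ContDiffAt ℝ ∞ (fun q : Coord n => Real.sqrt (Q X μ q.1)) p :=
  ((h.contDiffAt_Q μ).comp p contDiff_fst.contDiffAt).sqrt (h.pos μ).ne'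

theorem contDiffAt_eForm (h : IsRegularAt X N p.1) (μ : Fin n) :
    ContDiffAt ℝ ∞ (eForm X μ) p :=
  ((h.contDiffAt_sqrt_Q μ).inv (h.sqrt_pos μ).ne').smul contDiffAt_const

theorem contDiffAt_eHatForm (h : IsRegularAt X N p.1) (μ : Fin n) :
    ContDiffAt ℝ ∞ (eHatForm X μ) p :=
  (h.contDiffAt_sqrt_Q μ).smul ((contDiff_theta μ).comp contDiff_fst).contDiffAt

theorem contDiffAt_sigmaForm_add_potA (h : IsRegularAt X N p.1) :
    ContDiffAt ℝ ∞ (fun q : Coord n => sigmaForm q.1 + potA N q.1) p :=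
  (contDiff_sigmaForm.comp contDiff_fst).contDiffAt.add
    (h.contDiffAt_potA.comp p contDiff_fst.contDiffAt)

theorem contDiffAt_eta (h : IsRegularAt X N p.1) : ContDiffAt ℝ ∞ (eta N) p :=
  h.contDiffAt_sigmaForm_add_potA.const_smul (2 : ℝ)

theorem contDiffAt_metric (h : IsRegularAt X N p.1) : ContDiffAt ℝ ∞ (metric X N) p := by
  have hQ : ∀ μ, ContDiffAt ℝ ∞ (fun q : Coord n => Q X μ q.1) p := fun μ =>
    (h.contDiffAt_Q μ).comp p contDiff_fst.contDiffAt
  have hθ : ∀ μ, ContDiffAt ℝ ∞ (fun q : Coord n => theta μ q.1) p := fun μ =>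
    ((contDiff_theta μ).comp contDiff_fst).contDiffAt
  have hζ := h.contDiffAt_sigmaForm_add_potA
  exact ((ContDiffAt.sum fun μ _ => ((hQ μ).inv (h.pos μ).ne').smul contDiffAt_const).add
    (ContDiffAt.sum fun μ _ => (hQ μ).smul ((hθ μ).smulRight (hθ μ)))).add
      ((hζ.smulRight hζ).const_smul (4 : ℝ))

theorem contDiffAt_frame (h : IsRegularAt X N p.1) (a : Fin n ⊕ Fin n ⊕ Unit) :
    ContDiffAt ℝ ∞ (fun q => frame X N q a) p := by
  obtain ⟨e, he⟩ := h.exists_equiv_coframe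
  have hc : ∀ a, ContDiffAt ℝ ∞ (fun q => coframe X N q a) p := by
    rintro (μ | μ | _)
    exacts [h.contDiffAt_eForm μ, h.contDiffAt_eHatForm μ, h.contDiffAt_eta]
  have h1 : ContDiffAt ℝ ∞ (fun q => ContinuousLinearMap.pi (coframe X N q)) p := by
    simp only [pi_eq_sum_smulRight]
    exact ContDiffAt.sum fun a _ => (hc a).smulRight contDiffAt_const
  have h2 : ContDiffAt ℝ ∞ ContinuousLinearMap.inverse
      (ContinuousLinearMap.pi (coframe X N p)) := by
    rw [← he]
    exact contDiffAt_map_inverse e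
  exact (h2.comp p h1).clm_apply contDiffAt_const

theorem contDiffAt_Phi (h : IsRegularAt X N p.1) : ContDiffAt ℝ ∞ (Phi X N) p :=
  ContDiffAt.sum fun μ _ => ((h.contDiffAt_eForm μ).smulRight (h.contDiffAt_frame _)).sub
    ((h.contDiffAt_eHatForm μ).smulRight (h.contDiffAt_frame _))

theorem metric_Phi (h : IsRegularAt X N p.1) (u v : Coord n) :
    metric X N p (Phi X N p u) v
      = ∑ μ, (eForm X μ p u * eHatForm X μ p v - eForm X μ p v * eHatForm X μ p u) := by
  rw [h.metric_apply, Finset.sum_sub_distrib]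
  simp only [h.eForm_Phi, h.eHatForm_Phi, h.eta_Phi, neg_mul, Finset.sum_neg_distrib]
  simp only [mul_comm (eHatForm X _ p u)]
  ring

theorem fundForm_eq (h : IsRegularAt X N p.1) :
    fundForm (metric X N) (Phi X N) p
      = ∑ μ, oneWedge (eForm X μ p) (oneForm (eHatForm X μ p)) := by
  refine form_two_ext fun u v => ?_
  rw [fundForm_apply, h.metric_Phi, ContinuousAlternatingMap.sum_apply]
  · simp only [oneWedge_oneForm_apply]
  · rw [h.metric_Phi, h.metric_Phi, ← Finset.sum_neg_distrib]
    exact Finset.sum_congr rfl fun μ _ => by ring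

theorem fundForm_eq_extDeriv (h : IsRegularAt X N p.1) :
    fundForm (metric X N) (Phi X N) p
      = extDeriv (fun q : Coord n => oneForm (sigmaForm q.1)) p := by
  have hd : DifferentiableAt ℝ (sigmaForm (n := n)) p.1 :=
    contDiff_sigmaForm.differentiable (by simp) _
  have hf := (hd.hasFDerivAt.comp p hasFDerivAt_fst)
  rw [h.fundForm_eq]
  refine form_two_ext fun u v => ?_
  refine Eq.trans ?_ (extDeriv_oneForm_apply hf.differentiableAt u v).symm
  have hf' : ∀ u v, fderiv ℝ (fun q : Coord n => sigmaForm q.1) p u v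
      = ∑ μ, u.1 μ * theta μ p.1 v := fun u v =>
    (congrArg (fun L : Coord n →L[ℝ] Coord n →L[ℝ] ℝ => L u v) hf.fderiv).trans
      (fderiv_sigmaForm _ _ _)
  refine Eq.trans ?_ (congrArg₂ (· - ·) (hf' u v) (hf' v u)).symm
  rw [ContinuousAlternatingMap.sum_apply, ← Finset.sum_sub_distrib]
  refine Finset.sum_congr rfl fun μ _ => ?_
  rw [oneWedge_oneForm_apply, h.eForm_mul_eHatForm, h.eForm_mul_eHatForm]
  rfl

theorem extDeriv_eta (h : IsRegularAt X N p.1) :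
    extDeriv (fun q => oneForm (eta N q)) p
      = (2 : ℝ) • ∑ μ, (1 + dH N μ p.1) • oneWedge (eForm X μ p) (oneForm (eHatForm X μ p)) := by
  have hd : DifferentiableAt ℝ (sigmaForm (n := n)) p.1 :=
    contDiff_sigmaForm.differentiable (by simp) _
  have hA : DifferentiableAt ℝ (potA N) p.1 := h.contDiffAt_potA.differentiableAt (by simp)
  have hf := ((hd.hasFDerivAt.comp p hasFDerivAt_fst).add
    (hA.hasFDerivAt.comp p hasFDerivAt_fst)).const_smul (2 : ℝ)
  have hf' : ∀ u v, fderiv ℝ (eta N) p u v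
      = ∑ μ, 2 * ((1 + dH N μ p.1) * (u.1 μ * theta μ p.1 v)) := by
    intro u v
    refine (congrArg (fun L : Coord n →L[ℝ] Coord n →L[ℝ] ℝ => L u v) hf.fderiv).trans ?_
    refine (show _ = (2 : ℝ) * (fderiv ℝ sigmaForm p.1 u.1 v + fderiv ℝ (potA N) p.1 u.1 v)
      from rfl).trans ?_
    rw [fderiv_sigmaForm, h.fderiv_potA, ← Finset.sum_add_distrib, Finset.mul_sum]
    exact Finset.sum_congr rfl fun μ _ => by ring
  refine form_two_ext fun u v => ?_
  refine (extDeriv_oneForm_apply hf.differentiableAt u v).trans ?_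
  refine (congrArg₂ (· - ·) (hf' u v) (hf' v u)).trans ?_
  rw [ContinuousAlternatingMap.smul_apply, ContinuousAlternatingMap.sum_apply,
    ← Finset.sum_sub_distrib, Finset.smul_sum]
  refine Finset.sum_congr rfl fun μ _ => ?_
  rw [ContinuousAlternatingMap.smul_apply, oneWedge_oneForm_apply, h.eForm_mul_eHatForm,
    h.eForm_mul_eHatForm, dx_apply, dx_apply]
  simp only [smul_eq_mul]
  ring

end IsRegularAt

end Frame

end SasakiTorsion

namespace SasakiTorsion

/-! ### The general hypotheses verified for the explicit metric -/

section Structure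

variable {n : ℕ} {X N : Fin n → ℝ → ℝ} {D : Set (Coord n)}

theorem fderiv_snd_of_invariant {F : Type*} [NormedAddCommGroup F] [NormedSpace ℝ F]
    {f : Coord n → F} (h : ∀ p q : Coord n, p.1 = q.1 → f p = f q) (p : Coord n)
    (s : Fin (n + 1) → ℝ) : fderiv ℝ f p (0, s) = 0 :=
  fderiv_apply_eq_zero_of_invariant fun t => h _ _ (by simp)

/-- This and the next congruences say that no tensor depends on the `ψ_k`, the source of all the
symmetries `∂/∂ψ_k`. -/
theorem metric_congr {p q : Coord n} (h : p.1 = q.1) : metric X N p = metric X N q := by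
  simp only [metric, h]

theorem coframe_congr {p q : Coord n} (h : p.1 = q.1) : coframe X N p = coframe X N q := by
  funext a
  rcases a with μ | μ | _ <;> simp only [coframe, eForm, eHatForm, eta, h]

theorem frame_congr {p q : Coord n} (h : p.1 = q.1) : frame X N p = frame X N q := by
  funext a
  simp only [frame, coframe_congr h]

theorem Phi_congr {p q : Coord n} (h : p.1 = q.1) : Phi X N p = Phi X N q := by
  simp only [Phi, eForm, eHatForm, frame_congr h, h]

theorem torsion_congr {p q : Coord n} (h : p.1 = q.1) : torsion X N p = torsion X N q := by
  simp only [torsion, eForm, eHatForm, eta, h]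

theorem coneJ_congr {p q : Coord n × ℝ} (h : p.1.1 = q.1.1) (h' : p.2 = q.2) :
    coneJ X N p = coneJ X N q := by
  simp only [coneJ, xi, Phi_congr h, frame_congr h, eta, h, h']

theorem coneMetric_congr {p q : Coord n × ℝ} (h : p.1.1 = q.1.1) (h' : p.2 = q.2) :
    coneMetric (metric X N) p = coneMetric (metric X N) q := by
  simp only [coneMetric, metric_congr h, h']

theorem isRiemannianMetric_metric (hreg : ∀ p ∈ D, IsRegularAt X N p.1) :
    IsRiemannianMetric D (metric X N) where
  smooth p hp := (hreg p hp).contDiffAt_metric.contDiffWithinAt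
  symm p hp u v := by
    simp only [(hreg p hp).metric_eq_sum_coframe, mul_comm]
  pos p hp u hu := by
    rw [(hreg p hp).metric_eq_sum_coframe]
    obtain ⟨a, ha⟩ : ∃ a, coframe X N p a u ≠ 0 := by
      by_contra! hc
      exact hu ((hreg p hp).eq_zero_of_coframe hc)
    exact Finset.sum_pos' (fun a _ => mul_self_nonneg _)
      ⟨a, Finset.mem_univ a, mul_self_pos.2 ha⟩

theorem isAlmostContactMetric (hreg : ∀ p ∈ D, IsRegularAt X N p.1) :
    IsAlmostContactMetric D (metric X N) (xi X N) (eta N) (Phi X N) where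
  metric := isRiemannianMetric_metric hreg
  smooth_vec p hp := ((hreg p hp).contDiffAt_frame _).contDiffWithinAt
  smooth_form p hp := (hreg p hp).contDiffAt_eta.contDiffWithinAt
  smooth_end p hp := (hreg p hp).contDiffAt_Phi.contDiffWithinAt
  form_vec p hp := (hreg p hp).eta_xi
  sq p hp u := by
    have h := hreg p hp
    refine h.eq_of_coframe (fun μ => ?_) (fun μ => ?_) ?_
    · simp [h.eForm_Phi, h.eHatForm_Phi, h.eForm_xi]
    · simp [h.eForm_Phi, h.eHatForm_Phi, h.eHatForm_xi]
    · simp [h.eta_Phi, h.eta_xi]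
  compat p hp u v := by
    have h := hreg p hp
    simp only [h.metric_apply, h.eForm_Phi, h.eHatForm_Phi, h.eta_Phi, neg_mul_neg]
    ring

theorem isKilling_metric_const (s : Fin (n + 1) → ℝ) :
    IsKilling D (metric X N) (fun _ => (0, s)) where
  smooth := contDiffOn_const
  lie p _ u w := by
    simp [lieMetric, fderiv_snd_of_invariant fun p q h => metric_congr (X := X) (N := N) h]

theorem IsKilling.congr {E : Type*} [NormedAddCommGroup E] [NormedSpace ℝ E] {D : Set E}
    (hD : IsOpen D) {g : E → Bilin E} {V W : E → E} (hV : IsKilling D g V)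
    (h : ∀ p ∈ D, W p = V p) : IsKilling D g W where
  smooth := hV.smooth.congr h
  lie p hp u w := by
    have e : W =ᶠ[nhds p] V := by
      filter_upwards [hD.mem_nhds hp] with q hq using h q hq
    rw [← hV.lie p hp u w, lieMetric, lieMetric, e.fderiv_eq, e.eq_of_nhds]

theorem contDiffOn_torsion (hreg : ∀ p ∈ D, IsRegularAt X N p.1) :
    ContDiffOn ℝ ∞ (torsion X N) D := by
  have he : ∀ μ, ContDiffOn ℝ ∞ (eForm X μ) D := fun μ p hp =>
    ((hreg p hp).contDiffAt_eForm μ).contDiffWithinAt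
  have he' : ∀ μ, ContDiffOn ℝ ∞ (eHatForm X μ) D := fun μ p hp =>
    ((hreg p hp).contDiffAt_eHatForm μ).contDiffWithinAt
  have hη : ContDiffOn ℝ ∞ (eta N) D := fun p hp =>
    (hreg p hp).contDiffAt_eta.contDiffWithinAt
  have hH : ∀ μ, ContDiffOn ℝ ∞ (fun q : Coord n => dH N μ q.1) D := fun μ p hp =>
    (((hreg p hp).contDiffAt_dH μ).comp p contDiff_fst.contDiffAt).contDiffWithinAt
  exact (ContDiffOn.sum fun μ _ => (hH μ).smul (contDiffOn_oneWedge (he μ)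
    (contDiffOn_oneWedge (he' μ) (contDiff_oneForm.comp_contDiffOn hη)))).const_smul (2 : ℝ)

/-- Near each point of `D`, `ω` is the exterior derivative of a form that is smooth everywhere, so
`d² = 0` applies. -/
theorem extDeriv_fundForm_eq_zero (hD : IsOpen D) (hreg : ∀ p ∈ D, IsRegularAt X N p.1)
    {p : Coord n} (hp : p ∈ D) : extDeriv (fundForm (metric X N) (Phi X N)) p = 0 := by
  have e : fundForm (metric X N) (Phi X N) =ᶠ[nhds p]
      extDeriv (fun q : Coord n => oneForm (sigmaForm q.1)) := by
    filter_upwards [hD.mem_nhds hp] with q hq using (hreg q hq).fundForm_eq_extDeriv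
  have hc : ContDiff ℝ ∞ (fun q : Coord n => oneForm (sigmaForm q.1)) :=
    contDiff_oneForm.comp (contDiff_sigmaForm.comp contDiff_fst)
  refine e.extDeriv_eq.trans ?_
  refine congrFun (extDeriv_extDeriv hc ?_) p
  rw [minSmoothness_of_isRCLikeNormedField]
  exact WithTop.coe_le_coe.2 le_top

theorem isReebTorsion (hD : IsOpen D) (hreg : ∀ p ∈ D, IsRegularAt X N p.1) :
    IsReebTorsion D (metric X N) (xi X N) (eta N) (Phi X N) (horizontalForm X N)
      (torsion X N) where
  contact := isAlmostContactMetric hreg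
  closed p hp := extDeriv_fundForm_eq_zero hD hreg hp
  killing := (isKilling_metric_const _).congr hD fun p hp => (hreg p hp).xi_eq
  dual p hp v := by
    have h := hreg p hp
    simp [h.metric_apply, h.eForm_xi, h.eHatForm_xi, h.eta_xi]
  end_vec p hp := by
    have h := hreg p hp
    exact h.eq_of_coframe (fun μ => by rw [h.eForm_Phi, h.eHatForm_xi]; simp)
      (fun μ => by rw [h.eHatForm_Phi, h.eForm_xi]; simp) (by rw [h.eta_Phi]; simp)
  smooth_torsion := contDiffOn_torsion hreg
  basic p hp v := by
    have h := hreg p hp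
    simp [horizontalForm_apply, h.eForm_xi, h.eHatForm_xi]
  invariant p hp u v := by
    have h := hreg p hp
    rw [horizontalForm_apply, horizontalForm_apply, ← Finset.sum_neg_distrib]
    refine Finset.sum_congr rfl fun μ _ => ?_
    rw [h.eForm_Phi, h.eHatForm_Phi, h.eForm_Phi, h.eHatForm_Phi]
    ring
  extDeriv_form p hp u v := by
    have h := hreg p hp
    rw [h.extDeriv_eta, horizontalForm_apply, h.metric_Phi, ContinuousAlternatingMap.smul_apply,
      ContinuousAlternatingMap.sum_apply, Finset.smul_sum, Finset.mul_sum,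
      ← Finset.sum_add_distrib]
    refine Finset.sum_congr rfl fun μ _ => ?_
    rw [ContinuousAlternatingMap.smul_apply, oneWedge_oneForm_apply, smul_eq_mul, smul_eq_mul]
    ring
  torsion_eq _ _ u v w := torsion_apply u v w

/-- The closed `1`-forms `dψ_k ∘ Φ = ∑_μ (-1)^{k-1} x_μ^{n-k} / X_μ dx_μ`. -/
noncomputable def dualForm (X : Fin n → ℝ → ℝ) (k : Fin n) (p : Coord n) : Coord n →L[ℝ] ℝ :=
  ∑ μ, ((-1) ^ (k : ℕ) * p.1 μ ^ (n - 1 - k) / X μ (p.1 μ)) • dx μ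

namespace IsRegularAt

variable {p : Coord n}

theorem dualForm_apply (h : IsRegularAt X N p.1) (k : Fin n) (v : Coord n) :
    dualForm X k p v = ∑ μ, invCoeff p.1 k μ * ((Real.sqrt (Q X μ p.1))⁻¹ * eForm X μ p v) := by
  rw [dualForm, sum_apply]
  refine Finset.sum_congr rfl fun μ _ => ?_
  have hU := h.U_ne_zero μ
  have hs := (h.sqrt_pos μ).ne'
  have hX : X μ (p.1 μ) = Real.sqrt (Q X μ p.1) * Real.sqrt (Q X μ p.1) * U μ p.1 := by
    rw [Real.mul_self_sqrt (h.pos μ).le, Q, div_mul_cancel₀ _ hU]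
  rw [smul_apply, smul_eq_mul, h.dx_eq, invCoeff, hX]
  field_simp

theorem dpsi_succ_apply (h : IsRegularAt X N p.1) (k : Fin n) (v : Coord n) :
    dpsi k.succ v
      = ∑ μ, invCoeff p.1 k μ * ((Real.sqrt (Q X μ p.1))⁻¹ * eHatForm X μ p v) := by
  simp only [← h.theta_eq]
  exact h.snd_succ k v

theorem ne_zero (h : IsRegularAt X N p.1) (μ : Fin n) : X μ (p.1 μ) ≠ 0 := fun h0 =>
  (h.pos μ).ne' (by rw [Q, h0, zero_div])

theorem contDiffAt_dualCoeff (h : IsRegularAt X N p.1) (k μ : Fin n) :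
    ContDiffAt ℝ ∞ (fun y : ℝ => (-1) ^ (k : ℕ) * y ^ (n - 1 - k) / X μ y) (p.1 μ) :=
  (contDiffAt_const.mul (contDiffAt_id.pow _)).div (h.smooth_left μ) (h.ne_zero μ)

theorem contDiffAt_dualForm (h : IsRegularAt X N p.1) (k : Fin n) :
    ContDiffAt ℝ ∞ (dualForm X k) p :=
  ContDiffAt.sum fun μ _ => ((h.contDiffAt_dualCoeff k μ).comp p
    ((contDiff_apply ℝ ℝ μ).comp contDiff_fst).contDiffAt).smul contDiffAt_const

/-- Each coefficient depends on its own `x_μ` only, so the Jacobian is diagonal in the `dx_μ`. Its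
symmetry is closedness. -/
theorem fderiv_dualForm (h : IsRegularAt X N p.1) (k : Fin n) (u v : Coord n) :
    fderiv ℝ (dualForm X k) p u v
      = ∑ μ, deriv (fun y : ℝ => (-1) ^ (k : ℕ) * y ^ (n - 1 - k) / X μ y) (p.1 μ)
          * (dx μ u * dx μ v) := by
  let f : Fin n → ℝ → ℝ := fun μ y => (-1) ^ (k : ℕ) * y ^ (n - 1 - k) / X μ y
  have hc : ∀ μ, HasFDerivAt (fun q : Coord n => f μ (q.1 μ) • dx μ)
      ((deriv (f μ) (p.1 μ) • dx μ).smulRight (dx μ)) p := fun μ =>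
    HasFDerivAt.smul_const (HasDerivAt.comp_hasFDerivAt p (h₂ := f μ) (f := dx μ)
      ((h.contDiffAt_dualCoeff k μ).differentiableAt (by simp)).hasDerivAt
      (dx μ).hasFDerivAt) (dx μ)
  have hs := HasFDerivAt.fun_sum (u := Finset.univ) fun μ _ => hc μ
  refine (congrArg (fun L : Coord n →L[ℝ] Coord n →L[ℝ] ℝ => L u v) hs.fderiv).trans ?_
  simp [sum_apply, mul_assoc, f]

end IsRegularAt

theorem isHolomorphicFamily (hreg : ∀ p ∈ D, IsRegularAt X N p.1) :
    IsHolomorphicFamily D (eta N) (Phi X N) (fun (k : Fin n) _ => dpsi k.succ) (dualForm X) where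
  smooth_left _ := contDiffOn_const
  smooth_right k p hp := ((hreg p hp).contDiffAt_dualForm k).contDiffWithinAt
  closed_left k p hp u v := by simp
  closed_right k p hp u v := by
    rw [(hreg p hp).fderiv_dualForm, (hreg p hp).fderiv_dualForm]
    exact Finset.sum_congr rfl fun μ _ => by ring
  left_comp k p hp v := by
    have h := hreg p hp
    rw [h.dpsi_succ_apply, h.dualForm_apply]
    simp only [h.eHatForm_Phi]
  right_comp k p hp v := by
    have h := hreg p hp
    rw [h.dpsi_succ_apply, h.dualForm_apply, ← Finset.sum_neg_distrib]
    refine Finset.sum_congr rfl fun μ _ => ?_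
    rw [h.eForm_Phi]
    ring
  separating p hp v hη hα hβ := by
    have h := hreg p hp
    refine h.eq_zero (fun ν => ?_) (fun ν => ?_) hη
    -- Contracting with `σ_ν^{(k)}` inverts `invCoeff` and isolates the `e^ν` component.
    · have e : ∑ k : Fin n, sigmaOmit ν k p.1 * dualForm X k p v
          = (Real.sqrt (Q X ν p.1))⁻¹ * eForm X ν p v := by
        simp only [h.dualForm_apply, Finset.mul_sum]
        rw [Finset.sum_comm]
        simp only [← mul_assoc, ← Finset.sum_mul, h.sum_sigmaOmit_mul]
        simp
      simp only [hβ, mul_zero, Finset.sum_const_zero] at e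
      rw [h.dx_eq, (mul_eq_zero.1 e.symm).resolve_left (inv_ne_zero (h.sqrt_pos ν).ne'), mul_zero]
    · rw [theta_apply]
      exact Finset.sum_eq_zero fun k _ => by rw [show v.2 k.succ = 0 from hα k, mul_zero]

/-! ### Invariance of the cone structure under translations in `ψ` -/

theorem fderiv_cone_of_invariant {F : Type*} [NormedAddCommGroup F] [NormedSpace ℝ F]
    {f : Coord n × ℝ → F} (h : ∀ p q : Coord n × ℝ, p.1.1 = q.1.1 → p.2 = q.2 → f p = f q)
    (q : Coord n × ℝ) (s : Fin (n + 1) → ℝ) : fderiv ℝ f q ((0, s), 0) = 0 :=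
  fderiv_apply_eq_zero_of_invariant fun t => h _ _ (by simp) (by simp)

theorem isKilling_coneMetric_const (s : Fin (n + 1) → ℝ) :
    IsKilling (coneDomain D) (coneMetric (metric X N)) (fun _ => ((0, s), 0)) where
  smooth := contDiffOn_const
  lie q _ u w := by
    simp [lieMetric, fderiv_cone_of_invariant
      fun p q h h' => coneMetric_congr (X := X) (N := N) h h']

theorem lieEnd_coneJ (s : Fin (n + 1) → ℝ) (q : Coord n × ℝ) :
    lieEnd (fun _ => ((0, s), 0)) (coneJ X N) q = 0 := by
  simp [lieEnd, fderiv_cone_of_invariant fun p q h h' => coneJ_congr (X := X) (N := N) h h']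

theorem lieForm_of_invariant {k : ℕ} {φ : Coord n × ℝ → Form (Coord n × ℝ) k}
    (h : ∀ p q : Coord n × ℝ, p.1.1 = q.1.1 → p.2 = q.2 → φ p = φ q) (s : Fin (n + 1) → ℝ)
    (q : Coord n × ℝ) : lieForm (fun _ => ((0, s), 0)) φ q = 0 := by
  simp [lieForm, fderiv_cone_of_invariant h]

end Structure

end SasakiTorsion

open SasakiTorsion in
theorem mainTheorem6 (n : ℕ) (X N : Fin n → ℝ → ℝ)
    (D : Set (SasakiTorsion.Coord n)) (hD : IsOpen D)
    (hX : ∀ p ∈ D, ∀ μ, ContDiffAt ℝ ∞ (X μ) (p.1 μ))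
    (hN : ∀ p ∈ D, ∀ μ, ContDiffAt ℝ ∞ (N μ) (p.1 μ))
    (hdist : ∀ p ∈ D, ∀ μ ν, μ ≠ ν → p.1 μ ≠ p.1 ν)
    (hQ : ∀ p ∈ D, ∀ μ, 0 < SasakiTorsion.Q X μ p.1) :
    -- the metric is Riemannian, and the frame `e_a` is orthonormal with dual coframe `e^a`
    SasakiTorsion.IsRiemannianMetric D (SasakiTorsion.metric X N) ∧
    (∀ p ∈ D, ∀ a b,
      SasakiTorsion.coframe X N p a (SasakiTorsion.frame X N p b) = (if a = b then 1 else 0) ∧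
      SasakiTorsion.metric X N p (SasakiTorsion.frame X N p a) (SasakiTorsion.frame X N p b) =
        (if a = b then 1 else 0)) ∧
    -- the Sasaki with torsion structure
    SasakiTorsion.IsSasakiWithTorsion D (SasakiTorsion.metric X N)
      (SasakiTorsion.torsion X N) ∧
    SasakiTorsion.IsSTStructure D (SasakiTorsion.metric X N) (SasakiTorsion.torsion X N)
      (SasakiTorsion.xi X N) (SasakiTorsion.Phi X N) ∧
    (∀ p ∈ D, SasakiTorsion.dT (SasakiTorsion.metric X N) (SasakiTorsion.torsion X N)
        (fun q => SasakiTorsion.oneForm (SasakiTorsion.eta N q)) p =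
      (2 : ℝ) • SasakiTorsion.fundForm (SasakiTorsion.metric X N) (SasakiTorsion.Phi X N) p) ∧
    -- the cone is Kähler with torsion, with Bismut torsion `r² T`
    SasakiTorsion.IsKahlerWithTorsion (SasakiTorsion.coneDomain D)
      (SasakiTorsion.coneMetric (SasakiTorsion.metric X N)) (SasakiTorsion.coneJ X N)
      (SasakiTorsion.coneForm (SasakiTorsion.torsion X N)) ∧
    -- the metric is quasi-Sasakian, with exact fundamental form
    SasakiTorsion.IsQuasiSasakian D (SasakiTorsion.metric X N) (SasakiTorsion.xi X N)
      (SasakiTorsion.eta N) (SasakiTorsion.Phi X N) ∧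
    (∀ p ∈ D,
      SasakiTorsion.fundForm (SasakiTorsion.metric X N) (SasakiTorsion.Phi X N) p =
        ∑ μ, SasakiTorsion.oneWedge (SasakiTorsion.eForm X μ p)
          (SasakiTorsion.oneForm (SasakiTorsion.eHatForm X μ p)) ∧
      SasakiTorsion.fundForm (SasakiTorsion.metric X N) (SasakiTorsion.Phi X N) p =
        extDeriv (fun q : SasakiTorsion.Coord n =>
          SasakiTorsion.oneForm (SasakiTorsion.sigmaForm q.1)) p ∧
      extDeriv (fun q => SasakiTorsion.oneForm (SasakiTorsion.eta N q)) p =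
        (2 : ℝ) • ∑ μ, (1 + SasakiTorsion.dH N μ p.1) •
          SasakiTorsion.oneWedge (SasakiTorsion.eForm X μ p)
            (SasakiTorsion.oneForm (SasakiTorsion.eHatForm X μ p))) ∧
    -- the coordinate fields `∂/∂ψ_k` are Killing and preserve the structure of the cone
    (∀ k : Fin (n + 1),
      SasakiTorsion.IsKilling D (SasakiTorsion.metric X N) (SasakiTorsion.partialPsi k) ∧
      SasakiTorsion.IsKilling (SasakiTorsion.coneDomain D)
        (SasakiTorsion.coneMetric (SasakiTorsion.metric X N))
        (fun q => (SasakiTorsion.partialPsi k q.1, 0)) ∧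
      ∀ q ∈ SasakiTorsion.coneDomain D,
        SasakiTorsion.lieEnd (fun q => (SasakiTorsion.partialPsi k q.1, 0))
          (SasakiTorsion.coneJ X N) q = 0 ∧
        SasakiTorsion.lieForm (fun q => (SasakiTorsion.partialPsi k q.1, 0))
          (SasakiTorsion.fundForm (SasakiTorsion.coneMetric (SasakiTorsion.metric X N))
            (SasakiTorsion.coneJ X N)) q = 0 ∧
        SasakiTorsion.lieForm (fun q => (SasakiTorsion.partialPsi k q.1, 0))
          (SasakiTorsion.coneForm (SasakiTorsion.torsion X N)) q = 0) ∧
    -- the forms `η ∧ (d^T η)^ℓ` are special Killing forms with torsion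
    (∀ ℓ : ℕ, ℓ ≤ n →
      SasakiTorsion.IsSpecialKilling D (SasakiTorsion.metric X N) (SasakiTorsion.torsion X N)
        (SasakiTorsion.etaPow X N ℓ) (-2 * ((ℓ : ℝ) + 1))) := by
  have hreg : ∀ p ∈ D, IsRegularAt X N p.1 := fun p hp =>
    ⟨hX p hp, hN p hp, hdist p hp, hQ p hp⟩
  have hR := isReebTorsion hD hreg
  have hα := isHolomorphicFamily hreg
  have hnormal := fun p hp u v => hR.normal hD hα (p := p) hp u v
  -- `coneJ X N` unfolds to `coneEnd` of the explicit `ξ`, `η`, `Φ`, so the general cone theorem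
  -- applies by definition.
  have hcone : IsKahlerWithTorsion (coneDomain D) (coneMetric (metric X N)) (coneJ X N)
      (coneForm (torsion X N)) := hR.isKahlerWithTorsion_cone hD hα
  refine ⟨hR.contact.metric, fun p hp a b => ⟨(hreg p hp).coframe_frame a b,
    (hreg p hp).metric_frame a b⟩, ⟨hR.contact.metric, hR.smooth_torsion, _, hcone⟩,
    hR.isSTStructure hD hnormal, fun p hp => hR.dT_form hD hp, hcone, hR.isQuasiSasakian hD hα,
    fun p hp => ⟨(hreg p hp).fundForm_eq, (hreg p hp).fundForm_eq_extDeriv,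
      (hreg p hp).extDeriv_eta⟩,
    fun k => ⟨isKilling_metric_const _, isKilling_coneMetric_const _, fun q _ =>
      ⟨lieEnd_coneJ _ q, lieForm_of_invariant (fun p q h h' => ?_) _ q,
        lieForm_of_invariant (fun p q h h' => ?_) _ q⟩⟩,
    fun l _ => hR.isSpecialKilling hD hnormal l⟩
  · simp only [fundForm, coneMetric_congr h h', coneJ_congr h h']
  · simp only [coneForm, torsion_congr h, h']
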